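/- **Model.** Let $T\ge 2$, $0<\alpha\le 1$, let $c_0,\dots,c_T\in\mathbb R$, $K_0,\dots,K_{T-1}\ge 0$, $G_0,\dots,G_{T-1}:\mathbb R\to\mathbb R$, and let the demands $D_0,\dots,D_{T-1}$ be independent, non-negative, integrable random variables with distribution functions $F_t$. If the inventory level at the beginning of period $t<T$ is $x_t$ and the level is raised to $y_t\ge x_t$, then the cost $K_t\delta(y_t-x_t)+c_t(y_t-x_t)+G_t(y_t)$ is incurred ($\delta(z)=1$ for $z>0$, $\delta(0)=0$) and $x_{t+1}=y_t-D_t$; at time $T$ the cost $-c_Tx_T$ is incurred. Costs of period $t$ are discounted by $\alpha^t$. A policy prescribes $y_t$ as a measurable function of $x_t$; $v_0(x)$ is the minimal total expected discounted cost from $x_0=x$ over all policies with finite expected cost, and $v^\pi_0(x)$ is the total expected discounted cost of a policy $\pi$. Put $C_t(y)=(c_t-\alpha c_{t+1})y+G_t(y)+\alpha c_{t+1}E[D_t]$. Assume that, for $0\le t\le T-1$, $C_t$ is convex, $C_t(y)\to+\infty$ as $|y|\to\infty$, and $|C_t(x)-C_t(y)|\le\gamma_t|x-y|$ for all $x,y$,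 where $\gamma_t\ge0$; and that $K_t\ge\alpha K_{t+1}$ for $0\le t\le T-2$. **The approximate policy.** Let $\theta>0$, $z_m=m\theta$ ($m\in\mathbb Z$), $Z_\theta=\{z_m\}$, $f_t(n)=F_t(z_{n+1})-F_t(z_n)$. Let $C^m_t$ be the least minimizer of $C_t$ and $S^U_t=\min\{z_m\ge C^m_t: C_t(z_m)>C_t(z_{n_0})+K_t\}$, where $z_{n_0}<C^m_t\le z_{n_0+1}$. Let $H_{T-1}=C_{T-1}$, $S_{T-1}=C^m_{T-1}$, let $s_{T-1}=\bar I_{T-1}$ be the point $y\le C^m_{T-1}$ with $C_{T-1}(y)=C_{T-1}(C^m_{T-1})+K_{T-1}$. For every $t\le T-1$ let $V_t(y)=H_t(S_t)+K_t$ if $y<s_t$ and $V_t(y)=H_t(y)$ if $y\ge s_t$. For $t=T-2,\dots,0$ let, with all maxima and minima over grid points, $$I_t=\max\{z_m<\min(\bar I_{t+1}-\theta,C^m_t)\},\qquad \bar I_t=\max\{z_m\le I_t: C_t(z_m)>C_t(I_t)+K_t\}+\theta,$$ $$H_t(y)=C_t(y)+\alpha\sum_{n=-1}^\infty V_{t+1}(y-z_n)f_t(n),$$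 let $S_t$ be the largest grid point of $[I_t,S^U_t]$ at which $H_t$ attains its minimum over the grid points of $[I_t,S^U_t]$, and let $s_t=S_t$ if $K_t=0$ and $s_t=\min\{z_m\in[\bar I_t,S_t]: H_t(z_m)\le H_t(S_t)+K_t\}$ if $K_t>0$. The policy $\pi=\pi_\theta$ orders up to $S_t$ if $x_t<s_t$ and does not order if $x_t\ge s_t$. **The bounds.** Let $\psi_{T-1}(x,y)=\bar\psi_{T-1}(x,y)=\gamma_{T-1}x$, and let $\varphi_{T-1}(x,y)=\bar\varphi_{T-1}(x,y)$ be $0$ if $y<s_{T-1}$ and $\gamma_{T-1}x$ if $y\ge s_{T-1}$. For $t\le T-2$ let $\psi_t(x,y)=\gamma_tx$ if $y<s_{t+1}-\theta$, and otherwise $$\psi_t(x,y)=\gamma_tx+\alpha\sum_{m=-1}^{n-1}\varphi_{t+1}(x,y-z_m)f_t(m),\qquad z_{n-1}\le y-s_{t+1}<z_n;$$ let $\varphi_t(x,y)$ be $0$ if $y<s_t$, $\psi_t(y-s_t,y)$ if $y\ge s_t>y-x$, and $\psi_t(x,y)$ if $y\ge s_t$ and $y-x\ge s_t$. Define $\bar\psi_t,\bar\varphi_t$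 in the same way with bars throughout, except that $\bar\varphi_t(x,y)=\bar\psi_t(y-s_t+\theta,y)$ if $y\ge s_t>y-x$. Let $\bar\omega_{T-1}=0$ and, for $t\le T-2$, $$\omega_t(x)=\psi_t(\theta,x)-\gamma_t\theta+\alpha\sum_{n=-1}^\infty\bar\omega_{t+1}(x-z_n)f_t(n),\qquad \eta_t=\bar\psi_t(\theta,S^U_t)+\omega_t(S^U_t),$$ $\bar\omega_t(x)=\eta_t$ if $x\le S^U_t$ and $\bar\omega_t(x)=\max(\eta_t,\omega_t(x))$ if $x>S^U_t$. For $z\in Z_\theta$ let $\lambda(0)=\mu(0)=z$, $\lambda(i)=\max(\lambda(i-1),S_{i-1})+\theta$, $\mu(i)=\max(\mu(i-1),S^U_{i-1})+\theta$. Empty sums being $0$, let $$\bar\varepsilon_0(z)=\alpha^{T-1}\gamma_{T-1}\theta+\sum_{i=0}^{T-3}2\alpha^i\big[\bar\psi_i(\theta,\max(\lambda(i),S_i))-\gamma_i\theta\big].$$ With $\Pi_{i,n}(y)=\prod_{m=0}^{n-1}F_{i+m}(y+(m+1)\theta-s_{i+m+1})$ let $$U^\omega_0(z)=\theta\sum_{i=0}^{T-2}\alpha^i\gamma_i+\theta\sum_{i=0}^{T-2}\sum_{n=1}^{T-1-i}\alpha^{n+i}\gamma_{i+n}\big[\Pi_{i,n}(S^U_i)+\Pi_{i,n}(\max(\mu(i),S^U_i))\big],$$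 $$U^\varepsilon_0(z)=\alpha^{T-1}\gamma_{T-1}\theta+2\theta\sum_{i=0}^{T-3}\sum_{n=1}^{T-1-i}\alpha^{n+i}\gamma_{i+n}\,\Pi_{i,n}(\max(\lambda(i),S_i)),$$ $$\bar U^\omega_0(\theta)=\theta\sum_{i=0}^{T-2}\alpha^i\gamma_i+2\theta\sum_{i=0}^{T-2}\sum_{n=1}^{T-1-i}\alpha^{n+i}\gamma_{i+n},\qquad \bar U^\varepsilon_0(\theta)=\alpha^{T-1}\gamma_{T-1}\theta+2\theta\sum_{i=0}^{T-3}\sum_{n=1}^{T-1-i}\alpha^{n+i}\gamma_{i+n}.$$ **Theorem.** For every $\theta>0$, every $k\in\mathbb Z$ and every $x$ with $z_{k-1}<x\le z_k$, $$|v_0^{\pi}(x)-v_0(x)|\le\bar\omega_0(z_k)+\bar\varepsilon_0(z_k)\le U^\omega_0(z_k)+U^\varepsilon_0(z_k)\le\bar U^\omega_0(\theta)+\bar U^\varepsilon_0(\theta).$$ Moreover $\bar U^\omega_0(\theta)\to0$ and $\bar U^\varepsilon_0(\theta)\to0$ as $\theta\downarrow0$, and consequently the cost of the approximate policy converges to the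 optimal cost: $v_0^{\pi_\theta}(x)\to v_0(x)$ as $\theta\downarrow0$, uniformly in $x\in\mathbb R$. -/

import Mathlib

open MeasureTheory ProbabilityTheory Filter Topology

noncomputable section

/-- Data of a finite-horizon, non-stationary, backlogging inventory system with setup costs:
horizon `T`, discount factor `α`, unit ordering costs `c t` (with `c T` the salvage value),
setup costs `K t`, expected one-period holding and penalty costs `G t`, and demands `D t`
on a measure space with measure `P`. Only the periods `t < T` matter (and `c T`). -/
structure InventoryModel (Ω : Type*) [MeasurableSpace Ω] where
  T : ℕ
  α : ℝ
  c : ℕ → ℝ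
  K : ℕ → ℝ
  G : ℕ → ℝ → ℝ
  P : Measure Ω
  D : ℕ → Ω → ℝ

namespace InventoryModel

variable {Ω : Type*} [MeasurableSpace Ω]

/-- `C_t(y) = (c_t - α c_{t+1}) y + G_t(y) + α c_{t+1} E[D_t]`. -/
def C (M : InventoryModel Ω) (t : ℕ) (y : ℝ) : ℝ :=
  (M.c t - M.α * M.c (t + 1)) * y + M.G t y + M.α * M.c (t + 1) * ∫ ω, M.D t ω ∂M.P

/-- The standing assumptions of the model. -/
structure Standing (M : InventoryModel Ω) : Prop where
  prob : IsProbabilityMeasure M.P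
  α_pos : 0 < M.α
  α_le_one : M.α ≤ 1
  K_nonneg : ∀ t < M.T, 0 ≤ M.K t
  D_measurable : ∀ t < M.T, Measurable (M.D t)
  D_indep : iIndepFun (fun t : Fin M.T => M.D t) M.P
  D_nonneg : ∀ t < M.T, ∀ᵐ ω ∂M.P, 0 ≤ M.D t ω
  D_integrable : ∀ t < M.T, Integrable (M.D t) M.P
  C_convex : ∀ t < M.T, ConvexOn ℝ Set.univ (M.C t)
  C_atTop : ∀ t < M.T, Tendsto (M.C t) atTop atTop
  C_atBot : ∀ t < M.T, Tendsto (M.C t) atBot atTop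
  K_mono : ∀ t, t + 1 < M.T → M.α * M.K (t + 1) ≤ M.K t

/-- `γ_t` is a nonnegative Lipschitz constant of `C_t`, for every period `t`. -/
def LipschitzCosts (M : InventoryModel Ω) (γ : ℕ → ℝ) : Prop :=
  ∀ t < M.T, 0 ≤ γ t ∧ ∀ x y : ℝ, |M.C t x - M.C t y| ≤ γ t * |x - y|

/-! ### Costs of ordering policies -/

/-- Inventory level at the beginning of a period when the initial level is `x` and the ordering
policy is `a`: in period `t`, on observing the level `y`, order up to `a t y`. -/
def level (M : InventoryModel Ω) (a : ℕ → ℝ → ℝ) (x : ℝ) : ℕ → Ω → ℝ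
  | 0, _ => x
  | t + 1, ω => a t (level M a x t ω) - M.D t ω

/-- Total discounted cost, over the whole horizon and along a demand realization, of the policy
`a` with initial inventory level `x`. -/
def totalCost (M : InventoryModel Ω) (a : ℕ → ℝ → ℝ) (x : ℝ) (ω : Ω) : ℝ :=
  (∑ t ∈ Finset.range M.T, M.α ^ t *
    (M.K t * (if 0 < a t (M.level a x t ω) - M.level a x t ω then 1 else 0)
      + M.c t * (a t (M.level a x t ω) - M.level a x t ω)
      + M.G t (a t (M.level a x t ω))))
    + M.α ^ M.T * (-(M.c M.T) * M.level a x M.T ω)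

/-- The policy `a` never disposes of stock, is measurable, and has a finite expected cost from
the initial inventory level `x`. -/
def Admissible (M : InventoryModel Ω) (a : ℕ → ℝ → ℝ) (x : ℝ) : Prop :=
  (∀ t < M.T, Measurable (a t)) ∧ (∀ t < M.T, ∀ y, y ≤ a t y) ∧
    Integrable (M.totalCost a x) M.P

/-- Total expected discounted cost of the policy `a` from the initial inventory level `x`. -/
def expectedCost (M : InventoryModel Ω) (a : ℕ → ℝ → ℝ) (x : ℝ) : ℝ :=
  ∫ ω, M.totalCost a x ω ∂M.P

/-- `v_0(x)`: the minimal total expected discounted cost from the initial inventory level `x`. -/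
def optimalCost (M : InventoryModel Ω) (x : ℝ) : ℝ :=
  sInf {r : ℝ | ∃ a : ℕ → ℝ → ℝ, M.Admissible a x ∧ r = M.expectedCost a x}

/-! ### The approximate policy with grid size `θ`

Grid points are `z_m = m θ` with `m : ℤ`; minima and maxima over grid points are taken over
their integer indices. -/

/-- The cumulative distribution function `F_t` of `D_t`. -/
def F (M : InventoryModel Ω) (t : ℕ) (x : ℝ) : ℝ := M.P.real {ω | M.D t ω ≤ x}

/-- `f_t(n) = F_t(z_{n+1}) - F_t(z_n)`. -/
def f (M : InventoryModel Ω) (θ : ℝ) (t : ℕ) (n : ℤ) : ℝ :=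
  M.F t (((n + 1 : ℤ) : ℝ) * θ) - M.F t ((n : ℝ) * θ)

/-- `C^m_t`: the least minimizer of `C_t`. -/
def Cmin (M : InventoryModel Ω) (t : ℕ) : ℝ := sInf {y : ℝ | ∀ x, M.C t y ≤ M.C t x}

/-- `S^U_t`: the least grid point `z_m ≥ C^m_t` with `C_t(z_m) > C_t(z_{n₀}) + K_t`, where
`z_{n₀} < C^m_t ≤ z_{n₀+1}`, that is `n₀ = ⌈C^m_t / θ⌉ - 1`. -/
def SU (M : InventoryModel Ω) (θ : ℝ) (t : ℕ) : ℝ :=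
  ((sInf {m : ℤ | M.C t ((m : ℝ) * θ) > M.C t (((⌈M.Cmin t / θ⌉ - 1 : ℤ) : ℝ) * θ) + M.K t ∧
    M.Cmin t ≤ (m : ℝ) * θ} : ℤ) : ℝ) * θ

/-- `Ȳ_{T-1}`, used with `t = T - 1`: the point `y ≤ C^m_t` with `C_t(y) = C_t(C^m_t) + K_t`.
It is unique, because `C_t` is convex and `C^m_t` is its least minimizer. -/
def Ybar (M : InventoryModel Ω) (t : ℕ) : ℝ :=
  sSup {y : ℝ | M.C t y = M.C t (M.Cmin t) + M.K t ∧ y ≤ M.Cmin t}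

/-- `I_t`, as a function of the value `b` of `Ī_{t+1}`: the largest grid point that is smaller
than `min (Ī_{t+1} - θ) C^m_t`. -/
def lowerI (M : InventoryModel Ω) (θ : ℝ) (t : ℕ) (b : ℝ) : ℝ :=
  ((sSup {m : ℤ | (m : ℝ) * θ < min (b - θ) (M.Cmin t)} : ℤ) : ℝ) * θ

/-- `Ī_t` -/
def Ibar (M : InventoryModel Ω) (θ : ℝ) (t : ℕ) : ℝ :=
  if t + 1 < M.T then
    ((sSup {m : ℤ |
      M.C t ((m : ℝ) * θ) > M.C t (M.lowerI θ t (Ibar M θ (t + 1))) + M.K t ∧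
      (m : ℝ) * θ ≤ M.lowerI θ t (Ibar M θ (t + 1))} : ℤ) : ℝ) * θ + θ
  else M.Ybar t
termination_by M.T - t

/-- `I_t` (for `t + 1 < T`) -/
def Ilow (M : InventoryModel Ω) (θ : ℝ) (t : ℕ) : ℝ := M.lowerI θ t (M.Ibar θ (t + 1))

/-- What the backward recursion produces in one period: the function `H_t` and the two
parameters `S_t`, `s_t` of the approximate policy. -/
structure Stage where
  H : ℝ → ℝ
  S : ℝ
  s : ℝ

/-- `V_t`, computed from `K_t` and the stage of period `t`. -/
def Stage.V (K : ℝ) (σ : Stage) (y : ℝ) : ℝ := if y < σ.s then σ.H σ.S + K else σ.H y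

/-- `S_t` for `t + 1 < T`, computed from `H = H_t`: the largest grid point of `[I_t, S^U_t]` at
which `H` attains its minimum over the grid points of `[I_t, S^U_t]`. -/
def orderUpTo (M : InventoryModel Ω) (θ : ℝ) (t : ℕ) (H : ℝ → ℝ) : ℝ :=
  ((sSup {m : ℤ | (∀ n : ℤ, M.Ilow θ t ≤ (n : ℝ) * θ → (n : ℝ) * θ ≤ M.SU θ t →
      H ((m : ℝ) * θ) ≤ H ((n : ℝ) * θ)) ∧
    M.Ilow θ t ≤ (m : ℝ) * θ ∧ (m : ℝ) * θ ≤ M.SU θ t} : ℤ) : ℝ) * θ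

/-- `s_t` for `t + 1 < T`, computed from `H = H_t` and `S = S_t`. -/
def reorderPoint (M : InventoryModel Ω) (θ : ℝ) (t : ℕ) (H : ℝ → ℝ) (S : ℝ) : ℝ :=
  if M.K t = 0 then S
  else ((sInf {m : ℤ | H ((m : ℝ) * θ) ≤ H S + M.K t ∧
    M.Ibar θ t ≤ (m : ℝ) * θ ∧ (m : ℝ) * θ ≤ S} : ℤ) : ℝ) * θ

/-- `H_t` for `t + 1 < T`, computed from `V = V_{t+1}`:
`H_t(y) = C_t(y) + α ∑_{n ≥ -1} V_{t+1}(y - z_n) f_t(n)`. The summation index below is `n + 1`.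
The series converges: `V` is constant near `-∞` and `∑ f_t(n) = 1`. -/
def stepH (M : InventoryModel Ω) (θ : ℝ) (t : ℕ) (V : ℝ → ℝ) (y : ℝ) : ℝ :=
  M.C t y + M.α * ∑' n : ℕ, V (y - (((n : ℤ) - 1 : ℤ) : ℝ) * θ) * M.f θ t ((n : ℤ) - 1)

/-- The backward recursion, started in period `T - 1` with `H_{T-1} = C_{T-1}`,
`S_{T-1} = C^m_{T-1}` and `s_{T-1} = Ȳ_{T-1}`. -/
def stage (M : InventoryModel Ω) (θ : ℝ) (t : ℕ) : Stage :=
  if t + 1 < M.T then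
    let H := M.stepH θ t ((stage M θ (t + 1)).V (M.K (t + 1)))
    { H := H
      S := M.orderUpTo θ t H
      s := M.reorderPoint θ t H (M.orderUpTo θ t H) }
  else
    { H := M.C t, S := M.Cmin t, s := M.Ybar t }
termination_by M.T - t

/-- `S_t` -/
def S (M : InventoryModel Ω) (θ : ℝ) (t : ℕ) : ℝ := (M.stage θ t).S

/-- `s_t` -/
def s (M : InventoryModel Ω) (θ : ℝ) (t : ℕ) : ℝ := (M.stage θ t).s

/-- The policy `π = {(s_t, S_t)}`: order up to `S_t` if the level is below `s_t`, and do not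
order otherwise. -/
def approxPolicy (M : InventoryModel Ω) (θ : ℝ) (t : ℕ) (y : ℝ) : ℝ :=
  if y < M.s θ t then M.S θ t else y

/-- `v_0^π(x)` -/
def approxCost (M : InventoryModel Ω) (θ : ℝ) (x : ℝ) : ℝ :=
  M.expectedCost (M.approxPolicy θ) x

/-! ### The estimate functions -/

/-- `φ_t`, computed from `ψ = ψ_t`. -/
def phiOf (M : InventoryModel Ω) (γ : ℕ → ℝ) (θ : ℝ) (t : ℕ) (ψ : ℝ → ℝ → ℝ) (x y : ℝ) : ℝ :=
  if t + 1 < M.T then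
    if y < M.s θ t then 0
    else if y - x < M.s θ t then ψ (y - M.s θ t) y
    else ψ x y
  else if y < M.s θ t then 0 else γ t * x

/-- `φ̄_t`, computed from `ψ = ψ̄_t`. -/
def phiBarOf (M : InventoryModel Ω) (γ : ℕ → ℝ) (θ : ℝ) (t : ℕ) (ψ : ℝ → ℝ → ℝ) (x y : ℝ) : ℝ :=
  if t + 1 < M.T then
    if y < M.s θ t then 0
    else if y - x < M.s θ t then ψ (y - M.s θ t + θ) y
    else ψ x y
  else if y < M.s θ t then 0 else γ t * x

/-- `ψ_t(x, y)`. The last summation index is the integer `k` with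
`z_k ≤ y - s_{t+1} < z_{k+1}`. -/
def psi (M : InventoryModel Ω) (γ : ℕ → ℝ) (θ : ℝ) (t : ℕ) : ℝ → ℝ → ℝ := fun x y =>
  if t + 1 < M.T then
    if y < M.s θ (t + 1) - θ then γ t * x
    else γ t * x + M.α * ∑ m ∈ Finset.Icc (-1 : ℤ) ⌊(y - M.s θ (t + 1)) / θ⌋,
      M.phiOf γ θ (t + 1) (psi M γ θ (t + 1)) x (y - (m : ℝ) * θ) * M.f θ t m
  else γ t * x
termination_by M.T - t

/-- `ψ̄_t(x, y)` -/
def psiBar (M : InventoryModel Ω) (γ : ℕ → ℝ) (θ : ℝ) (t : ℕ) : ℝ → ℝ → ℝ := fun x y =>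
  if t + 1 < M.T then
    if y < M.s θ (t + 1) - θ then γ t * x
    else γ t * x + M.α * ∑ m ∈ Finset.Icc (-1 : ℤ) ⌊(y - M.s θ (t + 1)) / θ⌋,
      M.phiBarOf γ θ (t + 1) (psiBar M γ θ (t + 1)) x (y - (m : ℝ) * θ) * M.f θ t m
  else γ t * x
termination_by M.T - t

/-! ### The error bounds -/

/-- `ω_t` for `t + 1 < T`, computed from `W = ω̄_{t+1}`:
`ω_t(x) = ψ_t(θ, x) - γ_t θ + α ∑_{n ≥ -1} ω̄_{t+1}(x - z_n) f_t(n)`. -/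
def omegaOf (M : InventoryModel Ω) (γ : ℕ → ℝ) (θ : ℝ) (t : ℕ) (W : ℝ → ℝ) (x : ℝ) : ℝ :=
  M.psi γ θ t θ x - γ t * θ +
    M.α * ∑' n : ℕ, W (x - (((n : ℤ) - 1 : ℤ) : ℝ) * θ) * M.f θ t ((n : ℤ) - 1)

/-- `ω̄_t`: with `η_t = ψ̄_t(θ, S^U_t) + ω_t(S^U_t)`, it is `η_t` on `(-∞, S^U_t]` and
`max η_t ω_t` on `(S^U_t, ∞)`; and `ω̄_{T-1} = 0`. -/
def omegaBar (M : InventoryModel Ω) (γ : ℕ → ℝ) (θ : ℝ) (t : ℕ) : ℝ → ℝ := fun x =>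
  if t + 1 < M.T then
    let ω := M.omegaOf γ θ t (omegaBar M γ θ (t + 1))
    let η := M.psiBar γ θ t θ (M.SU θ t) + ω (M.SU θ t)
    if x ≤ M.SU θ t then η else max η (ω x)
  else 0
termination_by M.T - t

/-- `λ_t(i)`, started at `λ_t(0) = z`. -/
def lam (M : InventoryModel Ω) (θ : ℝ) (t : ℕ) (z : ℝ) : ℕ → ℝ
  | 0 => z
  | i + 1 => max (lam M θ t z i) (M.S θ (t + i)) + θ

/-- `μ_t(i)`, started at `μ_t(0) = z`. -/
def mu (M : InventoryModel Ω) (θ : ℝ) (t : ℕ) (z : ℝ) : ℕ → ℝ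
  | 0 => z
  | i + 1 => max (mu M θ t z i) (M.SU θ (t + i)) + θ

/-- `ε̄_t(z)`, for `t + 2 ≤ T`. -/
def epsBar (M : InventoryModel Ω) (γ : ℕ → ℝ) (θ : ℝ) (t : ℕ) (z : ℝ) : ℝ :=
  if t + 2 = M.T then M.α * γ (M.T - 1) * θ
  else M.α ^ (M.T - 1 - t) * γ (M.T - 1) * θ +
    ∑ i ∈ Finset.range (M.T - 2 - t), 2 * M.α ^ i *
      (M.psiBar γ θ (t + i) θ (max (M.lam θ t z i) (M.S θ (t + i))) - γ (t + i) * θ)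

/-- `∏_{m=0}^{n-1} F_{t+m}(y + (m+1) θ - s_{t+m+1})` -/
def prodF (M : InventoryModel Ω) (θ : ℝ) (t n : ℕ) (y : ℝ) : ℝ :=
  ∏ m ∈ Finset.range n, M.F (t + m) (y + ((m : ℝ) + 1) * θ - M.s θ (t + m + 1))

/-- `U^ω_t(z)`, for `t + 2 ≤ T`. -/
def Uomega (M : InventoryModel Ω) (γ : ℕ → ℝ) (θ : ℝ) (t : ℕ) (z : ℝ) : ℝ :=
  θ * ∑ i ∈ Finset.range (M.T - 1 - t), M.α ^ i * γ (t + i) +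
  θ * ∑ i ∈ Finset.range (M.T - 1 - t), ∑ n ∈ Finset.Icc 1 (M.T - 1 - t - i),
    M.α ^ (n + i) * γ (t + i + n) *
      (M.prodF θ (t + i) n (M.SU θ (t + i)) +
        M.prodF θ (t + i) n (max (M.mu θ t z i) (M.SU θ (t + i))))

/-- `Ū^ω_t(θ)`, for `t + 2 ≤ T`. -/
def UomegaBar (M : InventoryModel Ω) (γ : ℕ → ℝ) (t : ℕ) (θ : ℝ) : ℝ :=
  θ * ∑ i ∈ Finset.range (M.T - 1 - t), M.α ^ i * γ (t + i) +
  2 * θ * ∑ i ∈ Finset.range (M.T - 1 - t), ∑ n ∈ Finset.Icc 1 (M.T - 1 - t - i),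
    M.α ^ (n + i) * γ (t + i + n)

/-- `U^ε_t(z)`, for `t + 2 ≤ T` (the sum over `i` is empty if `t + 2 = T`). -/
def Ueps (M : InventoryModel Ω) (γ : ℕ → ℝ) (θ : ℝ) (t : ℕ) (z : ℝ) : ℝ :=
  M.α ^ (M.T - 1 - t) * γ (M.T - 1) * θ +
  2 * θ * ∑ i ∈ Finset.range (M.T - 2 - t), ∑ n ∈ Finset.Icc 1 (M.T - 1 - t - i),
    M.α ^ (n + i) * γ (t + i + n) *
      M.prodF θ (t + i) n (max (M.lam θ t z i) (M.S θ (t + i)))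

/-- `Ū^ε_t(θ)`, for `t + 2 ≤ T`. -/
def UepsBar (M : InventoryModel Ω) (γ : ℕ → ℝ) (t : ℕ) (θ : ℝ) : ℝ :=
  M.α ^ (M.T - 1 - t) * γ (M.T - 1) * θ +
  2 * θ * ∑ i ∈ Finset.range (M.T - 2 - t), ∑ n ∈ Finset.Icc 1 (M.T - 1 - t - i),
    M.α ^ (n + i) * γ (t + i + n)

end InventoryModel

end

/-! ### Convex functions of a real variable -/

/-! The number $f_t(n)$ is the probability that $D_t$ lies in the cell $(z_n,z_{n+1}]$. The grid
recursion is therefore dynamic programming for a system whose demand is rounded down to the left end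
of its cell. Started on the grid, that system stays on the grid, and there Scarf's argument applies:
$K$-convexity passes from $V_{t+1}$ to $H_t$ and from $H_t$ to $V_t$, and $(s_t,S_t)$ is an optimal
rule on all grid points, although $S_t$ and $s_t$ are searched for in a bounded window only
(`StageInvariant.step`).

Three value functions are compared: the exact one `optV`, the grid one `gridV`, and that of the
policy in the true system, `polV`. The policy is admissible, so its cost is at least the optimum and
only its excess needs a bound. At the level of expected future costs the excess is split into policy
against grid (`Standing.policyBound`, which yields `epsBar`) and grid against optimum
(`Standing.futureBound`, which yields `omega` and `omegaBar`). Both are backward inductions with the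
same mechanism. If $x$ lies in the cell that starts at $z_i$, then $x-D_t$ is within $\theta$ of the
rounded level $w$. It lies either in the cell that starts at $w$ or in the one below, and in the
second case the price is one grid increment of $V_{t+1}$. Such increments are at most
$\varphi_{t+1}$ upwards and $\bar\varphi_{t+1}$ downwards (`Standing.increment_bound`), and their
expectations build up $\psi_t$ and $\bar\psi_t$. `Standing.polV_le_optV` joins the two comparisons.

Value functions are turned into expected costs by telescoping the purchasing costs (`totalCost_eq`)
and summing the one-period inequalities along a policy, where the demand is independent of the
current level (`Standing.value_le`).

For the explicit bounds, $\bar\varphi_{t+1}$ vanishes below $s_{t+1}$, so each further period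
contributes a factor $F_t$ (`Standing.psiBar_le_step`). Replacing these factors by $1$ leaves a
multiple of $\theta$ that does not depend on $x$, which gives uniform convergence. -/

theorem ConvexOn.antitone_left_of_min {f : ℝ → ℝ} (hf : ConvexOn ℝ Set.univ f) {m : ℝ}
    (hm : ∀ x, f m ≤ f x) {x y : ℝ} (hxy : x ≤ y) (hy : y ≤ m) : f y ≤ f x := by
  have := hf.le_max_of_mem_Icc (Set.mem_univ x) (Set.mem_univ m) ⟨hxy, hy⟩
  rwa [max_eq_left (hm x)] at this

theorem ConvexOn.monotone_right_of_min {f : ℝ → ℝ} (hf : ConvexOn ℝ Set.univ f) {m : ℝ}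
    (hm : ∀ x, f m ≤ f x) {x y : ℝ} (hx : m ≤ x) (hxy : x ≤ y) : f x ≤ f y := by
  have := hf.le_max_of_mem_Icc (Set.mem_univ m) (Set.mem_univ y) ⟨hx, hxy⟩
  rwa [max_eq_right (hm y)] at this

/-- A coercive convex function on the line has at least linear growth. -/
theorem ConvexOn.exists_abs_le {f : ℝ → ℝ} (hf : ConvexOn ℝ Set.univ f)
    (htop : Tendsto f atTop atTop) (hbot : Tendsto f atBot atTop) :
    ∃ A : ℝ, 0 ≤ A ∧ ∀ y, |y| ≤ A * (1 + |f y|) := by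
  obtain ⟨a, ha⟩ := eventually_atTop.1 (htop.eventually_ge_atTop (f 0 + 1))
  obtain ⟨b, hb⟩ := eventually_atBot.1 (hbot.eventually_ge_atTop (f 0 + 1))
  set R := max 1 (max a (-b)) with hR
  have hR1 : 1 ≤ R := le_max_left _ _
  have hRa : a ≤ R := (le_max_left _ _).trans (le_max_right _ _)
  have hRb : -R ≤ b := by
    have : -b ≤ R := (le_max_right _ _).trans (le_max_right _ _)
    linarith
  have key : ∀ y, R ≤ |y| → |y| ≤ R * (f y - f 0) := by
    intro y hy
    have hypos : 0 < |y| := by linarith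
    -- Convexity between $0$ and $y$, with the weight that lands on $\pm R$, where $f$ is already at
    -- least $f(0)+1$.
    have h := hf.2 (Set.mem_univ 0) (Set.mem_univ y) 
      (show 0 ≤ 1 - R / |y| by rw [sub_nonneg, div_le_one hypos]; exact hy)
      (show 0 ≤ R / |y| by positivity) (by ring)
    simp only [smul_eq_mul, mul_zero, zero_add] at h
    have h1 : f 0 + 1 ≤ f (R / |y| * y) := by
      rcases le_total 0 y with h0 | h0
      · rw [abs_of_nonneg h0, div_mul_cancel₀ _ (by rw [abs_of_nonneg h0] at hypos; exact hypos.ne')]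
        exact ha _ hRa
      · have : R / |y| * y = -R := by
          rw [abs_of_nonpos h0] at hypos ⊢
          have : y ≠ 0 := by intro h; simp [h] at hypos
          field_simp
        rw [this]
        exact hb _ hRb
    have h2 : 1 ≤ R / |y| * (f y - f 0) := by nlinarith
    rw [div_mul_eq_mul_div, le_div_iff₀ hypos] at h2
    linarith
  refine ⟨R * (1 + |f 0|), by positivity, fun y => ?_⟩
  have hfy := abs_nonneg (f y)
  have hf0 := abs_nonneg (f 0)
  rcases le_total R |y| with h | h
  · have h1 : f y - f 0 ≤ |f y| + |f 0| := by linarith [le_abs_self (f y), neg_abs_le (f 0)]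
    have h2 : R * (f y - f 0) ≤ R * ((1 + |f 0|) * (1 + |f y|)) := by
      apply mul_le_mul_of_nonneg_left _ (by linarith)
      nlinarith
    linarith [key y h]
  · have : R * 1 ≤ R * ((1 + |f 0|) * (1 + |f y|)) := by
      apply mul_le_mul_of_nonneg_left _ (by linarith)
      nlinarith
    linarith

/-! ### K-convexity and (s, S) policies relative to a set of inventory levels -/

/-- `K`-convexity of `f` on the set `A` of levels. -/
def KConvexOn (K : ℝ) (A : Set ℝ) (f : ℝ → ℝ) : Prop :=
  ∀ a ∈ A, ∀ b ∈ A, ∀ c ∈ A, a ≤ b → b ≤ c →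
    (c - a) * f b ≤ (c - b) * f a + (b - a) * (f c + K)

/-- On the levels in `A`, with cost `H` after ordering and setup cost `K`, it is optimal to order
up to `S` below `s` and not to order from `s` on. -/
structure ReorderOptimal (A : Set ℝ) (H : ℝ → ℝ) (S s K : ℝ) : Prop where
  mem : S ∈ A
  le : s ≤ S
  min : ∀ z ∈ A, H S ≤ H z
  below : ∀ z ∈ A, z < s → H S + K ≤ H z
  above : ∀ z ∈ A, ∀ z' ∈ A, s ≤ z → z ≤ z' → H z ≤ H z' + K

theorem ConvexOn.kConvexOn {f : ℝ → ℝ} (hf : ConvexOn ℝ Set.univ f) {K : ℝ} (hK : 0 ≤ K)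
    (A : Set ℝ) : KConvexOn K A f := by
  intro a _ b _ c _ hab hbc
  rcases hab.eq_or_lt with rfl | hab'
  · simp
  have hac : 0 < c - a := by linarith
  have h := hf.2 (Set.mem_univ a) (Set.mem_univ c) 
    (show 0 ≤ (c - b) / (c - a) from div_nonneg (by linarith) hac.le)
    (show 0 ≤ (b - a) / (c - a) from div_nonneg (by linarith) hac.le) (by field_simp; ring)
  have e : ((c - b) / (c - a)) • a + ((b - a) / (c - a)) • c = b := by
    simp only [smul_eq_mul]; field_simp; ring
  rw [e] at h
  simp only [smul_eq_mul] at h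
  have e2 : (c - b) / (c - a) * f a + (b - a) / (c - a) * f c
      = ((c - b) * f a + (b - a) * f c) / (c - a) := by ring
  rw [e2, le_div_iff₀ hac] at h
  nlinarith

theorem KConvexOn.mono {K : ℝ} {A B : Set ℝ} {f : ℝ → ℝ} (h : KConvexOn K B f) (hAB : A ⊆ B) :
    KConvexOn K A f :=
  fun a ha b hb c hc => h a (hAB ha) b (hAB hb) c (hAB hc)

/-- Right of $S$, $K$-convexity on $S<z\le z'$ together with $H(S)\le H(z)$ gives the claim. Between
$s$ and $S$, $K$-convexity on $s,z,S$ keeps $H(z)$ below $H(S)+K$, and $H(S)$ is minimal. -/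
theorem KConvexOn.above {K : ℝ} {A : Set ℝ} {H : ℝ → ℝ} (h : KConvexOn K A H)
    {S s : ℝ} (hS : S ∈ A) (hs : s ∈ A) (hmin : ∀ z ∈ A, H S ≤ H z)
    (hsS : H s ≤ H S + K) : ∀ z ∈ A, ∀ z' ∈ A, s ≤ z → z ≤ z' → H z ≤ H z' + K := by
  intro z hz z' hz' hsz hzz'
  rcases lt_or_ge S z with hSz | hzS
  · have h1 := h S hS z hz z' hz' hSz.le hzz'
    have h2 := hmin z hz
    by_contra! hcon
    nlinarith
  · have h3 : H z ≤ H S + K := by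
      rcases hsz.eq_or_lt with rfl | hsz
      · exact hsS
      have h1 := h s hs z hz S hS hsz.le hzS
      by_contra! hcon
      nlinarith
    linarith [hmin z' hz']

namespace InventoryModel

namespace Stage

variable {A : Set ℝ} {σ : Stage} {K : ℝ}

theorem V_of_lt {y : ℝ} (h : y < σ.s) : σ.V K y = σ.H σ.S + K := if_pos h

theorem V_of_le {y : ℝ} (h : σ.s ≤ y) : σ.V K y = σ.H y := if_neg h.not_gt

theorem V_le_self (h : ReorderOptimal A σ.H σ.S σ.s K) {z : ℝ} (hz : z ∈ A) :
    σ.V K z ≤ σ.H z := by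
  rcases lt_or_ge z σ.s with hs | hs
  · rw [V_of_lt hs]; exact h.below z hz hs
  · rw [V_of_le hs]

theorem V_le_order (h : ReorderOptimal A σ.H σ.S σ.s K) {z z' : ℝ}
    (hz : z ∈ A) (hz' : z' ∈ A) (hzz' : z ≤ z') : σ.V K z ≤ σ.H z' + K := by
  rcases lt_or_ge z σ.s with hs | hs
  · rw [V_of_lt hs]; linarith [h.min z' hz']
  · rw [V_of_le hs]; exact h.above z hz z' hz' hs hzz'

theorem V_le_V (h : ReorderOptimal A σ.H σ.S σ.s K) (hK : 0 ≤ K) {z z' : ℝ}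
    (hz : z ∈ A) (hz' : z' ∈ A) (hzz' : z ≤ z') : σ.V K z ≤ σ.V K z' + K := by
  rcases lt_or_ge z' σ.s with hs | hs
  · rw [V_of_lt hs, V_of_lt (hzz'.trans_lt hs)]; linarith
  · rw [V_of_le hs]; exact V_le_order h hz hz' hzz'

/-- Scarf's step: replacing $H$ by the value of the $(s,S)$ rule preserves $K$-convexity. The
critical case is $a<s\le b$ with $H(b)>H(S)+K$. There $K$-convexity of $H$ is used on $S,b,c$, and
moving the left point from $S$ back to $a$, where the value is $H(S)+K$, only weakens the
inequality. -/
theorem V_kConvexOn (h : ReorderOptimal A σ.H σ.S σ.s K) (hK : 0 ≤ K)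
    (hH : KConvexOn K A σ.H) : KConvexOn K A (σ.V K) := by
  intro a ha b hb c hc hab hbc
  rcases lt_or_ge a σ.s with has | has
  swap
  · rw [V_of_le has, V_of_le (has.trans hab), V_of_le (has.trans (hab.trans hbc))]
    exact hH a ha b hb c hc hab hbc
  rw [V_of_lt has]
  rcases lt_or_ge b σ.s with hbs | hbs
  · rw [V_of_lt hbs]
    have : σ.H σ.S + K ≤ σ.V K c + K := by
      rw [← V_of_lt has]; exact V_le_V h hK ha hc (hab.trans hbc)
    nlinarith
  rw [V_of_le hbs, V_of_le (hbs.trans hbc)]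
  have hbc' := h.above b hb c hc hbs hbc
  rcases le_or_gt (σ.H b) (σ.H σ.S + K) with hle | hgt
  · nlinarith
  -- A point of $[s,S]$ would satisfy $H(b)\le H(S)+K$.
  have hSb : σ.S < b := by
    by_contra! hcon
    exact absurd (h.above b hb σ.S h.mem hbs hcon) (not_le.2 hgt)
  have h1 := hH σ.S h.mem b hb c hc hSb.le hbc
  have haS : a < σ.S := has.trans_le h.le
  have hcS : 0 < c - σ.S := by linarith
  -- multiply by `c - S > 0` and compare the weights
  have h2 : (c - a) * ((c - σ.S) * σ.H b) ≤
      (c - σ.S) * ((c - b) * (σ.H σ.S + K) + (b - a) * (σ.H c + K)) := by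
    have e1 : (c - a) * ((c - σ.S) * σ.H b) ≤
        (c - a) * ((c - b) * σ.H σ.S + (b - σ.S) * (σ.H c + K)) :=
      mul_le_mul_of_nonneg_left h1 (by linarith)
    have e2 : 0 ≤ (σ.S - a) * ((c - b) * (σ.H c - σ.H σ.S)) :=
      mul_nonneg (by linarith) (mul_nonneg (by linarith) (by linarith [h.min c hc]))
    have e3 : 0 ≤ (c - σ.S) * ((c - b) * K) :=
      mul_nonneg hcS.le (mul_nonneg (by linarith) hK)
    have e4 : 0 ≤ (σ.S - a) * ((c - b) * K) :=
      mul_nonneg (by linarith) (mul_nonneg (by linarith) hK)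
    nlinarith
  have h3 : (c - σ.S) * ((c - a) * σ.H b) ≤
      (c - σ.S) * ((c - b) * (σ.H σ.S + K) + (b - a) * (σ.H c + K)) := by linarith
  exact le_of_mul_le_mul_left h3 hcS

end Stage

/-! ### The one-period costs -/

variable {Ω : Type*} [MeasurableSpace Ω] {M : InventoryModel Ω} {θ : ℝ} {t : ℕ}

theorem Standing.continuous_C (hM : M.Standing) (ht : t < M.T) : Continuous (M.C t) := by
  rw [← continuousOn_univ]
  exact (hM.C_convex t ht).continuousOn isOpen_univ

theorem Standing.Cmin_le (hM : M.Standing) (ht : t < M.T) : ∀ x, M.C t (M.Cmin t) ≤ M.C t x := by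
  have hc := hM.continuous_C ht
  obtain ⟨m, hm⟩ := hc.exists_forall_le (by
    rw [cocompact_eq_atBot_atTop]
    exact tendsto_sup.2 ⟨hM.C_atBot t ht, hM.C_atTop t ht⟩)
  have hclosed : IsClosed {y : ℝ | ∀ x, M.C t y ≤ M.C t x} := by
    simp only [Set.ofPred_forall]
    exact isClosed_iInter fun x => isClosed_le hc continuous_const
  have hbdd : BddBelow {y : ℝ | ∀ x, M.C t y ≤ M.C t x} := by
    obtain ⟨a, ha⟩ := eventually_atBot.1 ((hM.C_atBot t ht).eventually_gt_atTop (M.C t m))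
    refine ⟨a, fun y hy => ?_⟩
    by_contra! hya
    exact absurd (hy m) (not_le.2 (ha y hya.le))
  exact hclosed.csInf_mem ⟨m, hm⟩ hbdd

theorem Standing.C_anti (hM : M.Standing) (ht : t < M.T) {x y : ℝ} (hxy : x ≤ y)
    (hy : y ≤ M.Cmin t) : M.C t y ≤ M.C t x :=
  (hM.C_convex t ht).antitone_left_of_min (hM.Cmin_le ht) hxy hy

theorem Standing.C_mono (hM : M.Standing) (ht : t < M.T) {x y : ℝ} (hx : M.Cmin t ≤ x)
    (hxy : x ≤ y) : M.C t x ≤ M.C t y :=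
  (hM.C_convex t ht).monotone_right_of_min (hM.Cmin_le ht) hx hxy

theorem Standing.Ybar_spec (hM : M.Standing) (ht : t < M.T) :
    M.C t (M.Ybar t) = M.C t (M.Cmin t) + M.K t ∧ M.Ybar t ≤ M.Cmin t := by
  have hc := hM.continuous_C ht
  have hne : {y : ℝ | M.C t y = M.C t (M.Cmin t) + M.K t ∧ y ≤ M.Cmin t}.Nonempty := by
    obtain ⟨a, ha⟩ := eventually_atBot.1
      ((hM.C_atBot t ht).eventually_ge_atTop (M.C t (M.Cmin t) + M.K t))
    have hK := hM.K_nonneg t ht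
    obtain ⟨y, hy, hy'⟩ := intermediate_value_Icc' (min_le_right a (M.Cmin t)) hc.continuousOn
      ⟨by linarith, ha _ (min_le_left _ _)⟩
    exact ⟨y, hy', hy.2⟩
  have hclosed : IsClosed {y : ℝ | M.C t y = M.C t (M.Cmin t) + M.K t ∧ y ≤ M.Cmin t} :=
    (isClosed_eq hc continuous_const).inter isClosed_Iic
  exact hclosed.csSup_mem hne ⟨M.Cmin t, fun y hy => hy.2⟩

theorem Standing.reorderOptimal_last (hM : M.Standing) (ht : t < M.T) :
    ReorderOptimal Set.univ (M.C t) (M.Cmin t) (M.Ybar t) (M.K t) := by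
  obtain ⟨h1, h2⟩ := hM.Ybar_spec ht
  refine ⟨trivial, h2, fun z _ => hM.Cmin_le ht z, fun z _ hz => ?_, fun z _ z' _ hz hzz' => ?_⟩
  · rw [← h1]; exact hM.C_anti ht hz.le h2
  · rcases le_total z (M.Cmin t) with h | h
    · linarith [hM.C_anti ht hz h, hM.Cmin_le ht z']
    · linarith [hM.C_mono ht h hzz', hM.K_nonneg t ht]

/-- The grid point below $C^m_t$ is the rival that rules out order-up-to levels beyond $S^U_t$: it
saves more than $K_t$ in $C_t$, and it can lose at most $K_t$ in future costs. -/
theorem Standing.SU_spec (hM : M.Standing) (hθ : 0 < θ) (ht : t < M.T) :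
    (∃ m : ℤ, M.SU θ t = m * θ) ∧ M.Cmin t ≤ M.SU θ t ∧
      ∃ n : ℤ, (n : ℝ) * θ < M.Cmin t ∧ M.C t (n * θ) + M.K t < M.C t (M.SU θ t) := by
  set n : ℤ := ⌈M.Cmin t / θ⌉ - 1 with hn
  set A := {m : ℤ | M.C t ((m : ℝ) * θ) > M.C t ((n : ℝ) * θ) + M.K t ∧
    M.Cmin t ≤ (m : ℝ) * θ} with hA
  have hne : A.Nonempty := by
    obtain ⟨a, ha⟩ := eventually_atTop.1
      ((hM.C_atTop t ht).eventually_gt_atTop (M.C t ((n : ℝ) * θ) + M.K t))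
    refine ⟨⌈max a (M.Cmin t) / θ⌉, ?_⟩
    have h : max a (M.Cmin t) ≤ (⌈max a (M.Cmin t) / θ⌉ : ℝ) * θ := by
      rw [← div_le_iff₀ hθ]; exact Int.le_ceil _
    exact ⟨ha _ ((le_max_left _ _).trans h), (le_max_right _ _).trans h⟩
  have hbdd : BddBelow A := by
    refine ⟨⌈M.Cmin t / θ⌉, fun m hm => ?_⟩
    rw [Int.ceil_le, div_le_iff₀ hθ]; exact hm.2
  have hmem : sInf A ∈ A := Int.csInf_mem hne hbdd
  refine ⟨⟨sInf A, rfl⟩, hmem.2, n, ?_, hmem.1⟩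
  rw [← lt_div_iff₀ hθ, ← Int.lt_ceil]
  omega

theorem lowerI_spec (hθ : 0 < θ) (b : ℝ) :
    (∃ m : ℤ, M.lowerI θ t b = m * θ) ∧ M.lowerI θ t b < b - θ ∧ M.lowerI θ t b < M.Cmin t := by
  set A := {m : ℤ | (m : ℝ) * θ < min (b - θ) (M.Cmin t)} with hA
  have hne : A.Nonempty := by
    refine ⟨⌈min (b - θ) (M.Cmin t) / θ⌉ - 1, ?_⟩
    rw [hA, Set.mem_ofPred_eq, ← lt_div_iff₀ hθ, ← Int.lt_ceil]
    omega
  have hbdd : BddAbove A := by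
    refine ⟨⌈min (b - θ) (M.Cmin t) / θ⌉, fun m hm => ?_⟩
    rw [hA, Set.mem_ofPred_eq, ← lt_div_iff₀ hθ, ← Int.lt_ceil] at hm
    exact hm.le
  have hmem : ((sSup A : ℤ) : ℝ) * θ < min (b - θ) (M.Cmin t) := Int.csSup_mem hne hbdd
  have h := lt_min_iff.1 hmem
  exact ⟨⟨sSup A, rfl⟩, h.1, h.2⟩

/-- The grid of size `θ`. -/
def grid (θ : ℝ) : Set ℝ := {z | ∃ n : ℤ, z = n * θ}

theorem grid_mul (n : ℤ) : (n : ℝ) * θ ∈ grid θ := ⟨n, rfl⟩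

/-- `Ī_t` for `t + 1 < T`. -/
theorem Standing.Ibar_spec (hM : M.Standing) (hθ : 0 < θ) (ht : t + 1 < M.T) :
    (∃ m : ℤ, M.Ibar θ t = m * θ) ∧ M.Ibar θ t ≤ M.Ilow θ t ∧
      ∀ y < M.Ibar θ t, y ∈ grid θ → M.C t (M.Ilow θ t) + M.K t < M.C t y := by
  obtain ⟨⟨i, hi⟩, -, hiC⟩ := lowerI_spec (M := M) (t := t) hθ (M.Ibar θ (t + 1))
  rw [Ibar, if_pos ht, Ilow]
  set I := M.lowerI θ t (M.Ibar θ (t + 1)) with hI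
  set A := {m : ℤ | M.C t ((m : ℝ) * θ) > M.C t I + M.K t ∧ (m : ℝ) * θ ≤ I} with hA
  have ht' : t < M.T := by omega
  have hne : A.Nonempty := by
    obtain ⟨a, ha⟩ := eventually_atBot.1
      ((hM.C_atBot t ht').eventually_gt_atTop (M.C t I + M.K t))
    refine ⟨⌊min a I / θ⌋, ?_⟩
    have h : (⌊min a I / θ⌋ : ℝ) * θ ≤ min a I := by
      rw [← le_div_iff₀ hθ]; exact Int.floor_le _
    exact ⟨ha _ (h.trans (min_le_left _ _)), h.trans (min_le_right _ _)⟩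
  have hbdd : BddAbove A := by
    refine ⟨⌊I / θ⌋, fun m hm => ?_⟩
    rw [Int.le_floor, le_div_iff₀ hθ]; exact hm.2
  have hmem : sSup A ∈ A := Int.csSup_mem hne hbdd
  refine ⟨⟨sSup A + 1, by push_cast; ring⟩, ?_, ?_⟩
  -- Strict, because $C_t(I_t)>C_t(I_t)+K_t$ is impossible; hence adding $\theta$ does not pass the
  -- grid point $I_t$.
  · have hlt : ((sSup A : ℤ) : ℝ) * θ < I := by
      refine lt_of_le_of_ne hmem.2 fun h => ?_
      have := hmem.1
      rw [h] at this
      linarith [hM.K_nonneg t ht']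
    rw [hi] at hlt ⊢
    have h1 : sSup A + 1 ≤ i := by
      have := lt_of_mul_lt_mul_right hlt hθ.le
      exact_mod_cast this
    have h2 : ((sSup A + 1 : ℤ) : ℝ) * θ ≤ i * θ := by gcongr
    push_cast at h2
    linarith
  · rintro y hy ⟨n, rfl⟩
    have h1 : n ≤ sSup A := by
      have : (n : ℝ) * θ < ((sSup A + 1 : ℤ) : ℝ) * θ := by push_cast; linarith
      have := lt_of_mul_lt_mul_right this hθ.le
      have : n < sSup A + 1 := by exact_mod_cast this
      omega
    have h2 : (n : ℝ) * θ ≤ (sSup A : ℤ) * θ := by gcongr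
    -- Left of $C^m_t$ the cost decreases, so the inequality at the largest qualifying grid point
    -- extends to all grid points below it.
    have h3 := hM.C_anti ht' h2 (hmem.2.trans hiC.le)
    linarith [hmem.1]

end InventoryModel

namespace InventoryModel

variable {Ω : Type*} [MeasurableSpace Ω] {M : InventoryModel Ω} {θ : ℝ} {t : ℕ}

/-! ### Demand rounded to the grid -/

/-- The index `n` of the grid cell `(z_n, z_{n+1}]` that contains the demand of period `t`. -/
noncomputable def cell (M : InventoryModel Ω) (θ : ℝ) (t : ℕ) (ω : Ω) : ℤ := ⌈M.D t ω / θ⌉ - 1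

theorem cell_eq_iff (hθ : 0 < θ) (n : ℤ) (ω : Ω) :
    M.cell θ t ω = n ↔ (n : ℝ) * θ < M.D t ω ∧ M.D t ω ≤ ((n + 1 : ℤ) : ℝ) * θ := by
  rw [cell, sub_eq_iff_eq_add, Int.ceil_eq_iff, lt_div_iff₀ hθ, div_le_iff₀ hθ]
  push_cast
  simp

theorem cell_lt (hθ : 0 < θ) (ω : Ω) : (M.cell θ t ω : ℝ) * θ < M.D t ω :=
  ((cell_eq_iff hθ _ ω).1 rfl).1

theorem le_cell (hθ : 0 < θ) (ω : Ω) : M.D t ω ≤ (M.cell θ t ω : ℝ) * θ + θ := by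
  have := ((cell_eq_iff (M := M) (t := t) hθ _ ω).1 rfl).2
  push_cast at this
  linarith

theorem Standing.measurable_cell (hM : M.Standing) (ht : t < M.T) : Measurable (M.cell θ t) :=
  (Int.measurable_ceil.comp ((hM.D_measurable t ht).div_const θ)).sub_const 1

/-- Zero demand belongs to the cell $(z_{-1},z_0]$; this is why the sums start at $-1$. -/
theorem Standing.neg_one_le_cell (hM : M.Standing) (hθ : 0 < θ) (ht : t < M.T) :
    ∀ᵐ ω ∂M.P, -1 ≤ M.cell θ t ω := by
  filter_upwards [hM.D_nonneg t ht] with ω hω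
  have : 0 ≤ ⌈M.D t ω / θ⌉ := Int.ceil_nonneg (by positivity)
  rw [cell]; omega

/-- The cells are open on the left and closed on the right, so differences of distribution functions
are exactly their probabilities. From here on the sums against $f_t$ can be handled as expectations
over $\Omega$. -/
theorem Standing.f_eq (hM : M.Standing) (hθ : 0 < θ) (ht : t < M.T) (n : ℤ) :
    M.f θ t n = M.P.real {ω | M.cell θ t ω = n} := by
  have := hM.prob
  have hD := hM.D_measurable t ht
  have h1 : {ω | M.cell θ t ω = n} =
      {ω | M.D t ω ≤ ((n + 1 : ℤ) : ℝ) * θ} \ {ω | M.D t ω ≤ (n : ℝ) * θ} := by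
    ext ω
    simp only [Set.mem_ofPred_eq, Set.mem_sdiff, not_le, cell_eq_iff hθ]
    tauto
  have hle : (n : ℝ) * θ ≤ ((n + 1 : ℤ) : ℝ) * θ := by
    push_cast; nlinarith
  have hsub : {ω | M.D t ω ≤ (n : ℝ) * θ} ⊆ {ω | M.D t ω ≤ ((n + 1 : ℤ) : ℝ) * θ} :=
    fun ω hω => le_trans hω hle
  rw [h1, measureReal_sdiff hsub (measurableSet_le hD measurable_const), f, F, F]

theorem Standing.f_eq_zero (hM : M.Standing) (hθ : 0 < θ) (ht : t < M.T) {n : ℤ} (hn : n < -1) :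
    M.f θ t n = 0 := by
  rw [hM.f_eq hθ ht, measureReal_def]
  have : M.P {ω | M.cell θ t ω = n} = 0 := by
    refine measure_mono_null (fun ω hω => ?_) (ae_iff.1 (hM.neg_one_le_cell hθ ht))
    simp only [Set.mem_ofPred_eq] at hω ⊢
    omega
  simp [this]

theorem Standing.integrable_cell (hM : M.Standing) (hθ : 0 < θ) (ht : t < M.T) {g : ℤ → ℝ}
    {B : ℝ} (hg : ∀ n : ℤ, -1 ≤ n → |g n| ≤ B) : Integrable (fun ω => g (M.cell θ t ω)) M.P := by
  have := hM.prob
  refine Integrable.of_bound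
    ((measurable_from_top.comp (hM.measurable_cell ht)).aestronglyMeasurable) B ?_
  filter_upwards [hM.neg_one_le_cell hθ ht] with ω hω
  exact hg _ hω

theorem Standing.integral_cell (hM : M.Standing) (hθ : 0 < θ) (ht : t < M.T) {g : ℤ → ℝ}
    {B : ℝ} (hg : ∀ n : ℤ, -1 ≤ n → |g n| ≤ B) :
    ∫ ω, g (M.cell θ t ω) ∂M.P = ∑' n : ℤ, g n * M.f θ t n := by
  have hm := hM.measurable_cell (θ := θ) ht
  have h1 : ∫ ω, g (M.cell θ t ω) ∂M.P = ∫ n, g n ∂(M.P.map (M.cell θ t)) := by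
    rw [integral_map hm.aemeasurable measurable_from_top.aestronglyMeasurable]
  rw [h1, integral_countable ((integrable_map_measure
    measurable_from_top.aestronglyMeasurable hm.aemeasurable).2 (hM.integrable_cell hθ ht hg))]
  refine tsum_congr fun n => ?_
  rw [hM.f_eq hθ ht, map_measureReal_apply hm (measurableSet_singleton n), smul_eq_mul, mul_comm]
  rfl

theorem Standing.tsum_f_eq_integral (hM : M.Standing) (hθ : 0 < θ) (ht : t < M.T) {g : ℤ → ℝ}
    {B : ℝ} (hg : ∀ n : ℤ, -1 ≤ n → |g n| ≤ B) :
    ∑' n : ℕ, g ((n : ℤ) - 1) * M.f θ t ((n : ℤ) - 1) = ∫ ω, g (M.cell θ t ω) ∂M.P := by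
  rw [hM.integral_cell hθ ht hg]
  have hinj : Function.Injective (fun n : ℕ => (n : ℤ) - 1) := fun a b h => by
    simp only [sub_left_inj] at h; exact_mod_cast h
  refine hinj.tsum_eq (f := fun n : ℤ => g n * M.f θ t n) fun n hn => ?_
  have : -1 ≤ n := by
    by_contra! hlt
    exact hn (by simp only [hM.f_eq_zero hθ ht hlt, mul_zero])
  exact ⟨(n + 1).toNat, by simp only; omega⟩

theorem Standing.sum_f_eq_integral (hM : M.Standing) (hθ : 0 < θ) (ht : t < M.T) {g : ℤ → ℝ}
    {N : ℤ} (hg : ∀ n : ℤ, N < n → g n = 0) :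
    ∑ n ∈ Finset.Icc (-1) N, g n * M.f θ t n = ∫ ω, g (M.cell θ t ω) ∂M.P := by
  have hb : ∀ n : ℤ, -1 ≤ n → |g n| ≤ ∑ m ∈ Finset.Icc (-1) N, |g m| := fun n hn => by
    rcases le_or_gt n N with h | h
    · exact Finset.single_le_sum (f := fun m => |g m|) (fun m _ => abs_nonneg (g m))
        (Finset.mem_Icc.2 ⟨hn, h⟩)
    · rw [hg n h, abs_zero]; exact Finset.sum_nonneg fun m _ => abs_nonneg _
  rw [hM.integral_cell hθ ht hb, tsum_eq_sum]
  intro n hn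
  rcases lt_or_ge n (-1) with h | h
  · rw [hM.f_eq_zero hθ ht h, mul_zero]
  · rw [hg n (by simp only [Finset.mem_Icc, not_and, not_le] at hn; exact hn h), zero_mul]

/-- `V` is constant near `-∞`. -/
def ConstAtBot (V : ℝ → ℝ) : Prop := ∃ a c : ℝ, ∀ y < a, V y = c

theorem ConstAtBot.bounded {V : ℝ → ℝ} (hV : ConstAtBot V) (hθ : 0 < θ) (y : ℝ) :
    ∃ B, ∀ n : ℤ, -1 ≤ n → |V (y - n * θ)| ≤ B := by
  obtain ⟨a, c, h⟩ := hV
  set N : ℤ := ⌊(y - a) / θ⌋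
  refine ⟨|c| + ∑ m ∈ Finset.Icc (-1) N, |V (y - m * θ)|, fun n hn => ?_⟩
  have hs : 0 ≤ ∑ m ∈ Finset.Icc (-1) N, |V (y - m * θ)| :=
    Finset.sum_nonneg fun m _ => abs_nonneg _
  rcases le_or_gt n N with hnN | hnN
  · have := Finset.single_le_sum (f := fun m : ℤ => |V (y - m * θ)|) (fun m _ => abs_nonneg _)
      (Finset.mem_Icc.2 ⟨hn, hnN⟩)
    linarith [abs_nonneg c]
  · rw [Int.floor_lt, div_lt_iff₀ hθ] at hnN
    rw [h _ (by linarith)]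
    linarith

theorem Standing.integrable_grid (hM : M.Standing) (hθ : 0 < θ) (ht : t < M.T) {V : ℝ → ℝ}
    (hV : ConstAtBot V) (y : ℝ) : Integrable (fun ω => V (y - M.cell θ t ω * θ)) M.P := by
  obtain ⟨B, hB⟩ := hV.bounded hθ y
  exact hM.integrable_cell (g := fun n : ℤ => V (y - n * θ)) hθ ht hB

theorem Standing.tsum_grid (hM : M.Standing) (hθ : 0 < θ) (ht : t < M.T) {V : ℝ → ℝ}
    (hV : ConstAtBot V) (y : ℝ) :
    ∑' n : ℕ, V (y - (((n : ℤ) - 1 : ℤ) : ℝ) * θ) * M.f θ t ((n : ℤ) - 1)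
      = ∫ ω, V (y - M.cell θ t ω * θ) ∂M.P := by
  obtain ⟨B, hB⟩ := hV.bounded hθ y
  exact hM.tsum_f_eq_integral (g := fun n : ℤ => V (y - n * θ)) hθ ht hB

theorem Standing.stepH_eq (hM : M.Standing) (hθ : 0 < θ) (ht : t < M.T) {V : ℝ → ℝ}
    (hV : ConstAtBot V) (y : ℝ) :
    M.stepH θ t V y = M.C t y + M.α * ∫ ω, V (y - M.cell θ t ω * θ) ∂M.P := by
  rw [stepH, hM.tsum_grid hθ ht hV]

theorem Stage.V_constAtBot (σ : Stage) (K : ℝ) : ConstAtBot (σ.V K) :=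
  ⟨σ.s, σ.H σ.S + K, fun _ hy => Stage.V_of_lt hy⟩

theorem grid_sub_mul {z : ℝ} (hz : z ∈ grid θ) (n : ℤ) : z - n * θ ∈ grid θ := by
  obtain ⟨m, rfl⟩ := hz
  exact ⟨m - n, by push_cast; ring⟩

/-- For each outcome the three points are shifted by the same grid vector, which keeps them on the
grid and preserves their distances. -/
theorem Standing.cell_integral_kConvexOn (hM : M.Standing) (hθ : 0 < θ) (ht : t < M.T)
    {V : ℝ → ℝ} (hV : ConstAtBot V) {K : ℝ} (hK : KConvexOn K (grid θ) V) :
    KConvexOn K (grid θ) (fun y => ∫ ω, V (y - M.cell θ t ω * θ) ∂M.P) := by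
  have := hM.prob
  intro a ha b hb c hc hab hbc
  have ia := hM.integrable_grid hθ ht hV a
  have ib := hM.integrable_grid hθ ht hV b
  have ic := hM.integrable_grid hθ ht hV c
  have ic' : Integrable (fun ω => V (c - M.cell θ t ω * θ) + K) M.P := ic.add (integrable_const K)
  have e : (c - b) * (∫ ω, V (a - M.cell θ t ω * θ) ∂M.P)
      + (b - a) * ((∫ ω, V (c - M.cell θ t ω * θ) ∂M.P) + K) =
      ∫ ω, ((c - b) * V (a - M.cell θ t ω * θ) + (b - a) * (V (c - M.cell θ t ω * θ) + K)) ∂M.P := by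
    rw [integral_add (ia.const_mul _) (ic'.const_mul _),
      integral_const_mul, integral_const_mul, integral_add ic (integrable_const K)]
    simp
  rw [e, ← integral_const_mul]
  refine integral_mono (ib.const_mul _)
    ((ia.const_mul _).add (ic'.const_mul _)) fun ω => ?_
  have := hK _ (grid_sub_mul ha (M.cell θ t ω)) _ (grid_sub_mul hb (M.cell θ t ω)) _
    (grid_sub_mul hc (M.cell θ t ω)) (by linarith) (by linarith)
  simp only [sub_sub_sub_cancel_right] at this
  exact this

end InventoryModel

namespace InventoryModel

variable {Ω : Type*} [MeasurableSpace Ω] {M : InventoryModel Ω} {θ : ℝ} {t : ℕ}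

/-! ### The backward recursion -/

/-- `H_t` -/
noncomputable def gridH (M : InventoryModel Ω) (θ : ℝ) (t : ℕ) : ℝ → ℝ := (M.stage θ t).H

/-- `V_t` -/
noncomputable def gridV (M : InventoryModel Ω) (θ : ℝ) (t : ℕ) : ℝ → ℝ :=
  (M.stage θ t).V (M.K t)

/-- The expected discounted future cost in `H_t`. -/
noncomputable def gridJ (M : InventoryModel Ω) (θ : ℝ) (t : ℕ) (y : ℝ) : ℝ :=
  M.α * ∫ ω, M.gridV θ (t + 1) (y - M.cell θ t ω * θ) ∂M.P

/-- The levels on which the recursion of period `t` is exact. -/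
def levels (M : InventoryModel Ω) (θ : ℝ) (t : ℕ) : Set ℝ :=
  if t + 1 < M.T then grid θ else Set.univ

theorem grid_subset_levels : grid θ ⊆ M.levels θ t := by
  rw [levels]; split_ifs
  · exact subset_rfl
  · exact Set.subset_univ _

theorem levels_of_lt (ht : t + 1 < M.T) : M.levels θ t = grid θ := if_pos ht

theorem gridV_of_lt {y : ℝ} (h : y < M.s θ t) :
    M.gridV θ t y = M.gridH θ t (M.S θ t) + M.K t := Stage.V_of_lt h

theorem gridV_of_le {y : ℝ} (h : M.s θ t ≤ y) : M.gridV θ t y = M.gridH θ t y := Stage.V_of_le h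

theorem gridV_constAtBot : ConstAtBot (M.gridV θ t) := Stage.V_constAtBot _ _

theorem stage_last (ht : ¬ t + 1 < M.T) :
    M.stage θ t = { H := M.C t, S := M.Cmin t, s := M.Ybar t } := by
  rw [stage, if_neg ht]

theorem stage_of_lt (ht : t + 1 < M.T) :
    M.stage θ t = { H := M.stepH θ t (M.gridV θ (t + 1))
                    S := M.orderUpTo θ t (M.stepH θ t (M.gridV θ (t + 1)))
                    s := M.reorderPoint θ t (M.stepH θ t (M.gridV θ (t + 1)))
                      (M.orderUpTo θ t (M.stepH θ t (M.gridV θ (t + 1)))) } := by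
  rw [stage, if_pos ht]; rfl

theorem Standing.gridH_eq (hM : M.Standing) (hθ : 0 < θ) (ht : t + 1 < M.T) (y : ℝ) :
    M.gridH θ t y = M.C t y + M.gridJ θ t y := by
  rw [gridH, stage_of_lt ht]
  exact hM.stepH_eq hθ (by omega) gridV_constAtBot y

theorem S_eq_orderUpTo (ht : t + 1 < M.T) : M.S θ t = M.orderUpTo θ t (M.gridH θ t) := by
  rw [S, gridH, stage_of_lt ht]

theorem s_eq_reorderPoint (ht : t + 1 < M.T) :
    M.s θ t = M.reorderPoint θ t (M.gridH θ t) (M.S θ t) := by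
  rw [s, S, gridH, stage_of_lt ht]

theorem Standing.orderUpTo_spec (hM : M.Standing) (hθ : 0 < θ) (ht : t + 1 < M.T) (H : ℝ → ℝ) :
    M.orderUpTo θ t H ∈ grid θ ∧ M.Ilow θ t ≤ M.orderUpTo θ t H ∧ M.orderUpTo θ t H ≤ M.SU θ t ∧
      ∀ z ∈ grid θ, M.Ilow θ t ≤ z → z ≤ M.SU θ t → H (M.orderUpTo θ t H) ≤ H z := by
  set A := {m : ℤ | (∀ n : ℤ, M.Ilow θ t ≤ (n : ℝ) * θ → (n : ℝ) * θ ≤ M.SU θ t →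
      H ((m : ℝ) * θ) ≤ H ((n : ℝ) * θ)) ∧
    M.Ilow θ t ≤ (m : ℝ) * θ ∧ (m : ℝ) * θ ≤ M.SU θ t} with hA
  obtain ⟨⟨i, hi⟩, -, hiC⟩ := lowerI_spec (M := M) (t := t) hθ (M.Ibar θ (t + 1))
  obtain ⟨⟨u, hu⟩, huC, -⟩ := hM.SU_spec hθ (show t < M.T by omega)
  change M.Ilow θ t = _ at hi
  change M.Ilow θ t < _ at hiC
  have hiu : i ≤ u := by
    have : (i : ℝ) * θ < u * θ := by rw [← hi, ← hu]; linarith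
    exact_mod_cast (lt_of_mul_lt_mul_right this hθ.le).le
  have hiff : ∀ n : ℤ, (M.Ilow θ t ≤ (n : ℝ) * θ ∧ (n : ℝ) * θ ≤ M.SU θ t) ↔
      n ∈ Finset.Icc i u := fun n => by
    rw [hi, hu, mul_le_mul_iff_left₀ hθ, mul_le_mul_iff_left₀ hθ, Int.cast_le, Int.cast_le,
      Finset.mem_Icc]
  obtain ⟨m, hm, hmin⟩ := Finset.exists_min_image (Finset.Icc i u)
    (fun n : ℤ => H ((n : ℝ) * θ)) ⟨i, Finset.mem_Icc.2 ⟨le_rfl, hiu⟩⟩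
  have hne : A.Nonempty :=
    ⟨m, fun n h1 h2 => hmin n ((hiff n).1 ⟨h1, h2⟩), (hiff m).2 hm⟩
  have hbdd : BddAbove A := ⟨u, fun n hn => (Finset.mem_Icc.1 ((hiff n).1 hn.2)).2⟩
  have hmem : sSup A ∈ A := Int.csSup_mem hne hbdd
  refine ⟨⟨_, rfl⟩, hmem.2.1, hmem.2.2, ?_⟩
  rintro z ⟨n, rfl⟩ h1 h2
  exact hmem.1 n h1 h2

theorem Standing.reorderPoint_spec (hM : M.Standing) (hθ : 0 < θ) (ht : t + 1 < M.T)
    {H : ℝ → ℝ} {S : ℝ} (hS : S ∈ grid θ) (hIS : M.Ibar θ t ≤ S) :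
    M.reorderPoint θ t H S ∈ grid θ ∧ M.Ibar θ t ≤ M.reorderPoint θ t H S ∧
      M.reorderPoint θ t H S ≤ S ∧ H (M.reorderPoint θ t H S) ≤ H S + M.K t ∧
      (M.K t ≠ 0 → ∀ z ∈ grid θ, M.Ibar θ t ≤ z → z < M.reorderPoint θ t H S →
        H S + M.K t < H z) := by
  have hK := hM.K_nonneg t (by omega)
  rw [reorderPoint]
  split_ifs with h0
  · exact ⟨hS, hIS, le_rfl, by linarith, fun h => absurd h0 h⟩
  set A := {m : ℤ | H ((m : ℝ) * θ) ≤ H S + M.K t ∧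
    M.Ibar θ t ≤ (m : ℝ) * θ ∧ (m : ℝ) * θ ≤ S} with hA
  obtain ⟨j, hj⟩ := hS
  have hne : A.Nonempty := ⟨j, by rw [← hj]; linarith, by rw [← hj]; exact hIS, hj.ge⟩
  have hbdd : BddBelow A := by
    refine ⟨⌊M.Ibar θ t / θ⌋, fun m hm => ?_⟩
    have h2 : M.Ibar θ t / θ ≤ m := by rw [div_le_iff₀ hθ]; exact hm.2.1
    exact_mod_cast (Int.floor_le _).trans h2
  have hmem : sInf A ∈ A := Int.csInf_mem hne hbdd
  refine ⟨⟨_, rfl⟩, hmem.2.1, hmem.2.2, hmem.1, ?_⟩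
  rintro - z ⟨n, rfl⟩ hz1 hz2
  by_contra! hcon
  have : sInf A ≤ n := csInf_le hbdd ⟨hcon, hz1, hz2.le.trans hmem.2.2⟩
  have : ((sInf A : ℤ) : ℝ) * θ ≤ n * θ := by gcongr
  linarith

/-- What the recursion maintains. -/
structure StageInvariant (M : InventoryModel Ω) (θ : ℝ) (t : ℕ) : Prop where
  opt : ReorderOptimal (M.levels θ t) (M.gridH θ t) (M.S θ t) (M.s θ t) (M.K t)
  convex : KConvexOn (M.K t) (M.levels θ t) (M.gridH θ t)
  Ibar_le : M.Ibar θ t ≤ M.s θ t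

theorem StageInvariant.gridV_le_gridV (h : M.StageInvariant θ t) (hM : M.Standing) (ht : t < M.T)
    {z z' : ℝ} (hz : z ∈ grid θ) (hz' : z' ∈ grid θ) (hzz' : z ≤ z') :
    M.gridV θ t z ≤ M.gridV θ t z' + M.K t :=
  Stage.V_le_V h.opt (hM.K_nonneg t ht) (grid_subset_levels hz) (grid_subset_levels hz') hzz'

theorem StageInvariant.last (hM : M.Standing) (ht : t + 1 = M.T) : M.StageInvariant θ t := by
  have ht' : ¬ t + 1 < M.T := by omega
  have h := hM.reorderOptimal_last (show t < M.T by omega)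
  refine ⟨?_, ?_, ?_⟩
  · rw [levels, if_neg ht', gridH, S, s, stage_last ht']; exact h
  · rw [levels, if_neg ht', gridH, stage_last ht']
    exact (hM.C_convex t (by omega)).kConvexOn (hM.K_nonneg t (by omega)) _
  · rw [s, stage_last ht', Ibar, if_neg ht']

/-- From $y\le I_t$ even the lowest cell $-1$ leads to at most $y+\theta<\bar I_{t+1}\le s_{t+1}$,
so an order is placed in the next period whatever the demand. -/
theorem Standing.gridJ_eq_of_le (hM : M.Standing) (hθ : 0 < θ) (ht : t + 1 < M.T)
    (h : M.StageInvariant θ (t + 1)) {y : ℝ} (hy : y ≤ M.Ilow θ t) :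
    M.gridJ θ t y = M.α * (M.gridH θ (t + 1) (M.S θ (t + 1)) + M.K (t + 1)) := by
  have := hM.prob
  obtain ⟨-, hI, -⟩ := lowerI_spec (M := M) (t := t) hθ (M.Ibar θ (t + 1))
  change M.Ilow θ t < _ at hI
  rw [gridJ]
  congr 1
  have : ∀ᵐ ω ∂M.P, M.gridV θ (t + 1) (y - M.cell θ t ω * θ)
      = M.gridH θ (t + 1) (M.S θ (t + 1)) + M.K (t + 1) := by
    filter_upwards [hM.neg_one_le_cell hθ (show t < M.T by omega)] with ω hω
    refine gridV_of_lt ?_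
    have h1 : (-1 : ℝ) ≤ M.cell θ t ω := by exact_mod_cast hω
    have := h.Ibar_le
    nlinarith
  rw [integral_congr_ae this]
  simp

/-- A higher level can lower the next value by at most $K_{t+1}$, and $\alpha K_{t+1}\le K_t$. -/
theorem Standing.gridJ_le (hM : M.Standing) (hθ : 0 < θ) (ht : t + 1 < M.T)
    (h : M.StageInvariant θ (t + 1)) {z z' : ℝ} (hz : z ∈ grid θ) (hz' : z' ∈ grid θ)
    (hzz' : z ≤ z') : M.gridJ θ t z ≤ M.gridJ θ t z' + M.K t := by
  have := hM.prob
  have ht' : t < M.T := by omega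
  have i1 := hM.integrable_grid hθ ht' (gridV_constAtBot (M := M) (θ := θ) (t := t + 1)) z
  have i2 := hM.integrable_grid hθ ht' (gridV_constAtBot (M := M) (θ := θ) (t := t + 1)) z'
  have key : ∫ ω, M.gridV θ (t + 1) (z - M.cell θ t ω * θ) ∂M.P ≤
      ∫ ω, M.gridV θ (t + 1) (z' - M.cell θ t ω * θ) ∂M.P + M.K (t + 1) := by
    have e : ∫ ω, M.gridV θ (t + 1) (z' - M.cell θ t ω * θ) ∂M.P + M.K (t + 1) =
        ∫ ω, (M.gridV θ (t + 1) (z' - M.cell θ t ω * θ) + M.K (t + 1)) ∂M.P := by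
      rw [integral_add i2 (integrable_const _)]; simp
    rw [e]
    exact integral_mono i1 (i2.add (integrable_const _)) fun ω =>
      h.gridV_le_gridV hM ht (grid_sub_mul hz _) (grid_sub_mul hz' _) (by linarith)
  have := mul_le_mul_of_nonneg_left key hM.α_pos.le
  rw [gridJ, gridJ]
  linarith [hM.K_mono t ht]

/-- $S_t$ and $s_t$ are defined by searches inside $[\bar I_t,S^U_t]$. The point is that the window
loses nothing: below $I_t$ the future cost is constant and $C_t$ decreases, while above $S^U_t$ the
growth of $C_t$ outweighs any gain in future costs. -/
theorem StageInvariant.step (hM : M.Standing) (hθ : 0 < θ) (ht : t + 1 < M.T)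
    (h : M.StageInvariant θ (t + 1)) : M.StageInvariant θ t := by
  have ht' : t < M.T := by omega
  have hK := hM.K_nonneg t ht'
  have hH := fun y => hM.gridH_eq (θ := θ) hθ ht y
  obtain ⟨hSg, hIS, hSU, hSmin⟩ := hM.orderUpTo_spec hθ ht (M.gridH θ t)
  rw [← S_eq_orderUpTo ht] at hSg hIS hSU hSmin
  obtain ⟨-, hIbar, hIbarC⟩ := hM.Ibar_spec hθ ht
  obtain ⟨hsg, hIs, hsS, hHs, hbelow⟩ := hM.reorderPoint_spec (H := M.gridH θ t) hθ ht hSg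
    (hIbar.trans hIS)
  rw [← s_eq_reorderPoint ht] at hsg hIs hsS hHs hbelow
  obtain ⟨⟨i, hi⟩, -, hIC⟩ := lowerI_spec (M := M) (t := t) hθ (M.Ibar θ (t + 1))
  change M.Ilow θ t = _ at hi
  change M.Ilow θ t < _ at hIC
  obtain ⟨⟨u, hu⟩, hCU, n₀, hn₀, hn₀U⟩ := hM.SU_spec hθ ht'
  have hIg : M.Ilow θ t ∈ grid θ := ⟨i, hi⟩
  have hSI : M.gridH θ t (M.S θ t) ≤ M.gridH θ t (M.Ilow θ t) :=
    hSmin _ hIg le_rfl (by linarith)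
  have hmin' : ∀ z ∈ grid θ, z ≤ M.SU θ t → M.gridH θ t (M.S θ t) ≤ M.gridH θ t z := by
    intro z hz hzU
    rcases le_or_gt (M.Ilow θ t) z with hzI | hzI
    · exact hSmin z hz hzI hzU
    · refine hSI.trans ?_
      rw [hH, hH, hM.gridJ_eq_of_le hθ ht h hzI.le, hM.gridJ_eq_of_le hθ ht h le_rfl]
      linarith [hM.C_anti ht' hzI.le hIC.le]
  have hmin : ∀ z ∈ grid θ, M.gridH θ t (M.S θ t) ≤ M.gridH θ t z := by
    intro z hz
    rcases le_or_gt z (M.SU θ t) with hzU | hzU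
    · exact hmin' z hz hzU
    -- The rival is $z_{n_0}$: it is cheaper in $C_t$ by more than $K_t$, and its future cost is
    -- larger by at most $K_t$.
    · refine (hmin' _ (grid_mul n₀) (by linarith)).trans ?_
      rw [hH, hH]
      linarith [hM.C_mono ht' hCU hzU.le, hM.gridJ_le hθ ht h (grid_mul n₀) hz (by linarith)]
  have hconv : KConvexOn (M.K t) (grid θ) (M.gridH θ t) := by
    have h1 := hM.cell_integral_kConvexOn hθ ht' gridV_constAtBot
      ((Stage.V_kConvexOn h.opt (hM.K_nonneg _ ht) h.convex).mono grid_subset_levels)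
    have h2 := (hM.C_convex t ht').kConvexOn le_rfl (grid θ)
    intro a ha b hb c hc hab hbc
    have e1 := mul_le_mul_of_nonneg_left (h1 a ha b hb c hc hab hbc) hM.α_pos.le
    have e2 := h2 a ha b hb c hc hab hbc
    have e3 := mul_le_mul_of_nonneg_left (hM.K_mono t ht) (sub_nonneg.2 hab)
    simp only [hH, gridJ]
    simp only [gridV] at e1 ⊢
    linarith
  refine ⟨?_, ?_, hIs⟩
  · rw [levels_of_lt ht]
    refine ⟨hSg, hsS, hmin, ?_, hconv.above hSg hsg hmin hHs⟩
    intro z hz hzs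
    by_cases h0 : M.K t = 0
    · rw [h0, add_zero]; exact hmin z hz
    rcases le_or_gt (M.Ibar θ t) z with hzI | hzI
    · exact (hbelow h0 z hz hzI hzs).le
    -- Below $\bar I_t$ the future cost equals the one at $I_t$, so the excess $K_t$ in $C_t$ over
    -- $I_t$ is an excess in $H_t$, and $H_t(S_t)\le H_t(I_t)$.
    · have h1 := hIbarC z hzI hz
      have h2 : M.gridH θ t (M.Ilow θ t) + M.K t ≤ M.gridH θ t z := by
        rw [hH, hH, hM.gridJ_eq_of_le hθ ht h (hzI.le.trans hIbar),
          hM.gridJ_eq_of_le hθ ht h le_rfl]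
        linarith
      linarith
  · rw [levels_of_lt ht]; exact hconv

/-- Induction over the periods, backwards from the last one. -/
theorem backward_induction {T : ℕ} {p : ℕ → Prop} (last : ∀ t, t + 1 = T → p t)
    (step : ∀ t, t + 1 < T → p (t + 1) → p t) : ∀ t < T, p t := by
  have : ∀ n t, t + n + 1 = T → p t := by
    intro n
    induction n with
    | zero => exact fun t ht => last t ht
    | succ n ih => exact fun t ht => step t (by omega) (ih (t + 1) (by omega))
  exact fun t ht => this (T - t - 1) t (by omega)

theorem Standing.invariant (hM : M.Standing) (hθ : 0 < θ) : ∀ t < M.T, M.StageInvariant θ t :=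
  backward_induction (fun _ ht => .last hM ht) fun _ ht h => .step hM hθ ht h

theorem Standing.S_mem_grid (hM : M.Standing) (hθ : 0 < θ) (ht : t + 1 < M.T) :
    M.S θ t ∈ grid θ := by
  rw [S_eq_orderUpTo ht]; exact (hM.orderUpTo_spec hθ ht _).1

theorem Standing.S_le_SU (hM : M.Standing) (hθ : 0 < θ) (ht : t + 1 < M.T) :
    M.S θ t ≤ M.SU θ t := by
  rw [S_eq_orderUpTo ht]; exact (hM.orderUpTo_spec hθ ht _).2.2.1

theorem Standing.s_mem_grid (hM : M.Standing) (hθ : 0 < θ) (ht : t + 1 < M.T) :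
    M.s θ t ∈ grid θ := by
  have hS := hM.orderUpTo_spec hθ ht (M.gridH θ t)
  rw [← S_eq_orderUpTo ht] at hS
  rw [s_eq_reorderPoint ht]
  exact (hM.reorderPoint_spec hθ ht hS.1 ((hM.Ibar_spec hθ ht).2.1.trans hS.2.1)).1

theorem Standing.SU_mem_grid (hM : M.Standing) (hθ : 0 < θ) (ht : t < M.T) :
    M.SU θ t ∈ grid θ := (hM.SU_spec hθ ht).1

theorem Standing.s_le_S (hM : M.Standing) (hθ : 0 < θ) (ht : t < M.T) : M.s θ t ≤ M.S θ t :=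
  (hM.invariant hθ t ht).opt.le

end InventoryModel

namespace InventoryModel

variable {Ω : Type*} [MeasurableSpace Ω] {M : InventoryModel Ω} {γ : ℕ → ℝ} {θ : ℝ} {t : ℕ}

/-! ### The estimate functions on the grid -/

/-- `φ_t` -/
noncomputable def phi (M : InventoryModel Ω) (γ : ℕ → ℝ) (θ : ℝ) (t : ℕ) : ℝ → ℝ → ℝ :=
  M.phiOf γ θ t (M.psi γ θ t)

/-- `φ̄_t` -/
noncomputable def phiBar (M : InventoryModel Ω) (γ : ℕ → ℝ) (θ : ℝ) (t : ℕ) : ℝ → ℝ → ℝ :=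
  M.phiBarOf γ θ t (M.psiBar γ θ t)

theorem phi_of_lt {x y : ℝ} (h : y < M.s θ t) : M.phi γ θ t x y = 0 := by
  rw [phi, phiOf]; simp [h]

theorem phiBar_of_lt {x y : ℝ} (h : y < M.s θ t) : M.phiBar γ θ t x y = 0 := by
  rw [phiBar, phiBarOf]; simp [h]

theorem phi_constAtBot (x : ℝ) : ConstAtBot (M.phi γ θ t x) := ⟨M.s θ t, 0, fun _ h => phi_of_lt h⟩

theorem phiBar_constAtBot (x : ℝ) : ConstAtBot (M.phiBar γ θ t x) :=
  ⟨M.s θ t, 0, fun _ h => phiBar_of_lt h⟩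

/-- The finite sums in the definitions of `ψ_t` and `ψ̄_t` are expectations. -/
theorem Standing.ite_sum_eq_integral (hM : M.Standing) (hθ : 0 < θ) (ht : t < M.T)
    {g : ℝ → ℝ} {s : ℝ} (hg : ∀ y < s, g y = 0) (c a y : ℝ) :
    (if y < s - θ then c else
      c + a * ∑ m ∈ Finset.Icc (-1 : ℤ) ⌊(y - s) / θ⌋, g (y - (m : ℝ) * θ) * M.f θ t m)
      = c + a * ∫ ω, g (y - M.cell θ t ω * θ) ∂M.P := by
  split_ifs with h
  · have : ∀ᵐ ω ∂M.P, g (y - M.cell θ t ω * θ) = 0 := by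
      filter_upwards [hM.neg_one_le_cell hθ ht] with ω hω
      refine hg _ ?_
      have h1 : (-1 : ℝ) ≤ M.cell θ t ω := by exact_mod_cast hω
      nlinarith
    rw [integral_congr_ae this]
    simp
  · rw [hM.sum_f_eq_integral (g := fun m : ℤ => g (y - m * θ)) hθ ht]
    intro n hn
    refine hg _ ?_
    rw [Int.floor_lt, div_lt_iff₀ hθ] at hn
    linarith

theorem Standing.psi_eq (hM : M.Standing) (hθ : 0 < θ) (ht : t + 1 < M.T) (x y : ℝ) :
    M.psi γ θ t x y = γ t * x + M.α * ∫ ω, M.phi γ θ (t + 1) x (y - M.cell θ t ω * θ) ∂M.P := by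
  rw [psi, if_pos ht]
  exact hM.ite_sum_eq_integral hθ (by omega) (g := M.phi γ θ (t + 1) x) (fun _ h => phi_of_lt h) _ _ _

theorem Standing.psiBar_eq (hM : M.Standing) (hθ : 0 < θ) (ht : t + 1 < M.T) (x y : ℝ) :
    M.psiBar γ θ t x y =
      γ t * x + M.α * ∫ ω, M.phiBar γ θ (t + 1) x (y - M.cell θ t ω * θ) ∂M.P := by
  rw [psiBar, if_pos ht]
  exact hM.ite_sum_eq_integral hθ (by omega) (g := M.phiBar γ θ (t + 1) x)
    (fun _ h => phiBar_of_lt h) _ _ _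

theorem psi_last (ht : t + 1 = M.T) (x y : ℝ) : M.psi γ θ t x y = γ t * x := by
  rw [psi, if_neg (by omega)]

theorem psiBar_last (ht : t + 1 = M.T) (x y : ℝ) : M.psiBar γ θ t x y = γ t * x := by
  rw [psiBar, if_neg (by omega)]

/-- Needed at $y=s_t$, where the middle case in the definition of $\varphi_t$ evaluates $\psi_t$ at
first argument $0$. -/
theorem Standing.psi_zero (hM : M.Standing) (hθ : 0 < θ) :
    ∀ t < M.T, ∀ y, M.psi γ θ t 0 y = 0 := by
  refine backward_induction (fun t ht y => by rw [psi_last ht, mul_zero]) fun t ht ih y => ?_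
  rw [hM.psi_eq hθ ht]
  have : ∀ y, M.phi γ θ (t + 1) 0 y = 0 := fun y => by
    rw [phi, phiOf]
    split_ifs with h1 h2 h3
    · rfl
    · rw [sub_zero] at h3; exact absurd h3 h2
    · exact ih y
    · rfl
    · ring
  simp [this]

theorem grid_eq_of_lt (hθ : 0 < θ) {z s : ℝ} (hz : z ∈ grid θ) (hs : s ∈ grid θ) (h1 : s ≤ z)
    (h2 : z - θ < s) : z = s := by
  obtain ⟨m, rfl⟩ := hz
  obtain ⟨n, rfl⟩ := hs
  have h3 : (m : ℝ) * θ < (n + 1) * θ := by linarith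
  have h4 : m < n + 1 := by exact_mod_cast lt_of_mul_lt_mul_right h3 hθ.le
  have h5 : n ≤ m := by exact_mod_cast le_of_mul_le_mul_right h1 hθ
  have : m = n := by omega
  rw [this]

theorem grid_le_sub (hθ : 0 < θ) {z s : ℝ} (hz : z ∈ grid θ) (hs : s ∈ grid θ) (h1 : s < z) :
    s ≤ z - θ := by
  by_contra! h
  exact h1.ne' (grid_eq_of_lt hθ hz hs h1.le h)

/-- Since $s_t$ is a grid point when $t+1<T$, the case $s_t>z-\theta$, $z\ge s_t$ reduces to
$z=s_t$. There $\varphi_t$ is $\psi_t(0,s_t)=0$, whereas $\bar\varphi_t$ is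
$\bar\psi_t(\theta,s_t)$; this is the difference between the two truncation rules on the grid. -/
theorem Standing.phi_grid (hM : M.Standing) (hθ : 0 < θ) (ht : t + 1 < M.T) {z : ℝ}
    (hz : z ∈ grid θ) : M.phi γ θ t θ z = if z ≤ M.s θ t then 0 else M.psi γ θ t θ z := by
  rw [phi, phiOf, if_pos ht]
  have hs := hM.s_mem_grid hθ ht
  rcases lt_trichotomy z (M.s θ t) with h | h | h
  · rw [if_pos h, if_pos h.le]
  · rw [if_neg h.not_lt, if_pos (by linarith), if_pos h.le, h, sub_self,
      hM.psi_zero hθ t (by omega)]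
  · rw [if_neg h.not_gt, if_neg (not_lt.2 (grid_le_sub hθ hz hs h)), if_neg h.not_ge]

theorem phi_last (ht : t + 1 = M.T) (z : ℝ) :
    M.phi γ θ t θ z = if z < M.s θ t then 0 else γ t * θ := by
  rw [phi, phiOf, if_neg (by omega)]

theorem Standing.phiBar_grid (hM : M.Standing) (hθ : 0 < θ) (ht : t < M.T) {z : ℝ}
    (hz : z ∈ grid θ) : M.phiBar γ θ t θ z = if z < M.s θ t then 0 else M.psiBar γ θ t θ z := by
  rw [phiBar, phiBarOf]
  split_ifs with h1 h2 h3
  · rfl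
  · rw [grid_eq_of_lt hθ hz (hM.s_mem_grid hθ h1) (not_lt.1 h2) h3, sub_self, zero_add]
  · rfl
  · rfl
  · rw [psiBar_last (by omega)]

/-- Sign and monotonicity of a pair of estimates on the grid. -/
structure GridEstimate (θ c : ℝ) (u v : ℝ → ℝ) : Prop where
  lower : ∀ z ∈ grid θ, c ≤ u z
  le : ∀ z ∈ grid θ, u z ≤ v z
  mono : ∀ z ∈ grid θ, ∀ z' ∈ grid θ, z ≤ z' → u z ≤ u z'
  mono_bar : ∀ z ∈ grid θ, ∀ z' ∈ grid θ, z ≤ z' → v z ≤ v z'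

theorem GridEstimate.phi (hM : M.Standing) (hγ : M.LipschitzCosts γ) (hθ : 0 < θ) (ht : t < M.T)
    (h : GridEstimate θ (γ t * θ) (M.psi γ θ t θ) (M.psiBar γ θ t θ)) :
    GridEstimate θ 0 (M.phi γ θ t θ) (M.phiBar γ θ t θ) := by
  have hγθ : 0 ≤ γ t * θ := mul_nonneg (hγ t ht).1 hθ.le
  have hpos : ∀ z ∈ grid θ, 0 ≤ M.psi γ θ t θ z := fun z hz => hγθ.trans (h.lower z hz)
  have hpos' : ∀ z ∈ grid θ, 0 ≤ M.psiBar γ θ t θ z := fun z hz => (hpos z hz).trans (h.le z hz)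
  have hbar : ∀ z ∈ grid θ, ∀ z' ∈ grid θ, z ≤ z' →
      M.phiBar γ θ t θ z ≤ M.phiBar γ θ t θ z' := fun z hz z' hz' hzz' => by
    rw [hM.phiBar_grid hθ ht hz, hM.phiBar_grid hθ ht hz']
    split_ifs with h1 h2 h2
    · exact le_rfl
    · exact hpos' z' hz'
    · exact absurd (hzz'.trans_lt h2) h1
    · exact h.mono_bar z hz z' hz' hzz'
  by_cases hlt : t + 1 < M.T
  · refine ⟨fun z hz => ?_, fun z hz => ?_, fun z hz z' hz' hzz' => ?_, hbar⟩
    · rw [hM.phi_grid hθ hlt hz]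
      split_ifs
      exacts [le_rfl, hpos z hz]
    · rw [hM.phi_grid hθ hlt hz, hM.phiBar_grid hθ ht hz]
      split_ifs with h1 h2 h2
      · exact le_rfl
      · exact hpos' z hz
      · exact absurd h2.le h1
      · exact h.le z hz
    · rw [hM.phi_grid hθ hlt hz, hM.phi_grid hθ hlt hz']
      split_ifs with h1 h2 h2
      · exact le_rfl
      · exact hpos z' hz'
      · exact absurd (hzz'.trans h2) h1
      · exact h.mono z hz z' hz' hzz'
  · have hT : t + 1 = M.T := by omega
    refine ⟨fun z hz => ?_, fun z hz => ?_, fun z hz z' hz' hzz' => ?_, hbar⟩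
    · rw [phi_last hT]
      split_ifs
      exacts [le_rfl, hγθ]
    · rw [phi_last hT, hM.phiBar_grid hθ ht hz, psiBar_last hT]
    · rw [phi_last hT, phi_last hT]
      split_ifs with h1 h2 h2
      · exact le_rfl
      · exact hγθ
      · exact absurd (hzz'.trans_lt h2) h1
      · exact le_rfl

theorem GridEstimate.integral (hM : M.Standing) (hθ : 0 < θ) (ht : t < M.T) {u v : ℝ → ℝ}
    (h : GridEstimate θ 0 u v) (hu : ConstAtBot u) (hv : ConstAtBot v) (c : ℝ) :
    GridEstimate θ c (fun z => c + M.α * ∫ ω, u (z - M.cell θ t ω * θ) ∂M.P)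
      (fun z => c + M.α * ∫ ω, v (z - M.cell θ t ω * θ) ∂M.P) := by
  have hα := hM.α_pos.le
  have iu := hM.integrable_grid hθ ht hu
  have iv := hM.integrable_grid hθ ht hv
  refine ⟨fun z hz => ?_, fun z hz => ?_, fun z hz z' hz' hzz' => ?_, fun z hz z' hz' hzz' => ?_⟩
  · have : 0 ≤ ∫ ω, u (z - M.cell θ t ω * θ) ∂M.P :=
      integral_nonneg fun ω => h.lower _ (grid_sub_mul hz _)
    nlinarith
  · have := integral_mono (iu z) (iv z) fun ω => h.le _ (grid_sub_mul hz _)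
    gcongr
  · have := integral_mono (iu z) (iu z') fun ω =>
      h.mono _ (grid_sub_mul hz _) _ (grid_sub_mul hz' _) (by linarith)
    gcongr
  · have := integral_mono (iv z) (iv z') fun ω =>
      h.mono_bar _ (grid_sub_mul hz _) _ (grid_sub_mul hz' _) (by linarith)
    gcongr

/-- Monotonicity is what later allows an error estimate at a random or unknown grid level to be
replaced by the one at a known upper bound for it. -/
theorem Standing.psi_estimate (hM : M.Standing) (hγ : M.LipschitzCosts γ) (hθ : 0 < θ) :
    ∀ t < M.T, GridEstimate θ (γ t * θ) (M.psi γ θ t θ) (M.psiBar γ θ t θ) := by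
  refine backward_induction (fun t ht => ?_) fun t ht ih => ?_
  · refine ⟨fun z _ => ?_, fun z _ => ?_, fun z _ z' _ _ => ?_, fun z _ z' _ _ => ?_⟩ <;>
      simp only [psi_last ht, psiBar_last ht, le_refl]
  · have := (ih.phi hM hγ hθ ht).integral hM hθ (show t < M.T by omega) (phi_constAtBot θ)
      (phiBar_constAtBot θ) (γ t * θ)
    convert this using 1
    · exact funext fun z => hM.psi_eq hθ ht θ z
    · exact funext fun z => hM.psiBar_eq hθ ht θ z

theorem Standing.phi_estimate (hM : M.Standing) (hγ : M.LipschitzCosts γ) (hθ : 0 < θ)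
    (ht : t < M.T) : GridEstimate θ 0 (M.phi γ θ t θ) (M.phiBar γ θ t θ) :=
  (hM.psi_estimate hγ hθ t ht).phi hM hγ hθ ht

/-! ### Increments of `V_t` -/

/-- The last reorder point satisfies $C_t(s_t)=C_t(C^m_t)+K_t$, so $V_{T-1}$ has no jump there. It
is thus $\gamma_{T-1}$-Lipschitz on the whole line, and no grid is needed in the last period. -/
theorem Standing.gridV_last (hM : M.Standing) (ht : t + 1 = M.T) (y : ℝ) :
    M.gridV θ t y = M.C t (max y (M.s θ t)) := by
  have h := (hM.Ybar_spec (show t < M.T by omega)).1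
  have hs : M.s θ t = M.Ybar t := by rw [s, stage_last (by omega)]
  rcases lt_or_ge y (M.s θ t) with hy | hy
  · rw [gridV_of_lt hy, max_eq_right hy.le, gridH, S, hs, stage_last (by omega), h]
  · rw [gridV_of_le hy, max_eq_left hy, gridH, stage_last (by omega)]

theorem Standing.gridV_last_lipschitz (hM : M.Standing) (hγ : M.LipschitzCosts γ)
    (ht : t + 1 = M.T) (x y : ℝ) : |M.gridV θ t x - M.gridV θ t y| ≤ γ t * |x - y| := by
  have h := hγ t (by omega)
  rw [hM.gridV_last ht, hM.gridV_last ht]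
  refine (h.2 _ _).trans (mul_le_mul_of_nonneg_left ?_ h.1)
  exact abs_max_sub_max_le_abs x y _

theorem Standing.gridV_last_sub_le (hM : M.Standing) (hγ : M.LipschitzCosts γ)
    (ht : t + 1 = M.T) {u v w : ℝ} (huw : u ≤ w) (hvw : v ≤ w) (huv : |u - v| ≤ θ) :
    M.gridV θ t u - M.gridV θ t v ≤ M.phi γ θ t θ w := by
  rw [phi_last ht]
  split_ifs with h
  · rw [gridV_of_lt (huw.trans_lt h), gridV_of_lt (hvw.trans_lt h), sub_self]
  · refine (le_abs_self _).trans ((hM.gridV_last_lipschitz hγ ht u v).trans ?_)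
    exact mul_le_mul_of_nonneg_left huv (hγ t (by omega)).1

theorem Standing.phiBar_last_eq (hM : M.Standing) (hθ : 0 < θ) (ht : t + 1 = M.T) {z : ℝ}
    (hz : z ∈ grid θ) : M.phiBar γ θ t θ z = M.phi γ θ t θ z := by
  rw [hM.phiBar_grid hθ (by omega) hz, psiBar_last ht, phi_last ht]

/-- One grid step changes `V_t` by at most the estimates. -/
structure IncrementBound (M : InventoryModel Ω) (γ : ℕ → ℝ) (θ : ℝ) (t : ℕ) : Prop where
  up : ∀ z ∈ grid θ, M.gridV θ t z - M.gridV θ t (z - θ) ≤ M.phi γ θ t θ z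
  down : ∀ z ∈ grid θ, M.gridV θ t (z - θ) - M.gridV θ t z ≤ M.phiBar γ θ t θ z

theorem grid_sub {z : ℝ} (hz : z ∈ grid θ) : z - θ ∈ grid θ := by
  simpa using grid_sub_mul hz 1

theorem grid_add {z : ℝ} (hz : z ∈ grid θ) : z + θ ∈ grid θ := by
  simpa using grid_sub_mul hz (-1)

theorem Standing.gridH_increment (hM : M.Standing) (hγ : M.LipschitzCosts γ) (hθ : 0 < θ)
    (ht : t + 1 < M.T) (h : M.IncrementBound γ θ (t + 1)) {z : ℝ} (hz : z ∈ grid θ) :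
    M.gridH θ t z - M.gridH θ t (z - θ) ≤ M.psi γ θ t θ z ∧
      M.gridH θ t (z - θ) - M.gridH θ t z ≤ M.psiBar γ θ t θ z := by
  have ht' : t < M.T := by omega
  have hα := hM.α_pos.le
  have i1 := hM.integrable_grid hθ ht' (gridV_constAtBot (M := M) (θ := θ) (t := t + 1)) z
  have i2 := hM.integrable_grid hθ ht' (gridV_constAtBot (M := M) (θ := θ) (t := t + 1)) (z - θ)
  have hC := abs_le.1 ((hγ t ht').2 z (z - θ))
  rw [sub_sub_cancel, abs_of_pos hθ] at hC
  rw [hM.gridH_eq hθ ht, hM.gridH_eq hθ ht, hM.psi_eq hθ ht, hM.psiBar_eq hθ ht, gridJ, gridJ]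
  have e : ∀ ω, z - θ - M.cell θ t ω * θ = z - M.cell θ t ω * θ - θ := fun ω => by ring
  constructor
  · have := integral_mono (i1.sub i2) (hM.integrable_grid hθ ht' (phi_constAtBot (γ := γ) θ) z)
      fun ω => by
        simp only [Pi.sub_apply, e]
        exact h.up _ (grid_sub_mul hz _)
    rw [integral_sub' i1 i2] at this
    have := mul_le_mul_of_nonneg_left this hα
    linarith
  · have := integral_mono (i2.sub i1) (hM.integrable_grid hθ ht' (phiBar_constAtBot (γ := γ) θ) z)
      fun ω => by
        simp only [Pi.sub_apply, e]
        exact h.down _ (grid_sub_mul hz _)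
    rw [integral_sub' i2 i1] at this
    have := mul_le_mul_of_nonneg_left this hα
    linarith

/-- Only the step across $s_t$ differs from an increment of $H_t$, since
$V_t(s_t-\theta)=H_t(S_t)+K_t$. Upwards, $H_t(s_t)\le H_t(S_t)+K_t$ makes the increment nonpositive.
Downwards, $H_t(S_t)+K_t\le H_t(s_t-\theta)$ reduces it to an increment of $H_t$. -/
theorem Standing.increment_bound (hM : M.Standing) (hγ : M.LipschitzCosts γ) (hθ : 0 < θ) :
    ∀ t < M.T, M.IncrementBound γ θ t := by
  refine backward_induction (fun t ht => ?_) fun t ht ih => ?_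
  · refine ⟨fun z hz => ?_, fun z hz => ?_⟩
    · exact hM.gridV_last_sub_le hγ ht le_rfl (by linarith)
        (by rw [sub_sub_cancel, abs_of_pos hθ])
    · rw [hM.phiBar_last_eq hθ ht hz]
      exact hM.gridV_last_sub_le hγ ht (by linarith) le_rfl
        (by rw [sub_sub_cancel_left, abs_neg, abs_of_pos hθ])
  · have ht' : t < M.T := by omega
    have hinv := hM.invariant hθ t ht'
    have hsg := hM.s_mem_grid hθ ht
    have hopt := hinv.opt
    rw [levels_of_lt ht] at hopt
    refine ⟨fun z hz => ?_, fun z hz => ?_⟩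
    · rw [hM.phi_grid hθ ht hz]
      rcases lt_trichotomy z (M.s θ t) with h | h | h
      · rw [if_pos h.le, gridV_of_lt h, gridV_of_lt (by linarith), sub_self]
      · rw [if_pos h.le, gridV_of_le h.ge, gridV_of_lt (by linarith)]
        linarith [hopt.above z hz _ hopt.mem h.ge (h.le.trans hopt.le)]
      · rw [if_neg h.not_ge, gridV_of_le h.le, gridV_of_le (grid_le_sub hθ hz hsg h)]
        exact (hM.gridH_increment hγ hθ ht ih hz).1
    · rw [hM.phiBar_grid hθ ht' hz]
      rcases lt_trichotomy z (M.s θ t) with h | h | h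
      · rw [if_pos h, gridV_of_lt h, gridV_of_lt (by linarith), sub_self]
      · rw [if_neg h.not_lt, gridV_of_le h.ge, gridV_of_lt (by linarith)]
        linarith [hopt.below _ (grid_sub hz) (by linarith),
          (hM.gridH_increment hγ hθ ht ih hz).2]
      · rw [if_neg h.not_gt, gridV_of_le h.le, gridV_of_le (grid_le_sub hθ hz hsg h)]
        exact (hM.gridH_increment hγ hθ ht ih hz).2

end InventoryModel

/-! ### Measurable functions of linear growth -/

/-- `f` is measurable and grows at most linearly. -/
structure LinearGrowth (f : ℝ → ℝ) : Prop where
  measurable : Measurable f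
  bound : ∃ A, 0 ≤ A ∧ ∀ x, |f x| ≤ A * (1 + |x|)

theorem LinearGrowth.of_lipschitz {f : ℝ → ℝ} {L : ℝ} (hL : 0 ≤ L)
    (h : ∀ x y, |f x - f y| ≤ L * |x - y|) : LinearGrowth f := by
  refine ⟨?_, |f 0| + L, by positivity, fun x => ?_⟩
  · have : LipschitzWith ⟨L, hL⟩ f := LipschitzWith.of_dist_le_mul fun x y => by
      rw [Real.dist_eq, Real.dist_eq]; exact h x y
    exact this.continuous.measurable
  · have h1 := h x 0
    rw [sub_zero] at h1
    have h2 : |f x| ≤ |f x - f 0| + |f 0| := by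
      simpa using abs_add_le (f x - f 0) (f 0)
    nlinarith [abs_nonneg (f 0), abs_nonneg x, mul_nonneg (abs_nonneg (f 0)) (abs_nonneg x)]

theorem LinearGrowth.integrable_comp {f : ℝ → ℝ} (hf : LinearGrowth f) {Ω : Type*}
    [MeasurableSpace Ω] {P : Measure Ω} [IsFiniteMeasure P] {X : Ω → ℝ} (hX : Integrable X P) :
    Integrable (fun ω => f (X ω)) P := by
  obtain ⟨A, -, hb⟩ := hf.bound
  exact (((integrable_const (1 : ℝ)).add hX.abs).const_mul A).mono'
    (hf.measurable.comp_aemeasurable hX.aemeasurable).aestronglyMeasurable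
    (Eventually.of_forall fun ω => hb _)

theorem LinearGrowth.add {f g : ℝ → ℝ} (hf : LinearGrowth f) (hg : LinearGrowth g) :
    LinearGrowth (fun x => f x + g x) := by
  obtain ⟨A, hA, hfA⟩ := hf.bound
  obtain ⟨B, hB, hgB⟩ := hg.bound
  refine ⟨hf.measurable.add hg.measurable, A + B, by positivity, fun x => ?_⟩
  linarith [abs_add_le (f x) (g x), hfA x, hgB x]

theorem LinearGrowth.const (c : ℝ) : LinearGrowth (fun _ => c) :=
  .of_lipschitz le_rfl fun _ _ => by simp

theorem LinearGrowth.const_mul {f : ℝ → ℝ} (hf : LinearGrowth f) (c : ℝ) :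
    LinearGrowth (fun x => c * f x) := by
  obtain ⟨A, hA, hfA⟩ := hf.bound
  refine ⟨hf.measurable.const_mul c, |c| * A, by positivity, fun x => ?_⟩
  rw [abs_mul, mul_assoc]
  exact mul_le_mul_of_nonneg_left (hfA x) (abs_nonneg c)

theorem LinearGrowth.ite_lt {f g : ℝ → ℝ} (hf : LinearGrowth f) (hg : LinearGrowth g) (s : ℝ) :
    LinearGrowth (fun x => if x < s then f x else g x) := by
  obtain ⟨A, hA, hfA⟩ := hf.bound
  obtain ⟨B, hB, hgB⟩ := hg.bound
  refine ⟨Measurable.ite measurableSet_Iio hf.measurable hg.measurable, A + B, by positivity,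
    fun x => ?_⟩
  have h1 : 0 ≤ A * (1 + |x|) := by positivity
  have h2 : 0 ≤ B * (1 + |x|) := by positivity
  split_ifs
  · linarith [hfA x]
  · linarith [hgB x]

theorem LinearGrowth.integral_sub {f : ℝ → ℝ} (hf : LinearGrowth f) {Ω : Type*}
    [MeasurableSpace Ω] {P : Measure Ω} [IsProbabilityMeasure P] {X : Ω → ℝ} (hm : Measurable X)
    (hX : Integrable X P) : LinearGrowth (fun y => ∫ ω, f (y - X ω) ∂P) := by
  obtain ⟨A, hA, hfA⟩ := hf.bound
  have hi : ∀ y, Integrable (fun ω => f (y - X ω)) P := fun y =>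
    hf.integrable_comp ((integrable_const y).sub hX)
  refine ⟨?_, A * (1 + ∫ ω, |X ω| ∂P), ?_, fun y => ?_⟩
  · have : Measurable (Function.uncurry fun (y : ℝ) (ω : Ω) => f (y - X ω)) :=
      hf.measurable.comp (measurable_fst.sub (hm.comp measurable_snd))
    exact this.stronglyMeasurable.integral_prod_right.measurable
  · have : 0 ≤ ∫ ω, |X ω| ∂P := integral_nonneg fun ω => abs_nonneg _
    positivity
  · have h0 : 0 ≤ ∫ ω, |X ω| ∂P := integral_nonneg fun ω => abs_nonneg _
    have h1 : |∫ ω, f (y - X ω) ∂P| ≤ ∫ ω, A * ((1 + |y|) + |X ω|) ∂P := by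
      refine (abs_integral_le_integral_abs).trans (integral_mono (hi y).abs
        (((integrable_const _).add hX.abs).const_mul A) fun ω => (hfA _).trans ?_)
      refine mul_le_mul_of_nonneg_left ?_ hA
      linarith [abs_sub y (X ω)]
    rw [integral_const_mul, integral_add (integrable_const _) hX.abs] at h1
    simp only [integral_const, probReal_univ, one_smul] at h1
    refine h1.trans ?_
    rw [mul_assoc]
    refine mul_le_mul_of_nonneg_left ?_ hA
    nlinarith [abs_nonneg y]

namespace InventoryModel

variable {Ω : Type*} [MeasurableSpace Ω] {M : InventoryModel Ω} {γ : ℕ → ℝ} {θ : ℝ} {t : ℕ}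

/-! ### The functions `ω_t` on the grid -/

/-- `ω_t` -/
noncomputable def omega (M : InventoryModel Ω) (γ : ℕ → ℝ) (θ : ℝ) (t : ℕ) : ℝ → ℝ :=
  M.omegaOf γ θ t (M.omegaBar γ θ (t + 1))

/-- `η_t` -/
noncomputable def eta (M : InventoryModel Ω) (γ : ℕ → ℝ) (θ : ℝ) (t : ℕ) : ℝ :=
  M.psiBar γ θ t θ (M.SU θ t) + M.omega γ θ t (M.SU θ t)

theorem omegaBar_of_lt (ht : t + 1 < M.T) (x : ℝ) : M.omegaBar γ θ t x =
    if x ≤ M.SU θ t then M.eta γ θ t else max (M.eta γ θ t) (M.omega γ θ t x) := by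
  rw [omegaBar, if_pos ht]; rfl

theorem omegaBar_last (ht : t + 1 = M.T) (x : ℝ) : M.omegaBar γ θ t x = 0 := by
  rw [omegaBar, if_neg (by omega)]

theorem omegaBar_constAtBot : ConstAtBot (M.omegaBar γ θ t) := by
  by_cases ht : t + 1 < M.T
  · exact ⟨M.SU θ t, M.eta γ θ t, fun y hy => by rw [omegaBar_of_lt ht, if_pos hy.le]⟩
  · exact ⟨0, 0, fun y _ => by rw [omegaBar, if_neg ht]⟩

theorem Standing.omega_eq (hM : M.Standing) (hθ : 0 < θ) (ht : t + 1 < M.T) (x : ℝ) :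
    M.omega γ θ t x = M.psi γ θ t θ x - γ t * θ +
      M.α * ∫ ω, M.omegaBar γ θ (t + 1) (x - M.cell θ t ω * θ) ∂M.P := by
  rw [omega, omegaOf, hM.tsum_grid hθ (by omega) omegaBar_constAtBot]

theorem eta_le_omegaBar (ht : t + 1 < M.T) (x : ℝ) : M.eta γ θ t ≤ M.omegaBar γ θ t x := by
  rw [omegaBar_of_lt ht]
  split_ifs
  exacts [le_rfl, le_max_left _ _]

theorem Standing.omega_estimate_aux (hM : M.Standing) (hγ : M.LipschitzCosts γ) (hθ : 0 < θ)
    (ht : t + 1 < M.T)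
    (h : GridEstimate θ 0 (M.omegaBar γ θ (t + 1)) (M.omegaBar γ θ (t + 1))) :
    GridEstimate θ 0 (M.omega γ θ t) (M.omega γ θ t) := by
  have h1 := hM.psi_estimate hγ hθ t (by omega)
  have h2 := h.integral hM hθ (show t < M.T by omega) omegaBar_constAtBot omegaBar_constAtBot 0
  have hmono : ∀ z ∈ grid θ, ∀ z' ∈ grid θ, z ≤ z' → M.omega γ θ t z ≤ M.omega γ θ t z' :=
    fun z hz z' hz' hzz' => by
      rw [hM.omega_eq hθ ht, hM.omega_eq hθ ht]
      linarith [h1.mono z hz z' hz' hzz', h2.mono z hz z' hz' hzz']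
  refine ⟨fun z hz => ?_, fun _ _ => le_rfl, hmono, hmono⟩
  rw [hM.omega_eq hθ ht]
  linarith [h1.lower z hz, h2.lower z hz]

theorem Standing.eta_nonneg_aux (hM : M.Standing) (hγ : M.LipschitzCosts γ) (hθ : 0 < θ)
    (ht : t + 1 < M.T) (h : GridEstimate θ 0 (M.omega γ θ t) (M.omega γ θ t)) :
    0 ≤ M.eta γ θ t := by
  have ht' : t < M.T := by omega
  have hU := hM.SU_mem_grid hθ ht'
  have h1 := hM.psi_estimate hγ hθ t ht'
  have := mul_nonneg (hγ t ht').1 hθ.le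
  rw [eta]
  linarith [h.lower _ hU, h1.lower _ hU, h1.le _ hU]

theorem Standing.omegaBar_estimate (hM : M.Standing) (hγ : M.LipschitzCosts γ) (hθ : 0 < θ) :
    ∀ t < M.T, GridEstimate θ 0 (M.omegaBar γ θ t) (M.omegaBar γ θ t) := by
  refine backward_induction (fun t ht => ?_) fun t ht ih => ?_
  · refine ⟨fun z _ => ?_, fun z _ => ?_, fun z _ z' _ _ => ?_, fun z _ z' _ _ => ?_⟩ <;>
      simp only [omegaBar_last ht, le_refl]
  · have h := hM.omega_estimate_aux hγ hθ ht ih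
    have hη := hM.eta_nonneg_aux hγ hθ ht h
    have hmono : ∀ z ∈ grid θ, ∀ z' ∈ grid θ, z ≤ z' →
        M.omegaBar γ θ t z ≤ M.omegaBar γ θ t z' := fun z hz z' hz' hzz' => by
      rw [omegaBar_of_lt ht, omegaBar_of_lt ht]
      split_ifs with h1 h2 h2
      · exact le_rfl
      · exact le_max_left _ _
      · exact absurd (hzz'.trans h2) h1
      · exact max_le_max le_rfl (h.mono z hz z' hz' hzz')
    exact ⟨fun z _ => hη.trans (eta_le_omegaBar ht z), fun _ _ => le_rfl, hmono, hmono⟩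

theorem Standing.omega_estimate (hM : M.Standing) (hγ : M.LipschitzCosts γ) (hθ : 0 < θ)
    (ht : t + 1 < M.T) : GridEstimate θ 0 (M.omega γ θ t) (M.omega γ θ t) :=
  hM.omega_estimate_aux hγ hθ ht (hM.omegaBar_estimate hγ hθ _ ht)

/-- Up to $S^U_t$ the constant $\eta_t$ pays both for the future error and for the change
$\gamma_t\theta$ of $C_t$ when an order-up-to level is rounded to the grid. -/
theorem Standing.omega_add_le_eta (hM : M.Standing) (hγ : M.LipschitzCosts γ) (hθ : 0 < θ)
    (ht : t + 1 < M.T) {z : ℝ} (hz : z ∈ grid θ) (hzU : z ≤ M.SU θ t) :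
    γ t * θ + M.omega γ θ t z ≤ M.eta γ θ t := by
  have hU := hM.SU_mem_grid hθ (show t < M.T by omega)
  have h1 := hM.psi_estimate hγ hθ t (by omega)
  rw [eta]
  linarith [h1.lower _ hU, h1.le _ hU, (hM.omega_estimate hγ hθ ht).mono z hz _ hU hzU]

theorem Standing.omega_le_omegaBar (hM : M.Standing) (hγ : M.LipschitzCosts γ) (hθ : 0 < θ)
    (ht : t + 1 < M.T) {z : ℝ} (hz : z ∈ grid θ) : M.omega γ θ t z ≤ M.omegaBar γ θ t z := by
  rw [omegaBar_of_lt ht]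
  split_ifs with h
  · have := mul_nonneg (hγ t (by omega)).1 hθ.le
    linarith [hM.omega_add_le_eta hγ hθ ht hz h]
  · exact le_max_right _ _

/-! ### The exact value functions -/

/-- The value function of the problem from period `t` on, with the purchasing costs absorbed
into `C`. -/
noncomputable def optV (M : InventoryModel Ω) (t : ℕ) : ℝ → ℝ := fun x =>
  if t < M.T then
    ⨅ d : Set.Ici (0 : ℝ), ((if 0 < (d : ℝ) then M.K t else 0) +
      (M.C t (x + d) + M.α * ∫ ω, optV M (t + 1) (x + d - M.D t ω) ∂M.P))
  else 0
termination_by M.T - t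

/-- The expected discounted future cost under optimal ordering. -/
noncomputable def optJ (M : InventoryModel Ω) (t : ℕ) (y : ℝ) : ℝ :=
  M.α * ∫ ω, M.optV (t + 1) (y - M.D t ω) ∂M.P

theorem optV_of_lt (ht : t < M.T) (x : ℝ) : M.optV t x =
    ⨅ d : Set.Ici (0 : ℝ), ((if 0 < (d : ℝ) then M.K t else 0) +
      (M.C t (x + d) + M.optJ t (x + d))) := by
  rw [optV, if_pos ht]; rfl

theorem optV_of_ge (ht : M.T ≤ t) (x : ℝ) : M.optV t x = 0 := by
  rw [optV, if_neg (by omega)]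

theorem optJ_last (ht : t + 1 = M.T) (y : ℝ) : M.optJ t y = 0 := by
  simp [optJ, optV_of_ge ht.ge]

/-- Regularity of the exact value function. -/
structure RegularValue (V : ℝ → ℝ) : Prop where
  lipschitz : ∃ L, 0 ≤ L ∧ ∀ x y, |V x - V y| ≤ L * |x - y|
  bddBelow : ∃ B, ∀ x, B ≤ V x

theorem RegularValue.linearGrowth {V : ℝ → ℝ} (h : RegularValue V) : LinearGrowth V := by
  obtain ⟨L, hL, h⟩ := h.lipschitz
  exact .of_lipschitz hL h

theorem Standing.integrable_sub_demand (hM : M.Standing) (ht : t < M.T) {V : ℝ → ℝ}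
    (hV : LinearGrowth V) (y : ℝ) : Integrable (fun ω => V (y - M.D t ω)) M.P := by
  have := hM.prob
  exact hV.integrable_comp ((integrable_const y).sub (hM.D_integrable t ht))

theorem RegularValue.future (hM : M.Standing) (hγ : M.LipschitzCosts γ) (ht : t < M.T)
    (h : RegularValue (M.optV (t + 1))) : RegularValue (fun y => M.C t y + M.optJ t y) := by
  have := hM.prob
  have hi := hM.integrable_sub_demand ht h.linearGrowth
  obtain ⟨⟨L, hL, hLip⟩, B, hB⟩ := h
  refine ⟨⟨γ t + M.α * L, add_nonneg (hγ t ht).1 (mul_nonneg hM.α_pos.le hL), fun x y => ?_⟩,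
    M.C t (M.Cmin t) + M.α * B, fun x => ?_⟩
  · have h1 : |∫ ω, M.optV (t + 1) (x - M.D t ω) ∂M.P - ∫ ω, M.optV (t + 1) (y - M.D t ω) ∂M.P|
        ≤ L * |x - y| := by
      rw [← integral_sub (hi x) (hi y)]
      refine abs_integral_le_integral_abs.trans ?_
      have := integral_mono ((hi x).sub (hi y)).abs (integrable_const (L * |x - y|)) fun ω => by
        have := hLip (x - M.D t ω) (y - M.D t ω)
        rwa [sub_sub_sub_cancel_right] at this
      simpa using this
    have h2 := (hγ t ht).2 x y
    rw [optJ, optJ]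
    have e : ∀ a b p q : ℝ, a + M.α * p - (b + M.α * q) = (a - b) + M.α * (p - q) :=
      fun a b p q => by ring
    rw [e]
    refine (abs_add_le _ _).trans ?_
    rw [abs_mul, abs_of_pos hM.α_pos]
    nlinarith [mul_le_mul_of_nonneg_left h1 hM.α_pos.le]
  · have h1 : B ≤ ∫ ω, M.optV (t + 1) (x - M.D t ω) ∂M.P := by
      have := integral_mono (integrable_const B) (hi x) fun ω => hB _
      simpa using this
    have := mul_le_mul_of_nonneg_left h1 hM.α_pos.le
    rw [optJ]
    linarith [hM.Cmin_le ht x]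

theorem Standing.bddBelow_order (hM : M.Standing) (ht : t < M.T)
    (h : RegularValue (fun y => M.C t y + M.optJ t y)) (x : ℝ) :
    BddBelow (Set.range fun d : Set.Ici (0 : ℝ) => (if 0 < (d : ℝ) then M.K t else 0) +
      (M.C t (x + d) + M.optJ t (x + d))) := by
  obtain ⟨B, hB⟩ := h.bddBelow
  refine ⟨B, ?_⟩
  rintro _ ⟨d, rfl⟩
  have h1 := hB (x + d)
  have h2 : 0 ≤ if 0 < (d : ℝ) then M.K t else 0 := by
    split_ifs
    exacts [hM.K_nonneg t ht, le_rfl]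
  simp only at h1 ⊢
  linarith

/-- The infimum is over order quantities, so the same $d$, with the same setup cost, can be used
from both levels. The Lipschitz constant survives although the setup cost is discontinuous. -/
theorem RegularValue.optV_step (hM : M.Standing) (ht : t < M.T)
    (h : RegularValue (fun y => M.C t y + M.optJ t y)) : RegularValue (M.optV t) := by
  have hbdd := hM.bddBelow_order ht h
  obtain ⟨⟨L, hL, hLip⟩, B, hB⟩ := h
  have key : ∀ x y, M.optV t x ≤ M.optV t y + L * |x - y| := fun x y => by
    rw [← sub_le_iff_le_add, optV_of_lt ht y]
    refine le_ciInf fun d => ?_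
    rw [sub_le_iff_le_add, optV_of_lt ht x]
    refine (ciInf_le (hbdd x) d).trans ?_
    have := (abs_le.1 (hLip (x + d) (y + d))).2
    rw [add_sub_add_right_eq_sub] at this
    linarith
  refine ⟨⟨L, hL, fun x y => abs_le.2 ⟨?_, ?_⟩⟩, B, fun x => ?_⟩
  · have := key y x
    rw [abs_sub_comm] at this
    linarith
  · linarith [key x y]
  · rw [optV_of_lt ht]
    refine le_ciInf fun d => ?_
    have h1 := hB (x + d)
    have h2 : 0 ≤ if 0 < (d : ℝ) then M.K t else 0 := by
      split_ifs
      exacts [hM.K_nonneg t ht, le_rfl]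
    linarith

theorem RegularValue.optV_zero (ht : M.T ≤ t) : RegularValue (M.optV t) :=
  ⟨⟨0, le_rfl, fun x y => by simp [optV_of_ge ht]⟩, 0, fun x => (optV_of_ge ht x).ge⟩

theorem Standing.optV_regular (hM : M.Standing) (hγ : M.LipschitzCosts γ) (t : ℕ) :
    RegularValue (M.optV t) := by
  rcases le_or_gt M.T t with h | h
  · exact .optV_zero h
  · revert t
    exact backward_induction
      (fun t ht => .optV_step hM (by omega) (.future hM hγ (by omega) (.optV_zero ht.ge)))
      fun t ht ih => .optV_step hM (by omega) (.future hM hγ (by omega) ih)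

theorem Standing.optV_le (hM : M.Standing) (hγ : M.LipschitzCosts γ) (ht : t < M.T) {x y : ℝ}
    (hxy : x ≤ y) :
    M.optV t x ≤ (if 0 < y - x then M.K t else 0) + (M.C t y + M.optJ t y) := by
  rw [optV_of_lt ht]
  have := ciInf_le (hM.bddBelow_order ht (.future hM hγ ht (hM.optV_regular hγ _)) x)
    ⟨y - x, sub_nonneg.2 hxy⟩
  simpa only [add_sub_cancel] using this

theorem le_optV (ht : t < M.T) {x a : ℝ} (h0 : a ≤ M.C t x + M.optJ t x)
    (h : ∀ y, x < y → a ≤ M.K t + (M.C t y + M.optJ t y)) : a ≤ M.optV t x := by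
  rw [optV_of_lt ht]
  refine le_ciInf fun d => ?_
  obtain ⟨d, hd⟩ := d
  rcases (Set.mem_Ici.1 hd).eq_or_lt with rfl | hd
  · simpa using h0
  · rw [if_pos hd]
    exact h _ (by simpa using hd)

/-- From the lower level one can order up to any level chosen at the higher one, at the price of at
most one additional setup. -/
theorem Standing.optV_le_optV (hM : M.Standing) (hγ : M.LipschitzCosts γ) (ht : t < M.T) {x y : ℝ}
    (hxy : x ≤ y) : M.optV t x ≤ M.optV t y + M.K t := by
  have hK := hM.K_nonneg t ht
  have key : ∀ z, x ≤ z → M.optV t x ≤ M.K t + (M.C t z + M.optJ t z) := fun z hz => by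
    refine (hM.optV_le hγ ht hz).trans ?_
    split_ifs <;> linarith
  rw [← sub_le_iff_le_add]
  refine le_optV ht (by linarith [key y hxy]) fun z hz => by linarith [key z (hxy.trans hz.le)]

theorem Standing.optJ_le (hM : M.Standing) (hγ : M.LipschitzCosts γ) (ht : t < M.T) {x y : ℝ}
    (hxy : x ≤ y) : M.optJ t x ≤ M.optJ t y + M.K t := by
  by_cases ht1 : t + 1 < M.T
  · have := hM.prob
    have hi := hM.integrable_sub_demand ht (hM.optV_regular hγ (t + 1)).linearGrowth
    have h1 := integral_mono (hi x) ((hi y).add (integrable_const (M.K (t + 1)))) fun ω =>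
      hM.optV_le_optV hγ ht1 (sub_le_sub_right hxy (M.D t ω))
    rw [integral_add' (hi y) (integrable_const _)] at h1
    simp only [integral_const, probReal_univ, one_smul] at h1
    have := mul_le_mul_of_nonneg_left h1 hM.α_pos.le
    rw [optJ, optJ]
    linarith [hM.K_mono t ht1]
  · rw [optJ_last (by omega), optJ_last (by omega)]
    linarith [hM.K_nonneg t ht]

/-- In the exact problem nothing is gained by ordering above `S^U_t`, nor by ordering from a level
that is at least `C^m_t`. -/
theorem Standing.le_optV_of_le (hM : M.Standing) (hγ : M.LipschitzCosts γ) (hθ : 0 < θ)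
    (ht : t < M.T) {x a : ℝ} (h0 : a ≤ M.C t x + M.optJ t x)
    (h : x < M.Cmin t → ∀ y, x < y → y ≤ M.SU θ t → a ≤ M.K t + (M.C t y + M.optJ t y)) :
    a ≤ M.optV t x := by
  refine le_optV ht h0 fun y hxy => ?_
  have hJ := fun z (hz : z ≤ y) => hM.optJ_le hγ ht hz
  rcases le_or_gt (M.Cmin t) x with hx | hx
  · linarith [hM.C_mono ht hx hxy.le, hJ x hxy.le]
  rcases le_or_gt y (M.SU θ t) with hy | hy
  · exact h hx y hxy hy
  obtain ⟨-, hCU, n, hn, hnU⟩ := hM.SU_spec hθ ht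
  have hCy := hM.C_mono ht hCU hy.le
  -- For $y>S^U_t$ the rival is ordering up to $n\theta$ if this lies above $x$. Otherwise it is not
  -- ordering, since $C_t$ decreases from $n\theta$ to $x<C^m_t$.
  rcases lt_or_ge x (n * θ) with hxn | hxn
  · linarith [h hx _ hxn (by linarith), hJ (n * θ) (by linarith), hM.K_nonneg t ht]
  · linarith [hM.C_anti ht hxn hx.le, hJ x hxy.le, hM.K_nonneg t ht]

end InventoryModel

namespace InventoryModel

variable {Ω : Type*} [MeasurableSpace Ω] {M : InventoryModel Ω} {γ : ℕ → ℝ} {θ : ℝ} {t : ℕ}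

/-! ### Comparison of the grid recursion with the exact value functions -/

theorem gridH_last (ht : t + 1 = M.T) : M.gridH θ t = M.C t := by
  rw [gridH, stage_last (by omega)]

theorem Standing.gridV_last_le_optV (hM : M.Standing) (hθ : 0 < θ) (ht : t + 1 = M.T) (x : ℝ) :
    M.gridV θ t x ≤ M.optV t x := by
  have h := (hM.invariant hθ t (by omega)).opt
  have hx : ∀ y, y ∈ M.levels θ t := fun y => by rw [levels, if_neg (by omega)]; trivial
  refine le_optV (by omega) ?_ fun y hy => ?_
  · rw [optJ_last ht, add_zero, ← gridH_last (θ := θ) ht]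
    exact Stage.V_le_self h (hx x)
  · rw [optJ_last ht, add_zero, ← gridH_last (θ := θ) ht, add_comm]
    exact Stage.V_le_order h (hx x) (hx y) hy.le

/-- The cell `i` of `x - D_t`, in terms of the cell of `x`. -/
theorem cell_sub_bounds (hθ : 0 < θ) {x : ℝ} {i : ℤ} (hi : (i : ℝ) * θ ≤ x)
    (hi' : x < (i + 1) * θ) (ω : Ω) :
    (i : ℝ) * θ - M.cell θ t ω * θ - θ ≤ x - M.D t ω ∧
      x - M.D t ω < (i : ℝ) * θ - M.cell θ t ω * θ + θ := by
  have h1 := cell_lt (M := M) (t := t) hθ ω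
  have h2 := le_cell (M := M) (t := t) hθ ω
  constructor <;> linarith

/-- Upper bound for the excess of the future costs of the grid recursion over the exact ones. -/
def FutureBound (M : InventoryModel Ω) (γ : ℕ → ℝ) (θ : ℝ) (t : ℕ) : Prop :=
  ∀ (x : ℝ) (i k : ℤ), (i : ℝ) * θ ≤ x → x < (i + 1) * θ → x ≤ k * θ →
    M.gridJ θ t (i * θ) ≤ M.optJ t x + M.omega γ θ t (k * θ)

theorem exists_cell (hθ : 0 < θ) (y : ℝ) :
    ∃ i : ℤ, (i : ℝ) * θ ≤ y ∧ y < (i + 1) * θ ∧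
      ∀ j : ℤ, (j : ℝ) * θ ≤ y → (j : ℝ) * θ ≤ i * θ := by
  refine ⟨⌊y / θ⌋, ?_, ?_, fun j hj => ?_⟩
  · rw [← le_div_iff₀ hθ]; exact Int.floor_le _
  · rw [← div_lt_iff₀ hθ]; exact Int.lt_floor_add_one _
  · have : j ≤ ⌊y / θ⌋ := by rw [Int.le_floor, le_div_iff₀ hθ]; exact hj
    gcongr

/-- `H_t` at a grid point against the exact cost of ordering up to `y ≤ S^U_t`. -/
theorem FutureBound.gridH_le (h : M.FutureBound γ θ t) (hM : M.Standing)
    (hγ : M.LipschitzCosts γ) (hθ : 0 < θ) (ht : t + 1 < M.T) {y : ℝ} {i : ℤ}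
    (hi : (i : ℝ) * θ ≤ y) (hi' : y < (i + 1) * θ) (hy : y ≤ M.SU θ t) :
    M.gridH θ t (i * θ) ≤ M.C t y + M.optJ t y + M.eta γ θ t := by
  have ht' : t < M.T := by omega
  obtain ⟨u, hu⟩ := hM.SU_mem_grid hθ ht'
  have h1 := h y i u hi hi' (hu ▸ hy)
  rw [← hu] at h1
  have h2 := hM.omega_add_le_eta hγ hθ ht (hM.SU_mem_grid hθ ht') le_rfl
  have h3 := (abs_le.1 ((hγ t ht').2 (i * θ) y)).2
  have h4 : γ t * |i * θ - y| ≤ γ t * θ := by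
    refine mul_le_mul_of_nonneg_left ?_ (hγ t ht').1
    rw [abs_le]; constructor <;> linarith
  rw [hM.gridH_eq hθ ht]
  linarith

/-- This explains the form of $\bar\omega_t$. If $x\le S^U_t$ is kept, or if an order up to $y\le
S^U_t$ is placed, rounding down to the grid may raise $C_t$, and $\eta_t$ covers it. If $x>S^U_t$ is
kept, rounding down moves towards the minimizer of $C_t$ and costs nothing, so $\omega_t$ suffices.
-/
theorem FutureBound.gridV_le (h : M.FutureBound γ θ t) (hM : M.Standing)
    (hγ : M.LipschitzCosts γ) (hθ : 0 < θ) (ht : t + 1 < M.T) {x : ℝ} {i k : ℤ}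
    (hi : (i : ℝ) * θ ≤ x) (hi' : x < (i + 1) * θ) (hk : x ≤ k * θ) :
    M.gridV θ t (i * θ) ≤ M.optV t x + M.omegaBar γ θ t (k * θ) := by
  have ht' : t < M.T := by omega
  have hopt := (hM.invariant hθ t ht').opt
  have hη := eta_le_omegaBar (γ := γ) (θ := θ) ht (k * θ)
  rw [← sub_le_iff_le_add]
  refine hM.le_optV_of_le hγ hθ ht' ?_ fun _ y hxy hy => ?_
  · have h1 : M.gridV θ t (i * θ) ≤ M.gridH θ t (i * θ) :=
      Stage.V_le_self hopt (grid_subset_levels (grid_mul i))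
    rcases le_or_gt x (M.SU θ t) with hx | hx
    · linarith [h.gridH_le hM hγ hθ ht hi hi' hx]
    · obtain ⟨⟨u, hu⟩, hCU, -⟩ := hM.SU_spec hθ ht'
      have hUi : M.SU θ t ≤ i * θ := by
        rw [hu] at hx ⊢
        have h3 : (u : ℝ) * θ < (i + 1) * θ := by linarith
        have h4 : u < i + 1 := by exact_mod_cast lt_of_mul_lt_mul_right h3 hθ.le
        have h5 : u ≤ i := by omega
        gcongr
      have h2 := hM.C_mono ht' (hCU.trans hUi) hi
      have h3 := h x i k hi hi' hk
      have h4 := hM.omega_le_omegaBar hγ hθ ht (grid_mul k)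
      rw [hM.gridH_eq hθ ht] at h1
      linarith
  · obtain ⟨j, hj, hj', hjmax⟩ := exists_cell hθ y
    have h1 : M.gridV θ t (i * θ) ≤ M.gridH θ t (j * θ) + M.K t :=
      Stage.V_le_order hopt (grid_subset_levels (grid_mul i)) (grid_subset_levels (grid_mul j))
        (hjmax i (by linarith))
    linarith [h.gridH_le hM hγ hθ ht hj hj' hy]

/-- Subtracting $\gamma_t\theta$ in $\omega_t$ removes the current-period term of $\psi_t$ and
leaves exactly $\alpha E[\varphi_{t+1}+\bar\omega_{t+1}]$, which is the integral of a bound for each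
outcome. -/
theorem Standing.futureBound_of_ae (hM : M.Standing) (hγ : M.LipschitzCosts γ) (hθ : 0 < θ)
    (ht : t + 1 < M.T)
    (h : ∀ (x : ℝ) (i k : ℤ), (i : ℝ) * θ ≤ x → x < (i + 1) * θ → x ≤ k * θ → ∀ ω,
      M.gridV θ (t + 1) (i * θ - M.cell θ t ω * θ) ≤ M.optV (t + 1) (x - M.D t ω) +
        (M.phi γ θ (t + 1) θ (k * θ - M.cell θ t ω * θ) +
          M.omegaBar γ θ (t + 1) (k * θ - M.cell θ t ω * θ))) :
    M.FutureBound γ θ t := by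
  intro x i k hi hi' hk
  have ht' : t < M.T := by omega
  have i1 := hM.integrable_grid hθ ht'
    (gridV_constAtBot (M := M) (θ := θ) (t := t + 1)) (i * θ)
  have i2 := hM.integrable_sub_demand ht' (hM.optV_regular hγ (t + 1)).linearGrowth x
  have i3 := hM.integrable_grid hθ ht' (phi_constAtBot (M := M) (γ := γ) (θ := θ) (t := t + 1) θ) (k * θ)
  have i4 := hM.integrable_grid hθ ht'
    (omegaBar_constAtBot (M := M) (γ := γ) (θ := θ) (t := t + 1)) (k * θ)
  have h1 := integral_mono i1 (i2.add (i3.add i4)) (h x i k hi hi' hk)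
  rw [integral_add' i2 (i3.add i4), integral_add' i3 i4] at h1
  have h2 := mul_le_mul_of_nonneg_left h1 hM.α_pos.le
  rw [gridJ, optJ, hM.omega_eq hθ ht, hM.psi_eq hθ ht]
  linarith

theorem Standing.futureBound (hM : M.Standing) (hγ : M.LipschitzCosts γ) (hθ : 0 < θ) :
    ∀ t, t + 1 < M.T → M.FutureBound γ θ t := by
  have : ∀ t < M.T - 1, M.FutureBound γ θ t := by
    refine backward_induction (fun t ht => ?_) fun t ht ih => ?_
    · have hT : t + 1 + 1 = M.T := by omega
      refine hM.futureBound_of_ae hγ hθ (by omega) fun x i k hi hi' hk ω => ?_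
      have hb := cell_sub_bounds (M := M) (t := t) hθ hi hi' ω
      have h1 := cell_lt (M := M) (t := t) hθ ω
      have h2 := hM.gridV_last_sub_le (γ := γ) (θ := θ) hγ hT
        (u := i * θ - M.cell θ t ω * θ) (v := x - M.D t ω) (w := k * θ - M.cell θ t ω * θ)
        (by linarith) (by linarith) (by rw [abs_le]; constructor <;> linarith)
      rw [omegaBar_last hT]
      linarith [hM.gridV_last_le_optV hθ hT (x - M.D t ω)]
    · have ht1 : t + 1 + 1 < M.T := by omega
      refine hM.futureBound_of_ae hγ hθ (by omega) fun x i k hi hi' hk ω => ?_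
      obtain ⟨hb1, hb2⟩ := cell_sub_bounds (M := M) (t := t) hθ hi hi' ω
      have h1 := cell_lt (M := M) (t := t) hθ ω
      have hwg : (i : ℝ) * θ - M.cell θ t ω * θ ∈ grid θ := grid_sub_mul (grid_mul i) _
      have hkg : (k : ℝ) * θ - M.cell θ t ω * θ ∈ grid θ := grid_sub_mul (grid_mul k) _
      have hφ := hM.phi_estimate hγ hθ (show t + 1 < M.T by omega)
      have hφk := hφ.mono _ hwg _ hkg (by linarith)
      have e1 : ((i - M.cell θ t ω : ℤ) : ℝ) * θ = i * θ - M.cell θ t ω * θ := by push_cast; ring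
      have e2 : ((i - M.cell θ t ω - 1 : ℤ) : ℝ) * θ = i * θ - M.cell θ t ω * θ - θ := by
        push_cast; ring
      have e3 : ((k - M.cell θ t ω : ℤ) : ℝ) * θ = k * θ - M.cell θ t ω * θ := by push_cast; ring
      rcases le_or_gt ((i : ℝ) * θ - M.cell θ t ω * θ) (x - M.D t ω) with hc | hc
      · have h2 := ih.gridV_le hM hγ hθ ht1 (x := x - M.D t ω) (i := i - M.cell θ t ω)
          (k := k - M.cell θ t ω) (by rw [e1]; exact hc) (by rw [add_mul, e1]; linarith)
          (by rw [e3]; linarith)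
        rw [e1, e3] at h2
        linarith [hφ.lower _ hkg]
      -- Here $x-D_t$ has fallen into the cell below the rounded level, and one upward increment of
      -- $V_{t+1}$ brings the comparison back to that level.
      · have h2 := ih.gridV_le hM hγ hθ ht1 (x := x - M.D t ω) (i := i - M.cell θ t ω - 1)
          (k := k - M.cell θ t ω) (by rw [e2]; exact hb1) (by rw [add_mul, e2]; linarith)
          (by rw [e3]; linarith)
        rw [e2, e3] at h2
        linarith [(hM.increment_bound hγ hθ _ (show t + 1 < M.T by omega)).up _ hwg]
  exact fun t ht => this t (by omega)

/-! ### The value functions of the approximate policy -/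

/-- Value function of the approximate policy from period `t` on, with the purchasing costs absorbed
into `C`. -/
noncomputable def polV (M : InventoryModel Ω) (θ : ℝ) (t : ℕ) : ℝ → ℝ := fun x =>
  if t < M.T then
    if x < M.s θ t then
      M.C t (M.S θ t) + M.α * (∫ ω, polV M θ (t + 1) (M.S θ t - M.D t ω) ∂M.P) + M.K t
    else M.C t x + M.α * ∫ ω, polV M θ (t + 1) (x - M.D t ω) ∂M.P
  else 0
termination_by M.T - t

/-- The expected discounted future cost under the approximate policy. -/
noncomputable def polJ (M : InventoryModel Ω) (θ : ℝ) (t : ℕ) (y : ℝ) : ℝ :=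
  M.α * ∫ ω, M.polV θ (t + 1) (y - M.D t ω) ∂M.P

theorem polV_eq (ht : t < M.T) (x : ℝ) : M.polV θ t x =
    if x < M.s θ t then M.C t (M.S θ t) + M.polJ θ t (M.S θ t) + M.K t
    else M.C t x + M.polJ θ t x := by
  rw [polV, if_pos ht]; rfl

theorem polV_of_ge (ht : M.T ≤ t) : M.polV θ t = fun _ => 0 := by
  funext x
  rw [polV, if_neg (by omega)]

theorem polV_of_lt (ht : t < M.T) {x : ℝ} (hx : x < M.s θ t) :
    M.polV θ t x = M.C t (M.S θ t) + M.polJ θ t (M.S θ t) + M.K t := by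
  rw [polV_eq ht, if_pos hx]

theorem polV_of_le (ht : t < M.T) {x : ℝ} (hx : M.s θ t ≤ x) :
    M.polV θ t x = M.C t x + M.polJ θ t x := by
  rw [polV_eq ht, if_neg hx.not_gt]

theorem polV_last (ht : t + 1 = M.T) : M.polV θ t = M.gridV θ t := by
  funext x
  have hJ : ∀ y, M.polJ θ t y = 0 := fun y => by simp [polJ, polV_of_ge ht.ge]
  rcases lt_or_ge x (M.s θ t) with h | h
  · rw [polV_of_lt (by omega) h, gridV_of_lt h, gridH_last ht, hJ, add_zero]
  · rw [polV_of_le (by omega) h, gridV_of_le h, gridH_last ht, hJ, add_zero]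

theorem Standing.polV_linearGrowth (hM : M.Standing) (hγ : M.LipschitzCosts γ) (t : ℕ) :
    LinearGrowth (M.polV θ t) := by
  have := hM.prob
  have hstep : ∀ t < M.T, LinearGrowth (M.polV θ (t + 1)) → LinearGrowth (M.polV θ t) := by
    intro t ht h
    have hC : LinearGrowth (M.C t) := .of_lipschitz (hγ t ht).1 (hγ t ht).2
    have hJ : LinearGrowth (M.polJ θ t) :=
      (h.integral_sub (hM.D_measurable t ht) (hM.D_integrable t ht)).const_mul M.α
    have e : M.polV θ t = fun x => if x < M.s θ t
        then M.C t (M.S θ t) + M.polJ θ t (M.S θ t) + M.K t else M.C t x + M.polJ θ t x :=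
      funext fun x => polV_eq ht x
    rw [e]
    exact (LinearGrowth.const _).ite_lt (hC.add hJ) _
  have hzero : ∀ t, M.T ≤ t → LinearGrowth (M.polV θ t) := fun t ht => by
    rw [polV_of_ge ht]; exact .const 0
  rcases le_or_gt M.T t with h | h
  · exact hzero t h
  · revert t
    exact backward_induction (fun t ht => hstep t (by omega) (hzero _ ht.ge))
      fun t ht ih => hstep t (by omega) ih

/-! ### Loss of the approximate policy against the grid recursion. -/

theorem lam_succ (z : ℝ) (i : ℕ) :
    M.lam θ t z (i + 1) = M.lam θ (t + 1) (max z (M.S θ t) + θ) i := by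
  induction i with
  | zero => rw [lam, lam, lam, add_zero]
  | succ i ih =>
    rw [lam, ih]
    conv_rhs => rw [lam]
    congr 3
    omega

theorem epsBar_last (ht : t + 2 = M.T) (z : ℝ) :
    M.epsBar γ θ t z = M.α * (γ (t + 1) * θ) := by
  rw [epsBar, if_pos ht, show M.T - 1 = t + 1 by omega, mul_assoc]

theorem epsBar_eq_sum (z : ℝ) :
    M.epsBar γ θ t z = M.α ^ (M.T - 1 - t) * γ (M.T - 1) * θ +
    ∑ i ∈ Finset.range (M.T - 2 - t), 2 * M.α ^ i *
      (M.psiBar γ θ (t + i) θ (max (M.lam θ t z i) (M.S θ (t + i))) - γ (t + i) * θ) := by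
  rw [epsBar]
  split_ifs with h
  · rw [show M.T - 1 - t = 1 by omega, show M.T - 2 - t = 0 by omega]
    simp
  · rfl

theorem epsBar_succ (ht : t + 2 < M.T) (z : ℝ) :
    M.epsBar γ θ t z = 2 * (M.psiBar γ θ t θ (max z (M.S θ t)) - γ t * θ) +
      M.α * M.epsBar γ θ (t + 1) (max z (M.S θ t) + θ) := by
  rw [epsBar_eq_sum, epsBar_eq_sum,
    show M.T - 2 - t = (M.T - 2 - (t + 1)) + 1 by omega,
    show M.T - 1 - t = (M.T - 1 - (t + 1)) + 1 by omega, Finset.sum_range_succ', mul_add,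
    Finset.mul_sum]
  have e : ∀ i ∈ Finset.range (M.T - 2 - (t + 1)), 2 * M.α ^ (i + 1) *
      (M.psiBar γ θ (t + (i + 1)) θ (max (M.lam θ t z (i + 1)) (M.S θ (t + (i + 1))))
        - γ (t + (i + 1)) * θ) = M.α * (2 * M.α ^ i *
      (M.psiBar γ θ (t + 1 + i) θ (max (M.lam θ (t + 1) (max z (M.S θ t) + θ) i)
        (M.S θ (t + 1 + i))) - γ (t + 1 + i) * θ)) := fun i _ => by
    rw [lam_succ, show t + (i + 1) = t + 1 + i by omega, pow_succ']
    ring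
  rw [Finset.sum_congr rfl e, pow_succ' M.α (M.T - 1 - (t + 1)), pow_zero, add_zero, lam]
  ring

theorem max_mem_grid {x y : ℝ} (hx : x ∈ grid θ) (hy : y ∈ grid θ) : max x y ∈ grid θ := by
  rcases max_choice x y with h | h <;> rw [h] <;> assumption

/-- Upper bound for the excess of the future costs of the approximate policy over those of the grid
recursion. -/
def PolicyBound (M : InventoryModel Ω) (γ : ℕ → ℝ) (θ : ℝ) (t : ℕ) : Prop :=
  ∀ z ∈ grid θ, ∀ (x : ℝ) (i : ℤ), (i : ℝ) * θ ≤ x → x < (i + 1) * θ →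
    (i : ℝ) * θ ≤ max z (M.S θ t) → M.polJ θ t x ≤ M.gridJ θ t (i * θ) + M.epsBar γ θ t z

/-- As $s_t$ is a grid point, $x$ and the grid point below it lie on the same side of $s_t$ and lead
to the same decision. If an order is placed, both levels become $S_t$. Otherwise $C_t$ differs by at
most $\gamma_t\theta$, which $\bar\varphi_t$ dominates from $s_t$ on. -/
theorem PolicyBound.polV_le (h : M.PolicyBound γ θ t) (hM : M.Standing)
    (hγ : M.LipschitzCosts γ) (hθ : 0 < θ) (ht : t + 1 < M.T) {z x : ℝ} (hz : z ∈ grid θ) {i : ℤ}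
    (hi : (i : ℝ) * θ ≤ x) (hi' : x < (i + 1) * θ) (hiz : (i : ℝ) * θ ≤ max z (M.S θ t)) :
    M.polV θ t x ≤ M.gridV θ t (i * θ) + M.phiBar γ θ t θ (i * θ) + M.epsBar γ θ t z := by
  have ht' : t < M.T := by omega
  have hφ := (hM.phi_estimate hγ hθ ht')
  have hφi := (hφ.lower _ (grid_mul i)).trans (hφ.le _ (grid_mul i))
  obtain ⟨j, hj⟩ := hM.S_mem_grid hθ ht
  rcases lt_or_ge x (M.s θ t) with hx | hx
  · have h1 := h z hz (M.S θ t) j hj.ge (by rw [hj]; nlinarith) (by rw [← hj]; exact le_max_right _ _)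
    rw [← hj] at h1
    rw [polV_of_lt ht' hx, gridV_of_lt (hi.trans_lt hx), hM.gridH_eq hθ ht]
    linarith
  · have hsi : M.s θ t ≤ i * θ := by
      obtain ⟨σ, hσ⟩ := hM.s_mem_grid hθ ht
      rw [hσ] at hx ⊢
      have h3 : (σ : ℝ) * θ < (i + 1) * θ := by linarith
      have h4 : σ < i + 1 := by exact_mod_cast lt_of_mul_lt_mul_right h3 hθ.le
      have h5 : σ ≤ i := by omega
      gcongr
    have h1 := h z hz x i hi hi' hiz
    have h2 := (abs_le.1 ((hγ t ht').2 x (i * θ))).2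
    have h3 : γ t * |x - i * θ| ≤ γ t * θ := by
      refine mul_le_mul_of_nonneg_left ?_ (hγ t ht').1
      rw [abs_le]; constructor <;> linarith
    have h4 := hM.psi_estimate hγ hθ t ht'
    rw [polV_of_le ht' hx, gridV_of_le hsi, hM.gridH_eq hθ ht, hM.phiBar_grid hθ ht' (grid_mul i),
      if_neg hsi.not_gt]
    linarith [h4.lower _ (grid_mul i), h4.le _ (grid_mul i)]

theorem Standing.policyBound_of_ae (hM : M.Standing) (hγ : M.LipschitzCosts γ) (ht : t < M.T)
    {x y c : ℝ} {g : Ω → ℝ} (hg : Integrable g M.P)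
    (hy : Integrable (fun ω => M.gridV θ (t + 1) (y - M.cell θ t ω * θ)) M.P)
    (h : ∀ᵐ ω ∂M.P, M.polV θ (t + 1) (x - M.D t ω) ≤
      M.gridV θ (t + 1) (y - M.cell θ t ω * θ) + (g ω + c)) :
    M.polJ θ t x ≤ M.gridJ θ t y + M.α * (∫ ω, g ω ∂M.P + c) := by
  have := hM.prob
  have i1 := hM.integrable_sub_demand ht (hM.polV_linearGrowth (θ := θ) hγ (t + 1)) x
  have i3 : Integrable (fun ω => g ω + c) M.P := hg.add (integrable_const c)
  have h1 := integral_mono_ae i1 (hy.add i3) h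
  rw [integral_add' hy i3, integral_add hg (integrable_const c)] at h1
  simp only [integral_const, probReal_univ, one_smul] at h1
  have h2 := mul_le_mul_of_nonneg_left h1 hM.α_pos.le
  rw [polJ, gridJ]
  linarith

/-- The factor $2$ in `epsBar` has two sources: one $\bar\varphi_{t+1}$ for the change of $C_{t+1}$
inside a cell, and one for the downward increment of $V_{t+1}$ when the true level falls one cell
below the rounded one. The final transition needs only the Lipschitz bound for $V_{T-1}$, hence a
single $\gamma_{T-1}\theta$. -/
theorem Standing.policyBound (hM : M.Standing) (hγ : M.LipschitzCosts γ) (hθ : 0 < θ) :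
    ∀ t, t + 1 < M.T → M.PolicyBound γ θ t := by
  have : ∀ t < M.T - 1, M.PolicyBound γ θ t := by
    refine backward_induction (fun t ht => ?_) fun t ht ih => ?_
    · have hT : t + 1 + 1 = M.T := by omega
      intro z hz x i hi hi' hiz
      have h1 := hM.policyBound_of_ae hγ (show t < M.T by omega) (θ := θ) (x := x) (y := i * θ)
        (c := γ (t + 1) * θ) (g := fun _ => 0) (integrable_zero _ _ _)
        (hM.integrable_grid hθ (by omega) gridV_constAtBot _) (Eventually.of_forall fun ω => by
          obtain ⟨hb1, hb2⟩ := cell_sub_bounds (M := M) (t := t) hθ hi hi' ω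
          have h2 := (abs_le.1 (hM.gridV_last_lipschitz (θ := θ) hγ hT (x - M.D t ω)
            (i * θ - M.cell θ t ω * θ))).2
          have h3 : γ (t + 1) * |x - M.D t ω - (i * θ - M.cell θ t ω * θ)| ≤ γ (t + 1) * θ := by
            refine mul_le_mul_of_nonneg_left ?_ (hγ (t + 1) (by omega)).1
            rw [abs_le]; constructor <;> linarith
          rw [polV_last hT]
          linarith)
      rw [epsBar_last hT]
      simpa using h1
    · have ht1 : t + 1 + 1 < M.T := by omega
      have ht' : t < M.T := by omega
      intro z hz x i hi hi' hiz
      have hSg := hM.S_mem_grid hθ (show t + 1 < M.T by omega)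
      have hmg := max_mem_grid hz hSg
      have hφ := hM.phi_estimate hγ hθ (show t + 1 < M.T by omega)
      have iφ := hM.integrable_grid hθ ht' (phiBar_constAtBot (M := M) (γ := γ) (θ := θ) (t := t + 1) θ)
        (i * θ)
      have h1 := hM.policyBound_of_ae hγ ht' (θ := θ) (x := x) (y := i * θ)
        -- The cell index is at least $-1$, so the next rounded level is at most $\theta$ above the
        -- current one; this is the recursion for $\lambda$.
        (c := M.epsBar γ θ (t + 1) (max z (M.S θ t) + θ))
        (g := fun ω => 2 * M.phiBar γ θ (t + 1) θ (i * θ - M.cell θ t ω * θ)) (iφ.const_mul 2)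
        (hM.integrable_grid hθ ht' gridV_constAtBot _) (by
          filter_upwards [hM.neg_one_le_cell hθ ht'] with ω hω
          obtain ⟨hb1, hb2⟩ := cell_sub_bounds (M := M) (t := t) hθ hi hi' ω
          have hcell : (-1 : ℝ) ≤ M.cell θ t ω := by exact_mod_cast hω
          have hcθ : -θ ≤ M.cell θ t ω * θ := by nlinarith
          have hwg : (i : ℝ) * θ - M.cell θ t ω * θ ∈ grid θ := grid_sub_mul (grid_mul i) _
          have e1 : ((i - M.cell θ t ω : ℤ) : ℝ) * θ = i * θ - M.cell θ t ω * θ := by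
            push_cast; ring
          have e2 : ((i - M.cell θ t ω - 1 : ℤ) : ℝ) * θ = i * θ - M.cell θ t ω * θ - θ := by
            push_cast; ring
          have hpos := (hφ.lower _ hwg).trans (hφ.le _ hwg)
          rcases le_or_gt ((i : ℝ) * θ - M.cell θ t ω * θ) (x - M.D t ω) with hc | hc
          · have h2 := ih.polV_le hM hγ hθ ht1 (x := x - M.D t ω) (i := i - M.cell θ t ω)
              (grid_add hmg) (by rw [e1]; exact hc) (by rw [add_mul, e1]; linarith)
              (by rw [e1]; exact le_max_of_le_left (by linarith))
            rw [e1] at h2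
            linarith
          · have h2 := ih.polV_le hM hγ hθ ht1 (x := x - M.D t ω) (i := i - M.cell θ t ω - 1)
              (grid_add hmg) (by rw [e2]; exact hb1) (by rw [add_mul, e2]; linarith)
              (by rw [e2]; exact le_max_of_le_left (by linarith))
            rw [e2] at h2
            linarith [(hM.increment_bound hγ hθ _ (show t + 1 < M.T by omega)).down _ hwg,
              hφ.mono_bar _ (grid_sub hwg) _ hwg (by linarith)])
      rw [integral_const_mul] at h1
      have h2 := hM.psiBar_eq (γ := γ) hθ (show t + 1 < M.T by omega) θ (i * θ)
      have h3 := (hM.psi_estimate hγ hθ t ht').mono_bar _ (grid_mul i) _ hmg hiz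
      rw [epsBar_succ (by omega)]
      linarith
  exact fun t ht => this t (by omega)

/-- The excess of the value of the approximate policy over the optimal value. -/
theorem Standing.polV_le_optV (hM : M.Standing) (hγ : M.LipschitzCosts γ) (hθ : 0 < θ)
    (ht : t + 1 < M.T) {x : ℝ} {k : ℤ} (hk : x ≤ k * θ) :
    M.polV θ t x - (M.omegaBar γ θ t (k * θ) + M.epsBar γ θ t (k * θ)) ≤ M.optV t x := by
  have ht' : t < M.T := by omega
  have hopt := (hM.invariant hθ t ht').opt
  have hA := hM.futureBound hγ hθ t ht
  have hB := hM.policyBound hγ hθ t ht (k * θ) (grid_mul k)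
  have hη := eta_le_omegaBar (γ := γ) (θ := θ) ht (k * θ)
  have hω := hM.omega_le_omegaBar hγ hθ ht (grid_mul k)
  have hSU := hM.S_le_SU hθ ht
  obtain ⟨j, hj⟩ := hM.S_mem_grid hθ ht
  obtain ⟨i, hi, hi', himax⟩ := exists_cell hθ x
  rcases lt_or_ge x (M.s θ t) with hx | hx
  · have h1 := hB (M.S θ t) j hj.ge (by rw [hj]; nlinarith) (by rw [← hj]; exact le_max_right _ _)
    rw [← hj] at h1
    have h2 := hM.gridH_eq hθ ht (M.S θ t)
    rw [polV_of_lt ht' hx]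
    refine hM.le_optV_of_le hγ hθ ht' ?_ fun _ y hxy hy => ?_
    · have h3 := hopt.below _ (grid_subset_levels (grid_mul i)) (hi.trans_lt hx)
      linarith [hA.gridH_le hM hγ hθ ht hi hi' ((hx.le.trans hopt.le).trans hSU)]
    · obtain ⟨n, hn, hn', -⟩ := exists_cell hθ y
      linarith [hA.gridH_le hM hγ hθ ht hn hn' hy,
        hopt.min _ (grid_subset_levels (grid_mul n))]
  · have hsi : M.s θ t ≤ i * θ := by
      obtain ⟨σ, hσ⟩ := hM.s_mem_grid hθ ht
      rw [hσ] at hx ⊢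
      exact himax σ hx
    have h1 := hB x i hi hi' (le_max_of_le_left (hi.trans hk))
    rw [polV_of_le ht' hx]
    refine hM.le_optV_of_le hγ hθ ht' ?_ fun hxC y hxy hy => ?_
    -- Both sides keep the same $x$, so $C_t$ is not rounded and only the two future errors remain.
    · linarith [hA x i k hi hi' hk]
    · obtain ⟨n, hn, hn', hnmax⟩ := exists_cell hθ y
      -- The policy waits while the rival orders. On the grid, waiting costs at most one setup more
      -- than any higher level, and for $x<C^m_t$ also $C_t(x)\le C_t(z_i)$.
      have h2 := hopt.above _ (grid_subset_levels (grid_mul i)) _ (grid_subset_levels (grid_mul n))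
        hsi (hnmax i (by linarith))
      have h3 := hM.gridH_eq hθ ht (i * θ)
      linarith [hA.gridH_le hM hγ hθ ht hn hn' hy, hM.C_anti ht' hi hxC.le]

end InventoryModel

/-- Independence makes the joint law a product, and Fubini then averages over $Y$ with $X$ frozen.
This is the Markov step of the dynamic program. -/
theorem LinearGrowth.integral_sub_indep {f : ℝ → ℝ} (hf : LinearGrowth f) {Ω : Type*}
    [MeasurableSpace Ω] {P : Measure Ω} [IsProbabilityMeasure P] {X Y : Ω → ℝ}
    (hXm : Measurable X) (hYm : Measurable Y) (hX : Integrable X P) (hY : Integrable Y P)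
    (hXY : IndepFun X Y P) :
    ∫ ω, f (X ω - Y ω) ∂P = ∫ ω, ∫ ω', f (X ω - Y ω') ∂P ∂P := by
  have hXa := hXm.aemeasurable (μ := P)
  have hYa := hYm.aemeasurable (μ := P)
  have hpair : Measurable fun ω => (X ω, Y ω) := hXm.prodMk hYm
  have hlaw := (indepFun_iff_map_prod_eq_prod_map_map hXa hYa).1 hXY
  have hfm : Measurable fun p : ℝ × ℝ => f (p.1 - p.2) :=
    hf.measurable.comp (measurable_fst.sub measurable_snd)
  have hg := hf.integral_sub hYm hY
  have h1 : ∫ ω, f (X ω - Y ω) ∂P = ∫ p, f (p.1 - p.2) ∂((P.map X).prod (P.map Y)) := by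
    rw [← hlaw, integral_map hpair.aemeasurable hfm.aestronglyMeasurable]
  have hi : Integrable (fun p : ℝ × ℝ => f (p.1 - p.2)) ((P.map X).prod (P.map Y)) := by
    rw [← hlaw, integrable_map_measure hfm.aestronglyMeasurable hpair.aemeasurable]
    exact hf.integrable_comp (hX.sub hY)
  have h2 : ∀ x, ∫ y, f (x - y) ∂(P.map Y) = ∫ ω', f (x - Y ω') ∂P := fun x =>
    integral_map hYa (hf.measurable.comp (measurable_const.sub measurable_id)).aestronglyMeasurable
  have := Measure.isProbabilityMeasure_map hXa
  have := Measure.isProbabilityMeasure_map hYa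
  rw [h1, integral_prod _ hi]
  simp only [h2]
  rw [integral_map hXa hg.measurable.aestronglyMeasurable]

namespace InventoryModel

variable {Ω : Type*} [MeasurableSpace Ω] {M : InventoryModel Ω} {γ : ℕ → ℝ} {θ : ℝ} {t : ℕ}
  {a : ℕ → ℝ → ℝ} {x : ℝ}

/-! ### Expected costs of policies -/

/-- The level of period $t$ is a function of the demands before $t$ alone, which makes it
independent of $D_t$. -/
theorem level_measurable_past (ha : ∀ t < M.T, Measurable (a t)) (x : ℝ) : ∀ t ≤ M.T,
    Measurable[⨆ i ∈ {i : Fin M.T | (i : ℕ) < t}, MeasurableSpace.comap (M.D i) inferInstance]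
      (M.level a x t) := by
  intro t
  induction t with
  | zero => exact fun _ => measurable_const
  | succ t ih =>
    intro ht
    have h1 : Measurable[⨆ i ∈ {i : Fin M.T | (i : ℕ) < t + 1},
        MeasurableSpace.comap (M.D i) inferInstance] (M.level a x t) :=
      (ih (by omega)).mono (biSup_mono fun i (hi : (i : ℕ) < t) => Nat.lt_succ_of_lt hi) le_rfl
    have h2 : Measurable[⨆ i ∈ {i : Fin M.T | (i : ℕ) < t + 1},
        MeasurableSpace.comap (M.D i) inferInstance] (M.D t) :=
      (comap_measurable (M.D t)).mono
        (le_iSup₂_of_le (⟨t, ht⟩ : Fin M.T) (Nat.lt_succ_self t) le_rfl) le_rfl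
    exact ((ha t ht).comp h1).sub h2

theorem Standing.past_le (hM : M.Standing) (i : Fin M.T) :
    MeasurableSpace.comap (M.D i) inferInstance ≤ (inferInstance : MeasurableSpace Ω) :=
  (hM.D_measurable i i.2).comap_le

theorem Standing.level_measurable (hM : M.Standing) (ha : ∀ t < M.T, Measurable (a t)) (x : ℝ)
    (ht : t ≤ M.T) : Measurable (M.level a x t) :=
  (level_measurable_past ha x t ht).mono (iSup₂_le fun i _ => hM.past_le i) le_rfl

theorem Standing.level_indep (hM : M.Standing) (ha : ∀ t < M.T, Measurable (a t)) (x : ℝ)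
    (ht : t < M.T) : IndepFun (M.level a x t) (M.D t) M.P := by
  rw [IndepFun_iff_Indep]
  have h := indep_iSup_of_disjoint hM.past_le hM.D_indep.iIndep
    (S := {i : Fin M.T | (i : ℕ) < t}) (T := {⟨t, ht⟩}) (by simp)
  refine indep_of_indep_of_le_right (indep_of_indep_of_le_left h
    (level_measurable_past ha x t ht.le).comap_le) ?_
  exact le_iSup₂_of_le (⟨t, ht⟩ : Fin M.T) rfl le_rfl

/-- The cost of period `t`, with the purchasing costs absorbed into `C`. -/
noncomputable def periodCost (M : InventoryModel Ω) (a : ℕ → ℝ → ℝ) (x : ℝ) (t : ℕ) (ω : Ω) : ℝ :=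
  M.K t * (if 0 < a t (M.level a x t ω) - M.level a x t ω then 1 else 0)
    + M.C t (a t (M.level a x t ω))

/-- The credit $-c_{t+1}x_{t+1}=-c_{t+1}(y_t-D_t)$ is charged to period $t$. This turns the costs
into $C_t(y_t)$ plus setup costs, a constant $-c_0x$, and centred demand terms that vanish in
expectation. -/
theorem totalCost_eq (a : ℕ → ℝ → ℝ) (x : ℝ) (ω : Ω) : M.totalCost a x ω =
    -(M.c 0) * x + ∑ t ∈ Finset.range M.T, M.α ^ t * M.periodCost a x t ω +
      ∑ t ∈ Finset.range M.T, M.α ^ t * (M.α * M.c (t + 1) * (M.D t ω - ∫ ω, M.D t ω ∂M.P)) := by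
  -- The identity holds at every truncation $n$, with salvage value $c_n$, which makes the induction
  -- possible.
  have : ∀ n, (∑ t ∈ Finset.range n, M.α ^ t *
    (M.K t * (if 0 < a t (M.level a x t ω) - M.level a x t ω then 1 else 0)
      + M.c t * (a t (M.level a x t ω) - M.level a x t ω)
      + M.G t (a t (M.level a x t ω))))
    + M.α ^ n * (-(M.c n) * M.level a x n ω) =
    -(M.c 0) * x + ∑ t ∈ Finset.range n, M.α ^ t * M.periodCost a x t ω +
      ∑ t ∈ Finset.range n, M.α ^ t * (M.α * M.c (t + 1) * (M.D t ω - ∫ ω, M.D t ω ∂M.P)) := by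
    intro n
    induction n with
    | zero => simp [level]
    | succ n ih =>
      rw [Finset.sum_range_succ, Finset.sum_range_succ, Finset.sum_range_succ, level]
      simp only [periodCost, C] at ih ⊢
      rw [pow_succ]
      linear_combination ih
  exact this M.T

/-- Along a policy, value functions that satisfy the one-period inequality are bounded by the
expected costs. -/
theorem Standing.value_le (hM : M.Standing) (ha : ∀ t < M.T, Measurable (a t))
    (hy : ∀ t < M.T, Integrable (fun ω => a t (M.level a x t ω)) M.P) {V : ℕ → ℝ → ℝ}
    (hV : ∀ t, LinearGrowth (V t)) (hVT : ∀ x, V M.T x = 0) {c : ℕ → Ω → ℝ}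
    (hc : ∀ t < M.T, Integrable (c t) M.P)
    (h : ∀ t < M.T, ∀ ω, V t (M.level a x t ω) ≤ c t ω +
      M.α * ∫ ω', V (t + 1) (a t (M.level a x t ω) - M.D t ω') ∂M.P) :
    V 0 x ≤ ∑ t ∈ Finset.range M.T, M.α ^ t * ∫ ω, c t ω ∂M.P := by
  have := hM.prob
  have hL : ∀ t ≤ M.T, Integrable (M.level a x t) M.P := by
    rintro (_ | t) ht
    · exact integrable_const x
    · exact (hy t ht).sub (hM.D_integrable t ht)
  have hstep : ∀ t < M.T, ∫ ω, V t (M.level a x t ω) ∂M.P ≤ ∫ ω, c t ω ∂M.P +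
      M.α * ∫ ω, V (t + 1) (M.level a x (t + 1) ω) ∂M.P := by
    intro t ht
    have hm := hM.level_measurable ha x ht.le
    have hind : IndepFun (fun ω => a t (M.level a x t ω)) (M.D t) M.P :=
      (hM.level_indep ha x ht).comp (ha t ht) measurable_id
    have h1 := (hV (t + 1)).integral_sub_indep ((ha t ht).comp hm) (hM.D_measurable t ht) (hy t ht)
      (hM.D_integrable t ht) hind
    have i2 : Integrable (fun ω => M.α *
        ∫ ω', V (t + 1) (a t (M.level a x t ω) - M.D t ω') ∂M.P) M.P :=
      (((hV (t + 1)).integral_sub (hM.D_measurable t ht)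
        (hM.D_integrable t ht)).integrable_comp (hy t ht)).const_mul M.α
    have h2 := integral_mono ((hV t).integrable_comp (hL t ht.le)) ((hc t ht).add i2) (h t ht)
    rw [integral_add' (hc t ht) i2, integral_const_mul] at h2
    simp only [Function.comp_apply] at h1
    rw [← h1] at h2
    exact h2
  have hsum : ∀ n ≤ M.T, V 0 x ≤ ∑ t ∈ Finset.range n, M.α ^ t * ∫ ω, c t ω ∂M.P +
      M.α ^ n * ∫ ω, V n (M.level a x n ω) ∂M.P := by
    intro n
    induction n with
    | zero => simp [level]
    | succ n ih =>
      intro hn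
      refine (ih (by omega)).trans ?_
      rw [Finset.sum_range_succ, pow_succ, add_assoc, mul_assoc, ← mul_add]
      have := mul_le_mul_of_nonneg_left (hstep n hn) (pow_nonneg hM.α_pos.le n)
      linarith
  simpa [hVT] using hsum M.T le_rfl

theorem Standing.integrable_noise (hM : M.Standing) :
    Integrable (fun ω => ∑ t ∈ Finset.range M.T,
      M.α ^ t * (M.α * M.c (t + 1) * (M.D t ω - ∫ ω, M.D t ω ∂M.P))) M.P ∧
    ∫ ω, ∑ t ∈ Finset.range M.T,
      M.α ^ t * (M.α * M.c (t + 1) * (M.D t ω - ∫ ω, M.D t ω ∂M.P)) ∂M.P = 0 := by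
  have := hM.prob
  have hi : ∀ t ∈ Finset.range M.T, Integrable (fun ω =>
      M.α ^ t * (M.α * M.c (t + 1) * (M.D t ω - ∫ ω, M.D t ω ∂M.P))) M.P := fun t ht =>
    (((hM.D_integrable t (Finset.mem_range.1 ht)).sub (integrable_const _)).const_mul _).const_mul _
  refine ⟨integrable_finsetSum _ hi, ?_⟩
  rw [integral_finsetSum _ hi]
  refine Finset.sum_eq_zero fun t ht => ?_
  rw [integral_const_mul, integral_const_mul,
    integral_sub (hM.D_integrable t (Finset.mem_range.1 ht)) (integrable_const _)]
  simp

theorem Standing.expectedCost_eq (hM : M.Standing)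
    (hc : ∀ t < M.T, Integrable (M.periodCost a x t) M.P) :
    Integrable (M.totalCost a x) M.P ∧ M.expectedCost a x =
      -(M.c 0) * x + ∑ t ∈ Finset.range M.T, M.α ^ t * ∫ ω, M.periodCost a x t ω ∂M.P := by
  have := hM.prob
  obtain ⟨hn, hn0⟩ := hM.integrable_noise
  have hi : ∀ t ∈ Finset.range M.T, Integrable (fun ω => M.α ^ t * M.periodCost a x t ω) M.P :=
    fun t ht => (hc t (Finset.mem_range.1 ht)).const_mul _
  have e := funext fun ω => totalCost_eq (M := M) a x ω
  have hs := integrable_finsetSum _ hi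
  have h1 : Integrable (fun ω => -(M.c 0) * x +
      ∑ t ∈ Finset.range M.T, M.α ^ t * M.periodCost a x t ω) M.P := (integrable_const _).add hs
  refine ⟨by rw [e]; exact h1.add hn, ?_⟩
  rw [expectedCost, e, integral_add h1 hn, hn0, integral_add (integrable_const _) hs,
    integral_finsetSum _ hi]
  simp [integral_const_mul]

/-- Admissibility gives integrability of the total only. Each period cost is bounded below by the
minimum of $C_t$, so no cancellation can occur and every summand is integrable. A coercive convex
function grows at least linearly, so the levels after ordering are integrable too. -/
theorem Standing.integrable_of_totalCost (hM : M.Standing) (ha : ∀ t < M.T, Measurable (a t))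
    (h : Integrable (M.totalCost a x) M.P) (ht : t < M.T) :
    Integrable (M.periodCost a x t) M.P ∧
      Integrable (fun ω => a t (M.level a x t ω)) M.P := by
  have := hM.prob
  have hα := hM.α_pos
  have hCm : ∀ t < M.T, Measurable fun ω => M.C t (a t (M.level a x t ω)) := fun t ht =>
    (hM.continuous_C ht).measurable.comp ((ha t ht).comp (hM.level_measurable ha x ht.le))
  have hδ : ∀ t < M.T, ∀ ω, 0 ≤ M.K t *
      (if 0 < a t (M.level a x t ω) - M.level a x t ω then (1 : ℝ) else 0) := fun t ht ω =>
    mul_nonneg (hM.K_nonneg t ht) (by split_ifs <;> norm_num)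
  have hpm : ∀ t < M.T, Measurable (M.periodCost a x t) := fun t ht => by
    have hm := hM.level_measurable ha x ht.le
    exact ((Measurable.ite (measurableSet_lt measurable_const
      (((ha t ht).comp hm).sub hm)) measurable_const measurable_const).const_mul _).add (hCm t ht)
  have hlow : ∀ t < M.T, ∀ ω, 0 ≤ M.periodCost a x t ω - M.C t (M.Cmin t) := fun t ht ω => by
    rw [periodCost]
    linarith [hδ t ht ω, hM.Cmin_le ht (a t (M.level a x t ω))]
  have hsum : Integrable (fun ω => ∑ t ∈ Finset.range M.T,
      M.α ^ t * (M.periodCost a x t ω - M.C t (M.Cmin t))) M.P := by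
    have e : (fun ω => ∑ t ∈ Finset.range M.T,
        M.α ^ t * (M.periodCost a x t ω - M.C t (M.Cmin t))) = fun ω =>
        (M.totalCost a x ω - ∑ t ∈ Finset.range M.T,
          M.α ^ t * (M.α * M.c (t + 1) * (M.D t ω - ∫ ω, M.D t ω ∂M.P))) -
        (-(M.c 0) * x + ∑ t ∈ Finset.range M.T, M.α ^ t * M.C t (M.Cmin t)) := by
      funext ω
      rw [totalCost_eq]
      simp only [mul_sub, Finset.sum_sub_distrib]
      ring
    rw [e]
    exact (h.sub hM.integrable_noise.1).sub (integrable_const _)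
  have hterm : Integrable (fun ω => M.α ^ t * (M.periodCost a x t ω - M.C t (M.Cmin t))) M.P := by
    refine hsum.mono' (((hpm t ht).sub_const _).const_mul _).aestronglyMeasurable
      (Eventually.of_forall fun ω => ?_)
    rw [Real.norm_of_nonneg (mul_nonneg (pow_nonneg hα.le t) (hlow t ht ω))]
    exact Finset.single_le_sum (f := fun t => M.α ^ t * (M.periodCost a x t ω - M.C t (M.Cmin t)))
      (fun s hs => mul_nonneg (pow_nonneg hα.le s) (hlow s (Finset.mem_range.1 hs) ω))
      (Finset.mem_range.2 ht)
  have hexc : Integrable (fun ω => M.periodCost a x t ω - M.C t (M.Cmin t)) M.P := by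
    have := hterm.const_mul (M.α ^ t)⁻¹
    simpa only [inv_mul_cancel_left₀ (pow_pos hα t).ne'] using this
  have hper : Integrable (M.periodCost a x t) M.P := by
    have := hexc.add (integrable_const (M.C t (M.Cmin t)))
    simpa [Pi.add_def] using this
  refine ⟨hper, ?_⟩
  have hC : Integrable (fun ω => M.C t (a t (M.level a x t ω)) - M.C t (M.Cmin t)) M.P := by
    refine hexc.mono' ((hCm t ht).sub_const _).aestronglyMeasurable
      (Eventually.of_forall fun ω => ?_)
    rw [Real.norm_of_nonneg (sub_nonneg.2 (hM.Cmin_le ht _)), periodCost]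
    linarith [hδ t ht ω]
  have hC' : Integrable (fun ω => M.C t (a t (M.level a x t ω))) M.P := by
    have := hC.add (integrable_const (M.C t (M.Cmin t)))
    simpa [Pi.add_def] using this
  obtain ⟨A, -, hA⟩ := (hM.C_convex t ht).exists_abs_le (hM.C_atTop t ht) (hM.C_atBot t ht)
  exact (((integrable_const (1 : ℝ)).add hC'.abs).const_mul A).mono'
    ((ha t ht).comp (hM.level_measurable ha x ht.le)).aestronglyMeasurable
    (Eventually.of_forall fun ω => hA _)

/-! ### Optimal and approximate expected costs as value functions. -/

theorem Standing.optV_le_expectedCost (hM : M.Standing) (hγ : M.LipschitzCosts γ)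
    (h : M.Admissible a x) : M.optV 0 x - M.c 0 * x ≤ M.expectedCost a x := by
  obtain ⟨ha, hle, hi⟩ := h
  have hint := fun t ht => hM.integrable_of_totalCost (t := t) ha hi ht
  rw [(hM.expectedCost_eq fun t ht => (hint t ht).1).2]
  have := hM.value_le (V := M.optV) (c := M.periodCost a x) ha (fun t ht => (hint t ht).2)
    (fun t => (hM.optV_regular hγ t).linearGrowth) (fun x => optV_of_ge le_rfl x)
    (fun t ht => (hint t ht).1) fun t ht ω => by
      have := hM.optV_le hγ ht (hle t ht (M.level a x t ω))
      rw [optJ] at this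
      rw [periodCost, mul_ite, mul_one, mul_zero]
      linarith
  linarith

theorem Standing.approxPolicy_admissible (hM : M.Standing) (hγ : M.LipschitzCosts γ) (hθ : 0 < θ)
    (x : ℝ) : M.Admissible (M.approxPolicy θ) x ∧
      M.approxCost θ x = M.polV θ 0 x - M.c 0 * x := by
  have := hM.prob
  have hgrow : ∀ t, LinearGrowth (M.approxPolicy θ t) := fun t =>
    (LinearGrowth.const _).ite_lt (.of_lipschitz zero_le_one fun x y => by rw [one_mul]) _
  have ha : ∀ t < M.T, Measurable (M.approxPolicy θ t) := fun t _ => (hgrow t).measurable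
  have hle : ∀ t < M.T, ∀ y, y ≤ M.approxPolicy θ t y := fun t ht y => by
    rw [approxPolicy]
    split_ifs with h
    · exact h.le.trans (hM.s_le_S hθ ht)
    · exact le_rfl
  have hL : ∀ t ≤ M.T, Integrable (M.level (M.approxPolicy θ) x t) M.P := by
    intro t
    induction t with
    | zero => exact fun _ => integrable_const x
    | succ t ih =>
      exact fun ht => ((hgrow t).integrable_comp (ih (by omega))).sub (hM.D_integrable t ht)
  have hy : ∀ t < M.T, Integrable (fun ω => M.approxPolicy θ t
      (M.level (M.approxPolicy θ) x t ω)) M.P := fun t ht => (hgrow t).integrable_comp (hL t ht.le)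
  have hc : ∀ t < M.T, Integrable (M.periodCost (M.approxPolicy θ) x t) M.P := fun t ht => by
    have hm := hM.level_measurable ha x ht.le
    have hC : LinearGrowth (M.C t) := .of_lipschitz (hγ t ht).1 (hγ t ht).2
    refine Integrable.add ?_ (hC.integrable_comp (hy t ht))
    refine Integrable.const_mul (Integrable.of_bound (C := 1) (Measurable.ite (measurableSet_lt
      measurable_const (((ha t ht).comp hm).sub hm)) measurable_const
      measurable_const).aestronglyMeasurable (Eventually.of_forall fun ω => ?_)) _
    split_ifs <;> simp
  obtain ⟨hi, he⟩ := hM.expectedCost_eq hc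
  refine ⟨⟨ha, hle, hi⟩, ?_⟩
  have hpt : ∀ t < M.T, ∀ ω, M.polV θ t (M.level (M.approxPolicy θ) x t ω) =
      M.periodCost (M.approxPolicy θ) x t ω + M.α * ∫ ω', M.polV θ (t + 1)
        (M.approxPolicy θ t (M.level (M.approxPolicy θ) x t ω) - M.D t ω') ∂M.P := by
    intro t ht ω
    rw [periodCost]
    rcases lt_or_ge (M.level (M.approxPolicy θ) x t ω) (M.s θ t) with h | h
    · have e : M.approxPolicy θ t (M.level (M.approxPolicy θ) x t ω) = M.S θ t := if_pos h
      rw [e, polV_of_lt ht h, if_pos (by linarith [hM.s_le_S hθ ht]), polJ]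
      ring
    · have e : M.approxPolicy θ t (M.level (M.approxPolicy θ) x t ω)
        = M.level (M.approxPolicy θ) x t ω := if_neg h.not_gt
      rw [e, polV_of_le ht h, if_neg (by simp), polJ]
      ring
  have hpol := fun t => hM.polV_linearGrowth (θ := θ) hγ t
  have h1 := hM.value_le (V := M.polV θ) ha hy hpol
    (fun x => by rw [polV_of_ge le_rfl]) hc fun t ht ω => (hpt t ht ω).le
  -- The one-period relation is an equality for this policy, so the inequality also applies to the
  -- negatives; together they give equality.
  have h2 := hM.value_le (V := fun t x => -1 * M.polV θ t x)
    (c := fun t ω => -1 * M.periodCost (M.approxPolicy θ) x t ω) ha hy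
    (fun t => (hpol t).const_mul (-1)) (fun x => by rw [polV_of_ge le_rfl, mul_zero])
    (fun t ht => (hc t ht).const_mul (-1)) fun t ht ω => by
      rw [hpt t ht ω, integral_const_mul]
      linarith
  simp only [integral_const_mul, mul_left_comm _ (-1 : ℝ), ← Finset.mul_sum] at h2
  rw [approxCost, he]
  linarith

theorem Standing.abs_approxCost_sub_le (hM : M.Standing) (hγ : M.LipschitzCosts γ) (hθ : 0 < θ)
    {b : ℝ} (hb : M.polV θ 0 x - b ≤ M.optV 0 x) :
    |M.approxCost θ x - M.optimalCost x| ≤ b := by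
  obtain ⟨hadm, heq⟩ := hM.approxPolicy_admissible hγ hθ x
  have hlow : ∀ r ∈ {r : ℝ | ∃ a : ℕ → ℝ → ℝ, M.Admissible a x ∧ r = M.expectedCost a x},
      M.optV 0 x - M.c 0 * x ≤ r := by
    rintro r ⟨a, ha, rfl⟩
    exact hM.optV_le_expectedCost hγ ha
  have h1 : M.optimalCost x ≤ M.approxCost θ x := csInf_le ⟨_, hlow⟩ ⟨_, hadm, rfl⟩
  have h2 : M.optV 0 x - M.c 0 * x ≤ M.optimalCost x := le_csInf ⟨_, _, hadm, rfl⟩ hlow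
  rw [abs_of_nonneg (sub_nonneg.2 h1)]
  linarith

end InventoryModel

namespace InventoryModel

variable {Ω : Type*} [MeasurableSpace Ω] {M : InventoryModel Ω} {γ : ℕ → ℝ} {θ : ℝ} {t : ℕ}

/-! ### Explicit bounds -/

theorem F_nonneg (y : ℝ) : 0 ≤ M.F t y := measureReal_nonneg

theorem Standing.prodF_le_one (hM : M.Standing) (n : ℕ) (y : ℝ) : M.prodF θ t n y ≤ 1 := by
  have := hM.prob
  exact Finset.prod_le_one (fun _ _ => F_nonneg _) fun _ _ => measureReal_le_one

theorem prodF_succ (n : ℕ) (y : ℝ) : M.prodF θ t (n + 1) y =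
    M.F t (y + θ - M.s θ (t + 1)) * M.prodF θ (t + 1) n (y + θ) := by
  rw [prodF, Finset.prod_range_succ', prodF, mul_comm]
  congr 1
  · simp
  · refine Finset.prod_congr rfl fun m _ => ?_
    rw [show t + (m + 1) = t + 1 + m by omega]
    congr 1
    push_cast
    ring

/-- $\bar\varphi_{t+1}$ is nonzero only if the rounded next level reaches $s_{t+1}$, which forces
$D_t\le z+\theta-s_{t+1}$. On that event $\bar\psi_{t+1}$ is at most its value at the highest
possible level $z+\theta$. -/
theorem Standing.psiBar_le_step (hM : M.Standing) (hγ : M.LipschitzCosts γ) (hθ : 0 < θ)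
    (ht : t + 1 < M.T) {z : ℝ} (hz : z ∈ grid θ) : M.psiBar γ θ t θ z ≤
      γ t * θ + M.α * (M.F t (z + θ - M.s θ (t + 1)) * M.psiBar γ θ (t + 1) θ (z + θ)) := by
  have := hM.prob
  have ht' : t < M.T := by omega
  have hD := hM.D_measurable t ht'
  have h1 := hM.psi_estimate hγ hθ (t + 1) ht
  have hpos : ∀ w ∈ grid θ, 0 ≤ M.psiBar γ θ (t + 1) θ w := fun w hw =>
    (mul_nonneg (hγ _ ht).1 hθ.le).trans ((h1.lower w hw).trans (h1.le w hw))
  have hset : MeasurableSet {ω | M.D t ω ≤ z + θ - M.s θ (t + 1)} :=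
    measurableSet_le hD measurable_const
  have key : ∫ ω, M.phiBar γ θ (t + 1) θ (z - M.cell θ t ω * θ) ∂M.P ≤
      ∫ ω, {ω | M.D t ω ≤ z + θ - M.s θ (t + 1)}.indicator
        (fun _ => M.psiBar γ θ (t + 1) θ (z + θ)) ω ∂M.P := by
    refine integral_mono_ae (hM.integrable_grid hθ ht' (phiBar_constAtBot θ) z)
      ((integrable_const _).indicator hset) ?_
    filter_upwards [hM.neg_one_le_cell hθ ht'] with ω hω
    have hcell : (-1 : ℝ) ≤ M.cell θ t ω := by exact_mod_cast hω
    have hwg := grid_sub_mul hz (M.cell θ t ω)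
    rw [hM.phiBar_grid hθ ht hwg]
    split_ifs with h
    · exact Set.indicator_nonneg (fun _ _ => hpos _ (grid_add hz)) ω
    · have h2 := le_cell (M := M) (t := t) hθ ω
      rw [Set.indicator_of_mem (show ω ∈ {ω | M.D t ω ≤ z + θ - M.s θ (t + 1)} from
        show M.D t ω ≤ _ by linarith)]
      exact h1.mono_bar _ hwg _ (grid_add hz) (by nlinarith)
  rw [integral_indicator_const _ hset, smul_eq_mul] at key
  rw [hM.psiBar_eq hθ ht]
  exact add_le_add le_rfl (mul_le_mul_of_nonneg_left key hM.α_pos.le)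

/-- The sum over `n ≥ 1` that bounds `(ψ̄_t(θ, y) - γ_t θ) / θ`. -/
noncomputable def tailSum (M : InventoryModel Ω) (γ : ℕ → ℝ) (θ : ℝ) (t : ℕ) (y : ℝ) : ℝ :=
  ∑ n ∈ Finset.Icc 1 (M.T - 1 - t), M.α ^ n * γ (t + n) * M.prodF θ t n y

theorem sum_Icc_one {f : ℕ → ℝ} (N : ℕ) :
    ∑ n ∈ Finset.Icc 1 N, f n = ∑ n ∈ Finset.range N, f (n + 1) := by
  rw [← Finset.Ico_add_one_right_eq_Icc, Finset.sum_Ico_eq_sum_range]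
  simp [add_comm]

theorem tailSum_succ (ht : t + 1 < M.T) (y : ℝ) : M.tailSum γ θ t y =
    M.α * (M.F t (y + θ - M.s θ (t + 1)) * (γ (t + 1) + M.tailSum γ θ (t + 1) (y + θ))) := by
  rw [tailSum, sum_Icc_one, tailSum, sum_Icc_one,
    show M.T - 1 - t = (M.T - 1 - (t + 1)) + 1 by omega, Finset.sum_range_succ', mul_add, mul_add,
    Finset.mul_sum, Finset.mul_sum, add_comm]
  congr 1
  · simp only [zero_add, pow_one, prodF_succ]
    simp [prodF]
    ring
  · refine Finset.sum_congr rfl fun n _ => ?_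
    rw [prodF_succ, pow_succ' M.α (n + 1), show t + (n + 1 + 1) = t + 1 + (n + 1) by omega]
    ring

theorem Standing.psiBar_le_tailSum (hM : M.Standing) (hγ : M.LipschitzCosts γ) (hθ : 0 < θ) :
    ∀ t < M.T, ∀ z ∈ grid θ, M.psiBar γ θ t θ z ≤ γ t * θ + θ * M.tailSum γ θ t z := by
  refine backward_induction (fun t ht z _ => ?_) fun t ht ih z hz => ?_
  · rw [psiBar_last ht, tailSum, show M.T - 1 - t = 0 by omega]
    simp
  · refine (hM.psiBar_le_step hγ hθ ht hz).trans ?_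
    have h1 := ih _ (grid_add hz)
    have h2 := mul_le_mul_of_nonneg_left (mul_le_mul_of_nonneg_left h1
      (F_nonneg (M := M) (t := t) (z + θ - M.s θ (t + 1)))) hM.α_pos.le
    rw [tailSum_succ ht]
    linarith

theorem Standing.lam_mem_grid (hM : M.Standing) (hθ : 0 < θ) {z : ℝ} (hz : z ∈ grid θ) {i : ℕ}
    (hi : t + i < M.T) : M.lam θ t z i ∈ grid θ := by
  induction i with
  | zero => exact hz
  | succ i ih =>
    exact grid_add (max_mem_grid (ih (by omega)) (hM.S_mem_grid hθ (by omega)))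

theorem Standing.epsBar_le_Ueps (hM : M.Standing) (hγ : M.LipschitzCosts γ) (hθ : 0 < θ)
    {z : ℝ} (hz : z ∈ grid θ) : M.epsBar γ θ t z ≤ M.Ueps γ θ t z := by
  rw [epsBar_eq_sum, Ueps]
  refine add_le_add le_rfl ?_
  rw [Finset.mul_sum]
  refine Finset.sum_le_sum fun i hi => ?_
  rw [Finset.mem_range] at hi
  have h1 := hM.psiBar_le_tailSum hγ hθ (t + i) (by omega) _
    (max_mem_grid (hM.lam_mem_grid (t := t) hθ hz (i := i) (by omega))
      (hM.S_mem_grid (t := t + i) hθ (by omega)))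
  have e : ∑ n ∈ Finset.Icc 1 (M.T - 1 - t - i), M.α ^ (n + i) * γ (t + i + n) *
      M.prodF θ (t + i) n (max (M.lam θ t z i) (M.S θ (t + i))) =
      M.α ^ i * M.tailSum γ θ (t + i) (max (M.lam θ t z i) (M.S θ (t + i))) := by
    rw [tailSum, Finset.mul_sum, show M.T - 1 - t - i = M.T - 1 - (t + i) by omega]
    exact Finset.sum_congr rfl fun n _ => by ring
  rw [e]
  have h2 := mul_le_mul_of_nonneg_left h1 (pow_nonneg hM.α_pos.le i)
  linarith

/-! ### Explicit bound for `omegaBar`, and the bounds that are free of the demand distributions. -/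

theorem mu_succ (z : ℝ) (i : ℕ) :
    M.mu θ t z (i + 1) = M.mu θ (t + 1) (max z (M.SU θ t) + θ) i := by
  induction i with
  | zero => rw [mu, mu, mu, add_zero]
  | succ i ih =>
    rw [mu, ih]
    conv_rhs => rw [mu]
    congr 3
    omega

theorem Uomega_eq (z : ℝ) : M.Uomega γ θ t z = θ * ∑ i ∈ Finset.range (M.T - 1 - t), M.α ^ i *
    (γ (t + i) + (M.tailSum γ θ (t + i) (M.SU θ (t + i)) +
      M.tailSum γ θ (t + i) (max (M.mu θ t z i) (M.SU θ (t + i))))) := by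
  rw [Uomega, ← mul_add, ← Finset.sum_add_distrib]
  congr 1
  refine Finset.sum_congr rfl fun i _ => ?_
  rw [mul_add, tailSum, tailSum, ← Finset.sum_add_distrib, Finset.mul_sum,
    show M.T - 1 - t - i = M.T - 1 - (t + i) by omega]
  congr 1
  exact Finset.sum_congr rfl fun n _ => by ring

theorem Uomega_succ (ht : t + 1 < M.T) (z : ℝ) : M.Uomega γ θ t z =
    θ * (γ t + (M.tailSum γ θ t (M.SU θ t) + M.tailSum γ θ t (max z (M.SU θ t)))) +
      M.α * M.Uomega γ θ (t + 1) (max z (M.SU θ t) + θ) := by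
  rw [Uomega_eq, Uomega_eq, show M.T - 1 - t = (M.T - 1 - (t + 1)) + 1 by omega,
    Finset.sum_range_succ', mul_add, add_comm, mul_left_comm M.α]
  congr 1
  · simp [mu]
  · rw [Finset.mul_sum _ _ M.α]
    congr 1
    refine Finset.sum_congr rfl fun i _ => ?_
    rw [mu_succ, show t + (i + 1) = t + 1 + i by omega, pow_succ']
    ring

/-- The next rounded level is at most $z+\theta$ and $\bar\omega_{t+1}$ is monotone on the grid, so
the expectation is replaced by the value there. -/
theorem Standing.omega_le_step (hM : M.Standing) (hγ : M.LipschitzCosts γ) (hθ : 0 < θ)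
    (ht : t + 1 < M.T) {z : ℝ} (hz : z ∈ grid θ) : M.omega γ θ t z ≤
      θ * M.tailSum γ θ t z + M.α * M.omegaBar γ θ (t + 1) (z + θ) := by
  have := hM.prob
  have ht' : t < M.T := by omega
  have h1 := (hM.psi_estimate hγ hθ t ht').le z hz
  have h2 := hM.psiBar_le_tailSum hγ hθ t ht' z hz
  have h3 : ∫ ω, M.omegaBar γ θ (t + 1) (z - M.cell θ t ω * θ) ∂M.P ≤
      ∫ _, M.omegaBar γ θ (t + 1) (z + θ) ∂M.P := by
    refine integral_mono_ae (hM.integrable_grid hθ ht' omegaBar_constAtBot z)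
      (integrable_const _) ?_
    filter_upwards [hM.neg_one_le_cell hθ ht'] with ω hω
    have hcell : (-1 : ℝ) ≤ M.cell θ t ω := by exact_mod_cast hω
    exact (hM.omegaBar_estimate hγ hθ _ ht).mono _ (grid_sub_mul hz _) _ (grid_add hz)
      (by nlinarith)
  simp only [integral_const, probReal_univ, one_smul] at h3
  have h4 := mul_le_mul_of_nonneg_left h3 hM.α_pos.le
  rw [hM.omega_eq hθ ht]
  linarith

theorem Standing.omegaBar_le_Uomega (hM : M.Standing) (hγ : M.LipschitzCosts γ) (hθ : 0 < θ) :
    ∀ t < M.T, ∀ z ∈ grid θ, M.omegaBar γ θ t z ≤ M.Uomega γ θ t z := by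
  refine backward_induction (fun t ht z _ => ?_) fun t ht ih z hz => ?_
  · rw [omegaBar_last ht, Uomega_eq, show M.T - 1 - t = 0 by omega]
    simp
  · have ht' : t < M.T := by omega
    have hU := hM.SU_mem_grid hθ ht'
    have hmg := max_mem_grid hz hU
    have hω := hM.omega_estimate hγ hθ ht
    have hUU := hM.psi_estimate hγ hθ t ht'
    have hpos : 0 ≤ M.psiBar γ θ t θ (M.SU θ t) :=
      (mul_nonneg (hγ t ht').1 hθ.le).trans ((hUU.lower _ hU).trans (hUU.le _ hU))
    -- Both branches of $\bar\omega_t$ are dominated by one expression: the term at $S^U_t$ produces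
    -- the first product in $U^\omega$, the one at $\max(z,S^U_t)$ the second.
    have h1 : M.omegaBar γ θ t z ≤
        M.psiBar γ θ t θ (M.SU θ t) + M.omega γ θ t (max z (M.SU θ t)) := by
      have hη : M.eta γ θ t ≤
          M.psiBar γ θ t θ (M.SU θ t) + M.omega γ θ t (max z (M.SU θ t)) := by
        rw [eta]
        linarith [hω.mono _ hU _ hmg (le_max_right _ _)]
      rw [omegaBar_of_lt ht]
      split_ifs
      · exact hη
      · refine max_le hη ?_
        linarith [hω.mono _ hz _ hmg (le_max_left _ _)]
    have h2 := hM.omega_le_step hγ hθ ht hmg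
    have h3 := hM.psiBar_le_tailSum hγ hθ t ht' _ hU
    have h4 := mul_le_mul_of_nonneg_left (ih _ (grid_add hmg)) hM.α_pos.le
    rw [Uomega_succ ht]
    linarith

theorem Standing.Ueps_le (hM : M.Standing) (hγ : M.LipschitzCosts γ) (hθ : 0 < θ) (z : ℝ) :
    M.Ueps γ θ t z ≤ M.UepsBar γ t θ := by
  rw [Ueps, UepsBar]
  refine add_le_add le_rfl (mul_le_mul_of_nonneg_left (Finset.sum_le_sum fun i hi =>
    Finset.sum_le_sum fun n hn => ?_) (by positivity))
  rw [Finset.mem_range] at hi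
  rw [Finset.mem_Icc] at hn
  exact mul_le_of_le_one_right (mul_nonneg (pow_nonneg hM.α_pos.le _) (hγ (t + i + n) (by omega)).1)
    (hM.prodF_le_one _ _)

theorem Standing.Uomega_le (hM : M.Standing) (hγ : M.LipschitzCosts γ) (hθ : 0 < θ) (z : ℝ) :
    M.Uomega γ θ t z ≤ M.UomegaBar γ t θ := by
  rw [Uomega, UomegaBar]
  refine add_le_add le_rfl ?_
  rw [mul_comm 2 θ, mul_assoc, Finset.mul_sum _ _ 2]
  gcongr with i hi
  rw [Finset.mul_sum]
  refine Finset.sum_le_sum fun n hn => ?_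
  rw [Finset.mem_range] at hi
  rw [Finset.mem_Icc] at hn
  rw [mul_comm 2]
  refine mul_le_mul_of_nonneg_left ?_
    (mul_nonneg (pow_nonneg hM.α_pos.le _) (hγ (t + i + n) (by omega)).1)
  linarith [hM.prodF_le_one (θ := θ) (t := t + i) n (M.SU θ (t + i)),
    hM.prodF_le_one (θ := θ) (t := t + i) n (max (M.mu θ t z i) (M.SU θ (t + i)))]

theorem tendsto_UomegaBar : Tendsto (fun θ : ℝ => M.UomegaBar γ t θ) (𝓝[>] 0) (𝓝 0) := by
  refine (Continuous.tendsto' ?_ _ _ ?_).mono_left nhdsWithin_le_nhds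
  · unfold UomegaBar; fun_prop
  · simp [UomegaBar]

theorem tendsto_UepsBar : Tendsto (fun θ : ℝ => M.UepsBar γ t θ) (𝓝[>] 0) (𝓝 0) := by
  refine (Continuous.tendsto' ?_ _ _ ?_).mono_left nhdsWithin_le_nhds
  · unfold UepsBar; fun_prop
  · simp [UepsBar]

end InventoryModel

theorem theorem4p6 {Ω : Type*} [MeasurableSpace Ω] (M : InventoryModel Ω) (hM : M.Standing)
    (hT : 2 ≤ M.T) (γ : ℕ → ℝ) (hγ : M.LipschitzCosts γ) :
    (∀ θ : ℝ, 0 < θ → ∀ (k : ℤ) (x : ℝ),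
      ((k - 1 : ℤ) : ℝ) * θ < x → x ≤ (k : ℝ) * θ →
        |M.approxCost θ x - M.optimalCost x|
            ≤ M.omegaBar γ θ 0 ((k : ℝ) * θ) + M.epsBar γ θ 0 ((k : ℝ) * θ) ∧
        M.omegaBar γ θ 0 ((k : ℝ) * θ) + M.epsBar γ θ 0 ((k : ℝ) * θ)
            ≤ M.Uomega γ θ 0 ((k : ℝ) * θ) + M.Ueps γ θ 0 ((k : ℝ) * θ) ∧
        M.Uomega γ θ 0 ((k : ℝ) * θ) + M.Ueps γ θ 0 ((k : ℝ) * θ)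
            ≤ M.UomegaBar γ 0 θ + M.UepsBar γ 0 θ) ∧
    Tendsto (fun θ : ℝ => M.UomegaBar γ 0 θ) (𝓝[>] 0) (𝓝 0) ∧
    Tendsto (fun θ : ℝ => M.UepsBar γ 0 θ) (𝓝[>] 0) (𝓝 0) ∧
    TendstoUniformly (fun (θ : ℝ) (x : ℝ) => M.approxCost θ x) M.optimalCost (𝓝[>] 0) := by
  have key : ∀ θ : ℝ, 0 < θ → ∀ (k : ℤ) (x : ℝ), x ≤ (k : ℝ) * θ →
        |M.approxCost θ x - M.optimalCost x|
            ≤ M.omegaBar γ θ 0 ((k : ℝ) * θ) + M.epsBar γ θ 0 ((k : ℝ) * θ) ∧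
        M.omegaBar γ θ 0 ((k : ℝ) * θ) + M.epsBar γ θ 0 ((k : ℝ) * θ)
            ≤ M.Uomega γ θ 0 ((k : ℝ) * θ) + M.Ueps γ θ 0 ((k : ℝ) * θ) ∧
        M.Uomega γ θ 0 ((k : ℝ) * θ) + M.Ueps γ θ 0 ((k : ℝ) * θ)
            ≤ M.UomegaBar γ 0 θ + M.UepsBar γ 0 θ := fun θ hθ k x hk =>
    ⟨hM.abs_approxCost_sub_le hγ hθ (hM.polV_le_optV hγ hθ (by omega) hk),
      add_le_add (hM.omegaBar_le_Uomega hγ hθ 0 (by omega) _ (InventoryModel.grid_mul k))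
        (hM.epsBar_le_Ueps hγ hθ (InventoryModel.grid_mul k)),
      add_le_add (hM.Uomega_le hγ hθ _) (hM.Ueps_le hγ hθ _)⟩
  refine ⟨fun θ hθ k x _ hk => key θ hθ k x hk, InventoryModel.tendsto_UomegaBar,
    InventoryModel.tendsto_UepsBar, ?_⟩
  rw [Metric.tendstoUniformly_iff]
  intro ε hε
  have hlim : Tendsto (fun θ : ℝ => M.UomegaBar γ 0 θ + M.UepsBar γ 0 θ) (𝓝[>] 0) (𝓝 0) := by
    simpa using (InventoryModel.tendsto_UomegaBar (M := M) (γ := γ) (t := 0)).add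
      InventoryModel.tendsto_UepsBar
  filter_upwards [hlim.eventually_lt_const hε, self_mem_nhdsWithin] with θ hθε hθ x
  have hθ' : (0 : ℝ) < θ := hθ
  have hx : x ≤ (⌈x / θ⌉ : ℝ) * θ := by
    rw [← div_le_iff₀ hθ']; exact Int.le_ceil _
  -- The index $k$ depends on $x$, but the last bound depends on neither $k$ nor $x$; hence the
  -- convergence is uniform.
  obtain ⟨h1, h2, h3⟩ := key θ hθ' ⌈x / θ⌉ x hx
  rw [dist_comm, Real.dist_eq]
  linarith
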